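/- Fix $\mathcal S\ge 1$, selectors $Sel=\{1,\dots,\mathcal S\}$, a countably infinite set $PVar$ of pointer variables with a designated variable $nil$, and a countably infinite set $Loc$ of locations with a designated element $null$. A state $S=\langle s,h\rangle$ consists of a partial function $s:PVar\rightharpoonup Loc$ with $s(nil)=null$ and a finite partial function $h:Loc\rightharpoonup_{fin}(Sel\rightharpoonup Loc)$ with $null\notin dom(h)$ and $h(\ell)$ non-empty for every $\ell\in dom(h)$. Separation logic formulas. $\alpha\mapsto(\beta_1,\dots,\beta_n)$ ($n\ge1$) holds if $dom(h)$ consists of the single location denoted by $\alpha$, whose outgoing selectors are exactly $1,\dots,n$, selector $k$ leading to the location denoted by $\beta_k$; $emp$ holds if $dom(h)=\emptyset$; $\varphi_1*\varphi_2$ holds in $S$ if $S$ is the union of two states with compatible stores and heaps of disjoint domains that satisfy $\varphi_1$ and $\varphi_2$ respectively; $=,\neq,\wedge,\exists$ are classical, and an atom with an undefined variable is false. A system $\mathcal P$ of recursive definitions is a finite list of predicates $P_i(\vec x_i)$, each with finitely many rules $R(\vec x_i)\equiv\exists\vec z.\ \Sigma*P_{i_1}(\vec y_1)*\dots*P_{i_m}(\vec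 y_m)\wedge\Pi$, where the head $\Sigma$ is a separating conjunction of points-to atoms, $\Pi$ is a conjunction of equalities and disequalities, $\vec z\cap\vec x_i=\emptyset$, and all variables are logical variables in $\vec x_i\cup\vec z$. An unfolding tree rooted at $i$ is a finite tree whose root is labelled by a rule $R$ of $P_i$ and has, for each predicate occurrence $P_{i_j}(\vec y_j)$ of $R$ in order, a child that is the root of an unfolding tree rooted at $i_j$. Its characteristic formula $\phi_t=\phi_t^\epsilon$ is given by $\phi_t^p\equiv\exists\vec z^p.\ \Sigma^p*\bigstar_{j}[\exists\vec x_{i_j}^{p.j}.\ \phi_t^{p.j}\wedge\vec y_j^{\,p}=\vec x_{i_j}^{p.j}]\wedge\Pi^p$, where $R$ labels $p$ and $x^p$ is a copy of $x$ for the position $p$. $P_i(\vec y)$ holds in a state if, for some unfolding tree $t$ rooted at $i$, $\phi_t$ holds with $\vec x_i^\epsilon$ interpreted by the values of $\vec y$. A formula over $\mathcal P$ is of the form $\varphi\equiv\exists\vec z.\ \phi*P_{i_1}(\vec y_1)*\dots*P_{i_n}(\vec y_n)$, where $\phi$ is a basic formula $\exists\vec x.\ \pi\wedge\sigma$ with $\pi$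 a conjunction of equalities and disequalities and $\sigma$ a separating conjunction of points-to atoms; it is closed if it has no free logical variables (pointer variables may occur). $\varphi$ is an $\mathrm{SLRD}_{btw}$ formula if $\mathcal P$ satisfies the following, where $\Pi^*$ is the closure of $\Pi$ under reflexivity, symmetry and transitivity of equality. (1) Progress: the head of every rule is a single points-to atom $\alpha\mapsto(\beta_1,\dots,\beta_n)$. (2) Connectivity: for every rule and every predicate occurrence $P_{i_j}(\vec y_j)$ in it there are $s,t$ such that $\beta_t=(\vec y_j)_s$ is in $\Pi^*$ and the $s$-th parameter of $P_{i_j}$ is allocated (occurs to the left of $\mapsto$) in the heads of all rules of $P_{i_j}$. (3) Establishment: every existentially quantified variable of a rule is allocated in that rule. Here a variable $x$ is allocated in a rule if it is allocated in the head, or if $(\vec y_\ell)_s=x$ is in $\Pi^*$ for some predicate occurrence $P_{i_\ell}(\vec y_\ell)$ of the rule such that the $s$-th parameter of $P_{i_\ell}$ is allocated in $P_{i_\ell}$, i.e. in all rules of $P_{i_\ell}$; this is the least relation with these properties. MSO formulas over states are built from $x=y$, $var_u(x)$ ($s(u)=x$), $edge_k(x,y)$ ($h_k(x)=y$), $null(x)$,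 $X(x)$ by $\wedge$, $\neg$, $\exists x$, $\exists X$, where $x$ ranges over locations and $X$ over sets of locations. Let $Heap(X)\equiv\forall x.\ \bigl(\bigvee_{i=1}^{\mathcal S}\exists y.\ edge_i(x,y)\bigr)\leftrightarrow X(x)$. **Theorem.** There is a computable function which maps every closed $\mathrm{SLRD}_{btw}$ formula $\varphi$ (given together with its system $\mathcal P$) to an MSO formula $\overline\varphi(X)$ with no free variables other than the set variable $X$, such that for every state $S$, $$S\models_{sl}\varphi\quad\Longleftrightarrow\quad S\models_{mso}\exists X.\ \overline\varphi(X)\wedge Heap(X).$$ -/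

import Mathlib

namespace SepLog

/-! ## States

Pointer variables are natural numbers, `nil` being the variable `0`. `Loc` is an arbitrary type of
locations with a designated element `null`. Selectors are the numbers `1, …, N`. -/

/-- The designated pointer variable `nil`. -/
def nilVar : ℕ := 0

/-- A state `⟨s, h⟩`. The store is a partial function on pointer variables. The heap is written in
curried form, `heap ℓ k` being `h_k(ℓ)`; a location is in `dom(h)` iff it has an outgoing selector
edge, so that no allocated location is without selectors. -/
structure State (Loc : Type*) (null : Loc) (N : ℕ) where
  store : ℕ → Option Loc
  heap : Loc → ℕ → Option Loc
  store_nil : store nilVar = some null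
  heap_null : ∀ k, heap null k = none
  heap_sel : ∀ l k, heap l k ≠ none → 1 ≤ k ∧ k ≤ N
  heap_finite : {l | ∃ k, heap l k ≠ none}.Finite

namespace State

variable {Loc : Type*} {null : Loc} {N : ℕ}

/-- The set of allocated locations. -/
def dom (S : State Loc null N) : Set Loc := {l | ∃ k, S.heap l k ≠ none}

/-- `S₁ ⊎ S₂ = S`: the stores agree where both are defined, the heaps have disjoint domains, and `S`
is the union of the two states. -/
def IsUnion (S₁ S₂ S : State Loc null N) : Prop :=
  (∀ u l₁ l₂, S₁.store u = some l₁ → S₂.store u = some l₂ → l₁ = l₂) ∧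
  Disjoint S₁.dom S₂.dom ∧
  (∀ u, S.store u = (S₁.store u <|> S₂.store u)) ∧
  (∀ l k, S.heap l k = (S₁.heap l k <|> S₂.heap l k))

end State

/-! ## Formulae of separation logic -/

/-- A variable of separation logic: `Sum.inl u` is the pointer variable `u`, and `Sum.inr x` is the
logical variable `x`. -/
abbrev Var (L : Type) := ℕ ⊕ L

/-- A pure formula: a conjunction of equalities and disequalities. -/
structure Pure (V : Type) where
  eqs : List (V × V)
  neqs : List (V × V)

/-- A points-to atom `src ↦ (dst₁, …, dstₙ)`. -/
structure PointsTo (V : Type) where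
  src : V
  dst : List V

/-- An occurrence `P_pred(args)` of a recursive predicate. -/
structure Call (V : Type) where
  pred : ℕ
  args : List V

/-- Apply a renaming to a pure formula. -/
def Pure.map {V W : Type} (f : V → W) (π : Pure V) : Pure W :=
  ⟨π.eqs.map (Prod.map f f), π.neqs.map (Prod.map f f)⟩

/-- All variables of a pure formula lie in the set `A`. -/
def Pure.VarsIn {V : Type} (A : Set V) (π : Pure V) : Prop :=
  (∀ e ∈ π.eqs, e.1 ∈ A ∧ e.2 ∈ A) ∧ ∀ e ∈ π.neqs, e.1 ∈ A ∧ e.2 ∈ A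

/-- `a = b` occurs in the closure `π*` of the pure formula `π` under reflexivity, symmetry and
transitivity of equality. -/
def Pure.EqClosure {V : Type} (π : Pure V) : V → V → Prop :=
  Relation.EqvGen fun a b => (a, b) ∈ π.eqs

/-- All variables of a points-to atom lie in `A`, and it has at least one target. -/
def PointsTo.WellFormed {V : Type} (A : Set V) (c : PointsTo V) : Prop :=
  c.src ∈ A ∧ c.dst ≠ [] ∧ ∀ y ∈ c.dst, y ∈ A

/-- Formulae built from spatial atoms, predicate occurrences, separating conjunction, conjunction
with a pure formula, and existential quantification over logical variables in `L`. -/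
inductive SL (L : Type) where
  | emp : SL L
  | pto : PointsTo (Var L) → SL L
  | call : Call (Var L) → SL L
  | star : SL L → SL L → SL L
  | andPure : Pure (Var L) → SL L → SL L
  | ex : L → SL L → SL L

namespace SL

variable {L : Type}

/-- `∃ x₁ … ∃ xₙ. φ` -/
def exs (xs : List L) (φ : SL L) : SL L := xs.foldr ex φ

/-- `φ₁ * … * φₙ`, which is `emp` if `n = 0` -/
def bigStar (φs : List (SL L)) : SL L := φs.foldr star emp

end SL

section Semantics

variable {Loc : Type*} {null : Loc} {N : ℕ}

/-- The value `(s ⊕ ι)(α)`. -/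
def evalVar {L : Type} (s : ℕ → Option Loc) (ι : L → Option Loc) : Var L → Option Loc
  | .inl u => s u
  | .inr x => ι x

/-- Satisfaction of a pure formula; an atom holds only if both of its sides are defined. -/
def Pure.Sat {L : Type} (π : Pure (Var L)) (s : ℕ → Option Loc) (ι : L → Option Loc) : Prop :=
  (∀ e ∈ π.eqs, ∃ l, evalVar s ι e.1 = some l ∧ evalVar s ι e.2 = some l) ∧
  ∀ e ∈ π.neqs, ∃ l m, evalVar s ι e.1 = some l ∧ evalVar s ι e.2 = some m ∧ l ≠ m

/-- `S, ι ⊨ α ↦ (β₁, …, βₙ)`: the heap consists of exactly one cell, at the location of `α`, whose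
`k`-th selector leads to the location of `βₖ` for `k = 1, …, n`, and it has no other selectors. -/
def PointsTo.Sat {L : Type} (c : PointsTo (Var L)) (S : State Loc null N) (ι : L → Option Loc) :
    Prop :=
  ∃ (a : Loc) (vs : List Loc), evalVar S.store ι c.src = some a ∧
    c.dst.map (evalVar S.store ι) = vs.map some ∧
    (∀ k, S.heap a (k + 1) = vs[k]?) ∧ ∀ l, l ≠ a → ∀ k, S.heap l k = none

/-- Satisfaction of a formula, with respect to a meaning `I i vs S` of the recursive predicates
(`P_i` holds of the locations `vs` in the state `S`). -/
def SL.Sat {L : Type} [DecidableEq L] (I : ℕ → List Loc → State Loc null N → Prop) :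
    SL L → State Loc null N → (L → Option Loc) → Prop
  | .emp, S, _ => S.dom = ∅
  | .pto c, S, ι => c.Sat S ι
  | .call c, S, ι => ∃ vs : List Loc, c.args.map (evalVar S.store ι) = vs.map some ∧ I c.pred vs S
  | .star φ ψ, S, ι => ∃ S₁ S₂, State.IsUnion S₁ S₂ S ∧ SL.Sat I φ S₁ ι ∧ SL.Sat I ψ S₂ ι
  | .andPure π φ, S, ι => π.Sat S.store ι ∧ SL.Sat I φ S ι
  | .ex x φ, S, ι => ∃ l, SL.Sat I φ S (Function.update ι x (some l))

end Semantics

/-! ## Systems of recursive definitions -/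

/-- A rule `∃ z⃗. Σ * P_{i₁}(y⃗₁) * … * P_{iₘ}(y⃗ₘ) ∧ Π` of a recursive definition; all its variables
are logical variables, represented by natural numbers. -/
structure Rule where
  exVars : List ℕ
  head : List (PointsTo ℕ)
  tail : List (Call ℕ)
  pure : Pure ℕ

/-- A recursive definition `P(x₁, …, xₙ) ::= R₁ | … | Rₘ`. -/
structure PredDef where
  params : List ℕ
  rules : List Rule

/-- A system of recursive definitions; `P_i` is the `i`-th entry of the list. -/
abbrev RecSystem := List PredDef

namespace RecSystem

/-- The parameters `x_{i,1}, …, x_{i,n_i}` of `P_i`. -/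
def params (P : RecSystem) (i : ℕ) : List ℕ := (P[i]?.map PredDef.params).getD []

/-- The rules `R_{i,1}, …, R_{i,m_i}` of `P_i`. -/
def rules (P : RecSystem) (i : ℕ) : List Rule := (P[i]?.map PredDef.rules).getD []

/-- The syntactic conditions on a system of recursive definitions: parameters are distinct, the
quantified variables of a rule are not parameters, every variable of a rule is a parameter or
quantified, and predicate occurrences respect arities. -/
def WellFormed (P : RecSystem) : Prop :=
  ∀ D ∈ P, D.params.Nodup ∧ ∀ R ∈ D.rules,
    List.Disjoint D.params R.exVars ∧
    (∀ c ∈ R.head, c.WellFormed {x | x ∈ D.params ∨ x ∈ R.exVars}) ∧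
    (∀ c ∈ R.tail, c.pred < P.length ∧ c.args.length = (P.params c.pred).length ∧
      ∀ y ∈ c.args, y ∈ D.params ∨ y ∈ R.exVars) ∧
    R.pure.VarsIn {x | x ∈ D.params ∨ x ∈ R.exVars}

/-- The unfolding trees of `P` rooted at `i`: the root is labelled with a rule of `P_i`, and it has
one subtree for each predicate occurrence in the tail of this rule, rooted at that predicate. -/
inductive UnfoldingTree (P : RecSystem) : ℕ → Type where
  | node (i : ℕ) (j : Fin (P.rules i).length)
      (children : ∀ k : Fin ((P.rules i).get j).tail.length,
        UnfoldingTree P (((P.rules i).get j).tail.get k).pred) :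
      UnfoldingTree P i

/-- The variable `x^p` for a logical variable `x` and a tree position `p`. -/
abbrev atPos (p : List ℕ) (x : ℕ) : Var (ℕ × List ℕ) := .inr (x, p)

/-- The characteristic formula of the unfolding tree `t`, placed at position `p`, namely
`∃ z⃗^p. head(R^p) * ⋆ⱼ [∃ x⃗^{p.j}. φ^{p.j} ∧ y⃗ⱼ^p = x⃗^{p.j}] ∧ pure(R^p)`, where `R` is the rule at
the root of `t`. -/
def charFormula (P : RecSystem) :
    {i : ℕ} → UnfoldingTree P i → List ℕ → SL (ℕ × List ℕ)
  | _, .node i j children, p =>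
    let R := (P.rules i).get j
    SL.exs (R.exVars.map fun z => (z, p)) <|
      SL.andPure (R.pure.map (atPos p)) <|
        SL.star
          (SL.bigStar (R.head.map fun c => SL.pto ⟨atPos p c.src, c.dst.map (atPos p)⟩))
          (SL.bigStar (List.ofFn fun k : Fin R.tail.length =>
            let q := p ++ [k.val]
            let xs := P.params (R.tail.get k).pred
            SL.exs (xs.map fun x => (x, q)) <|
              SL.andPure ⟨((R.tail.get k).args.map (atPos p)).zip (xs.map (atPos q)), []⟩ <|
                charFormula P (children k) q))

/-- `P_i` holds of the locations `vs` in the state `S`: some unfolding tree rooted at `i` has a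
characteristic formula that holds in `S` when the parameters `x_{i,j}^ε` are interpreted by `vs`. -/
def PredSat {Loc : Type*} {null : Loc} {N : ℕ} (P : RecSystem) (i : ℕ) (vs : List Loc)
    (S : State Loc null N) : Prop :=
  ∃ t : UnfoldingTree P i, SL.Sat (fun _ _ _ => False) (P.charFormula t []) S
    (fun v => if v.2 = [] then ((P.params i).zip vs).lookup v.1 else none)

/-! ### The fragment with bounded tree width -/

/-- The variable `x` is allocated in the head of the rule `R`. -/
def HeadAllocates (R : Rule) (x : ℕ) : Prop := ∃ c ∈ R.head, c.src = x

/-- Progress: each rule allocates exactly one variable. -/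
def Progress (P : RecSystem) : Prop :=
  ∀ D ∈ P, ∀ R ∈ D.rules, ∃ c, R.head = [c]

/-- A rule `R` with head `α ↦ (β₁, …, βₙ)` is connected if, for every predicate occurrence
`P_i(y⃗)` in its tail, there are `s` and `t` such that `βₜ = (y⃗)ₛ` occurs in `pure(R)*` and the `s`-th
parameter of `P_i` is allocated in the heads of all rules of `P_i`. -/
def RuleConnected (P : RecSystem) (R : Rule) : Prop :=
  ∀ c ∈ R.head, ∀ o ∈ R.tail, ∃ (s : ℕ) (y x : ℕ), ∃ b ∈ c.dst,
    o.args[s]? = some y ∧ R.pure.EqClosure b y ∧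
    (P.params o.pred)[s]? = some x ∧ ∀ Q ∈ P.rules o.pred, HeadAllocates Q x

/-- Connectivity: all rules are connected. -/
def Connected (P : RecSystem) : Prop :=
  ∀ D ∈ P, ∀ R ∈ D.rules, P.RuleConnected R

mutual
/-- The `s`-th parameter of `P_i` is (eventually) allocated in `P_i`, i.e. in all rules of `P_i`;
this is the least relation with the required closure property. -/
inductive ParamAllocated (P : RecSystem) : ℕ → ℕ → Prop where
  | mk {i s x : ℕ} : (P.params i)[s]? = some x →
      (∀ R ∈ P.rules i, EventuallyAllocated P R x) → ParamAllocated P i s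
/-- The variable `x` is allocated in the head of the rule `R`, or it equals, by `pure(R)*`, an
actual parameter passed to a predicate which allocates the corresponding formal parameter. -/
inductive EventuallyAllocated (P : RecSystem) : Rule → ℕ → Prop where
  | head {R : Rule} {x : ℕ} : HeadAllocates R x → EventuallyAllocated P R x
  | tail {R : Rule} {x y s : ℕ} {o : Call ℕ} : o ∈ R.tail → o.args[s]? = some y →
      R.pure.EqClosure y x → ParamAllocated P o.pred s → EventuallyAllocated P R x
end

/-- Establishment: every existentially quantified variable is eventually allocated. -/
def Established (P : RecSystem) : Prop :=
  ∀ D ∈ P, ∀ R ∈ D.rules, ∀ z ∈ R.exVars, P.EventuallyAllocated R z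

/-- The three restrictions that define the fragment `SLRD_btw`. -/
def IsBtw (P : RecSystem) : Prop := P.Progress ∧ P.Connected ∧ P.Established

end RecSystem

/-! ## Top level formulae -/

/-- A basic formula `∃ x⃗. π ∧ σ`; `spatial = []` is `emp`. -/
structure BasicFormula where
  exVars : List ℕ
  pure : Pure (Var ℕ)
  spatial : List (PointsTo (Var ℕ))

/-- A top level formula `∃ z⃗. φ * P_{i₁}(y⃗₁) * … * P_{iₙ}(y⃗ₙ)` with `φ` a basic formula. -/
structure TopFormula where
  exVars : List ℕ
  basic : BasicFormula
  calls : List (Call (Var ℕ))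

/-- `∃ x⃗. π ∧ σ` as a formula of separation logic. -/
def BasicFormula.toSL (φ : BasicFormula) : SL ℕ :=
  SL.exs φ.exVars (SL.andPure φ.pure (SL.bigStar (φ.spatial.map SL.pto)))

namespace TopFormula

/-- The top level formula as a formula of separation logic. -/
def toSL (φ : TopFormula) : SL ℕ :=
  SL.exs φ.exVars (SL.star φ.basic.toSL (SL.bigStar (φ.calls.map SL.call)))

/-- The pointer variables and the logical variables from `xs`. -/
def scope (xs : List ℕ) : Set (Var ℕ) := {v | ∀ x, v = .inr x → x ∈ xs}

/-- `φ` is a closed formula over the system `P`: it has no free logical variables, points-to atoms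
have at least one target, and predicate occurrences respect arities. -/
def IsClosedOver (P : RecSystem) (φ : TopFormula) : Prop :=
  φ.basic.pure.VarsIn (scope (φ.basic.exVars ++ φ.exVars)) ∧
  (∀ c ∈ φ.basic.spatial, c.WellFormed (scope (φ.basic.exVars ++ φ.exVars))) ∧
  ∀ c ∈ φ.calls, c.pred < P.length ∧ c.args.length = (P.params c.pred).length ∧
    ∀ y ∈ c.args, y ∈ scope φ.exVars

/-- `S ⊨_sl φ` for a closed formula `φ` over the system `P`. -/
def Models {Loc : Type*} {null : Loc} {N : ℕ} (P : RecSystem) (S : State Loc null N)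
    (φ : TopFormula) : Prop :=
  SL.Sat P.PredSat φ.toSL S (fun _ => none)

end TopFormula

/-! ## Monadic second-order logic on states -/

/-- MSO formulae. First-order and second-order variables are two separate copies of `ℕ`. -/
inductive MSO where
  | eq (x y : ℕ)
  | var (u x : ℕ)
  | edge (k x y : ℕ)
  | null (x : ℕ)
  | mem (X x : ℕ)
  | and (φ ψ : MSO)
  | not (φ : MSO)
  | exFO (x : ℕ) (φ : MSO)
  | exSO (X : ℕ) (φ : MSO)

namespace MSO

/-- `S, ι, ν ⊨_mso φ` -/
def Sat {Loc : Type*} {null : Loc} {N : ℕ} (S : State Loc null N) :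
    MSO → (ℕ → Loc) → (ℕ → Set Loc) → Prop
  | .eq x y, ι, _ => ι x = ι y
  | .var u x, ι, _ => S.store u = some (ι x)
  | .edge k x y, ι, _ => S.heap (ι x) k = some (ι y)
  | .null x, ι, _ => ι x = null
  | .mem X x, ι, ν => ι x ∈ ν X
  | .and φ ψ, ι, ν => Sat S φ ι ν ∧ Sat S ψ ι ν
  | .not φ, ι, ν => ¬ Sat S φ ι ν
  | .exFO x φ, ι, ν => ∃ l, Sat S φ (Function.update ι x l) ν
  | .exSO X φ, ι, ν => ∃ A, Sat S φ ι (Function.update ν X A)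

/-- `S ⊨_mso φ`: the formula holds in `S` under all interpretations. -/
def Models {Loc : Type*} {null : Loc} {N : ℕ} (S : State Loc null N) (φ : MSO) : Prop :=
  ∀ ι ν, Sat S φ ι ν

/-- The free first-order variables. -/
def freeFO : MSO → Set ℕ
  | .eq x y => {x, y}
  | .var _ x => {x}
  | .edge _ x y => {x, y}
  | .null x => {x}
  | .mem _ x => {x}
  | .and φ ψ => freeFO φ ∪ freeFO ψ
  | .not φ => freeFO φ
  | .exFO x φ => freeFO φ \ {x}
  | .exSO _ φ => freeFO φ

/-- The free second-order variables. -/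
def freeSO : MSO → Set ℕ
  | .eq _ _ => ∅
  | .var _ _ => ∅
  | .edge _ _ _ => ∅
  | .null _ => ∅
  | .mem X _ => {X}
  | .and φ ψ => freeSO φ ∪ freeSO ψ
  | .not φ => freeSO φ
  | .exFO _ φ => freeSO φ
  | .exSO X φ => freeSO φ \ {X}

/-- `φ ∨ ψ` -/
def or (φ ψ : MSO) : MSO := .not (.and (.not φ) (.not ψ))

/-- `φ ↔ ψ` -/
def iff (φ ψ : MSO) : MSO := .and (or (.not φ) ψ) (or φ (.not ψ))

/-- `∀ x. φ` -/
def allFO (x : ℕ) (φ : MSO) : MSO := .not (.exFO x (.not φ))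

/-- `φ₁ ∨ … ∨ φₙ`, a contradiction if `n = 0` -/
def bigOr (φs : List MSO) : MSO := φs.foldr or (.exFO 0 (.not (.eq 0 0)))

/-- `Heap(X)`, i.e. `∀ x. (⋁_{i=1}^N ∃ y. edge_i(x, y)) ↔ X(x)`: the set `X` is the domain of the
heap. -/
def heapDom (N X : ℕ) : MSO :=
  allFO 0 (iff (bigOr ((List.range N).map fun i => .exFO 1 (.edge (i + 1) 0 1))) (.mem X 0))

/-- The Gödel number of an MSO formula. -/
def code : MSO → ℕ
  | .eq x y => Nat.pair 0 (Nat.pair x y)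
  | .var u x => Nat.pair 1 (Nat.pair u x)
  | .edge k x y => Nat.pair 2 (Nat.pair k (Nat.pair x y))
  | .null x => Nat.pair 3 x
  | .mem X x => Nat.pair 4 (Nat.pair X x)
  | .and φ ψ => Nat.pair 5 (Nat.pair (code φ) (code ψ))
  | .not φ => Nat.pair 6 (code φ)
  | .exFO x φ => Nat.pair 7 (Nat.pair x (code φ))
  | .exSO X φ => Nat.pair 8 (Nat.pair X (code φ))

theorem code_injective : Function.Injective code := by
  intro φ
  induction φ with
  | and φ ψ h₁ h₂ =>
    intro χ h
    cases χ <;> simp [code, Nat.pair_eq_pair] at h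
    exact congrArg₂ MSO.and (h₁ h.1) (h₂ h.2)
  | not φ ih =>
    intro χ h
    cases χ <;> simp [code, Nat.pair_eq_pair] at h
    exact congrArg MSO.not (ih h)
  | exFO x φ ih =>
    intro χ h
    cases χ <;> simp [code, Nat.pair_eq_pair] at h
    exact congrArg₂ MSO.exFO h.1 (ih h.2)
  | exSO x φ ih =>
    intro χ h
    cases χ <;> simp [code, Nat.pair_eq_pair] at h
    exact congrArg₂ MSO.exSO h.1 (ih h.2)
  | _ =>
    intro χ h
    cases χ <;> simp_all [code, Nat.pair_eq_pair]

end MSO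

/-! ## Encodings of the input of the translation

The structures of the syntax are encoded as the tuples of their fields. -/

/-- A pure formula is the pair of its fields. -/
def Pure.equiv (V : Type) : Pure V ≃ List (V × V) × List (V × V) :=
  ⟨fun a => (a.eqs, a.neqs), fun a => ⟨a.1, a.2⟩, fun _ => rfl, fun _ => rfl⟩

/-- A points-to atom is the pair of its fields. -/
def PointsTo.equiv (V : Type) : PointsTo V ≃ V × List V :=
  ⟨fun a => (a.src, a.dst), fun a => ⟨a.1, a.2⟩, fun _ => rfl, fun _ => rfl⟩

/-- A predicate occurrence is the pair of its fields. -/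
def Call.equiv (V : Type) : Call V ≃ ℕ × List V :=
  ⟨fun a => (a.pred, a.args), fun a => ⟨a.1, a.2⟩, fun _ => rfl, fun _ => rfl⟩

instance {V : Type} [Primcodable V] : Primcodable (Pure V) := .ofEquiv _ (Pure.equiv V)

instance {V : Type} [Primcodable V] : Primcodable (PointsTo V) := .ofEquiv _ (PointsTo.equiv V)

instance {V : Type} [Primcodable V] : Primcodable (Call V) := .ofEquiv _ (Call.equiv V)

/-- A rule is the tuple of its fields. -/
def Rule.equiv : Rule ≃ List ℕ × List (PointsTo ℕ) × List (Call ℕ) × Pure ℕ :=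
  ⟨fun a => (a.exVars, a.head, a.tail, a.pure), fun a => ⟨a.1, a.2.1, a.2.2.1, a.2.2.2⟩,
    fun _ => rfl, fun _ => rfl⟩

instance : Primcodable Rule := .ofEquiv _ Rule.equiv

/-- A recursive definition is the pair of its fields. -/
def PredDef.equiv : PredDef ≃ List ℕ × List Rule :=
  ⟨fun a => (a.params, a.rules), fun a => ⟨a.1, a.2⟩, fun _ => rfl, fun _ => rfl⟩

instance : Primcodable PredDef := .ofEquiv _ PredDef.equiv

/-- A basic formula is the tuple of its fields. -/
def BasicFormula.equiv :
    BasicFormula ≃ List ℕ × Pure (Var ℕ) × List (PointsTo (Var ℕ)) :=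
  ⟨fun a => (a.exVars, a.pure, a.spatial), fun a => ⟨a.1, a.2.1, a.2.2⟩,
    fun _ => rfl, fun _ => rfl⟩

instance : Primcodable BasicFormula := .ofEquiv _ BasicFormula.equiv

/-- A top level formula is the tuple of its fields. -/
def TopFormula.equiv : TopFormula ≃ List ℕ × BasicFormula × List (Call (Var ℕ)) :=
  ⟨fun a => (a.exVars, a.basic, a.calls), fun a => ⟨a.1, a.2.1, a.2.2⟩,
    fun _ => rfl, fun _ => rfl⟩

instance : Primcodable TopFormula := .ofEquiv _ TopFormula.equiv

end SepLog

-- By progress, each node of an unfolding tree allocates exactly one location, so if a predicate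
-- holds in the part of the heap with domain `A`, then the locations in `A` can serve as the nodes
-- of the tree (`IsDecoration`). By connectivity, every child is the target of an edge that leaves
-- its parent, and there are only `N` selectors. The shape of the tree is therefore recorded by
-- finitely many sets of locations: which rule labels a node, and which selector leads to its `k`-th
-- child (`Marking`). That such sets describe a tree with root `r` and node set `A` (unique parents,
-- root without parent, every node reachable) is a monadic condition.
--
-- The values of the rule variables are functions from nodes to locations and cannot be guessed as
-- sets. They are defined instead: `x` has value `v` at node `l` if this follows from the equalities
-- of the rules, the parameter passing along tree edges, the arguments at the root, and the fact
-- that the node `v` allocates `v`. This is a least fixed point, expressed by quantifying over all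
-- closed families of sets (`Marking.Val`). It is sound because the true valuation is a closed
-- family, and complete by establishment: an existential variable is linked to the node that
-- allocates its value, and a parameter is linked through the ancestors to an existential variable
-- or to an argument at the root.
--
-- The semantic chain is `SL.sat_star_restrict` (separating conjunction splits the domain),
-- `RecSystem.predSat_restrict_iff` (unfolding trees become an inductive predicate on domains),
-- `RecSystem.PHolds.exists_isDecoration` with its converse `IsDecoration.pHolds`, and
-- `RecSystem.pHolds_iff_exists_isMarking`. Computability is carried along by `Definable`:
-- properties that have MSO formulae with primitive recursive codes are closed under all the
-- constructions needed, so no formula is ever written out.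

universe u

namespace SepLog

-- Separating conjunction as a partition of the heap domain

section Restriction

variable {Loc : Type*} {null : Loc} {N : ℕ}

open Classical in
/-- The state with the same store whose heap is restricted to the locations in `A`. -/
noncomputable def State.restrict (S : State Loc null N) (A : Set Loc) : State Loc null N where
  store := S.store
  heap l k := if l ∈ A then S.heap l k else none
  store_nil := S.store_nil
  heap_null k := by simp [S.heap_null]
  heap_sel l k h := S.heap_sel l k (by
    intro h'
    simp [h'] at h)
  heap_finite := S.heap_finite.subset (by
    rintro l ⟨k, hk⟩
    refine ⟨k, fun h' => hk ?_⟩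
    simp [h'])

theorem State.restrict_heap_of_mem (S : State Loc null N) {A : Set Loc} {l : Loc} (h : l ∈ A)
    (k : ℕ) : (S.restrict A).heap l k = S.heap l k := by
  simp [State.restrict, h]

theorem State.restrict_heap_of_notMem (S : State Loc null N) {A : Set Loc} {l : Loc} (h : l ∉ A)
    (k : ℕ) : (S.restrict A).heap l k = none := by
  simp [State.restrict, h]

theorem State.notMem_dom_iff (S : State Loc null N) {l : Loc} :
    l ∉ S.dom ↔ ∀ k, S.heap l k = none := by
  simp [State.dom]

theorem State.dom_restrict (S : State Loc null N) {A : Set Loc} (hA : A ⊆ S.dom) :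
    (S.restrict A).dom = A := by
  ext l
  by_cases h : l ∈ A
  · have : ∃ k, S.heap l k ≠ none := hA h
    simpa [State.dom, State.restrict, h] using this
  · simp [State.dom, State.restrict, h]

theorem State.restrict_dom (S : State Loc null N) : S.restrict S.dom = S := by
  have : (S.restrict S.dom).heap = S.heap := by
    funext l k
    by_cases h : l ∈ S.dom
    · exact S.restrict_heap_of_mem h k
    · rw [S.restrict_heap_of_notMem h, S.notMem_dom_iff.1 h]
  cases S
  simp only [State.restrict] at this ⊢
  congr

/-- `S'` has the heap of `S` and at least the pointer variables of `S`. -/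
def State.StoreLE (S S' : State Loc null N) : Prop :=
  S.heap = S'.heap ∧ ∀ u l, S.store u = some l → S'.store u = some l

/-- A meaning of predicates is preserved when pointer variables are added to the store. -/
def StoreMono (I : ℕ → List Loc → State Loc null N → Prop) : Prop :=
  ∀ i vs S S', State.StoreLE S S' → I i vs S → I i vs S'

theorem map_eq_map_some_mono {α : Type*} {f g : α → Option Loc}
    (h : ∀ a v, f a = some v → g a = some v) :
    ∀ {l : List α} {vs : List Loc}, l.map f = vs.map some → l.map g = vs.map some
  | [], [], _ => rfl
  | [], _ :: _, h' => by simp at h'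
  | _ :: _, [], h' => by simp at h'
  | a :: l, v :: vs, h' => by
    simp only [List.map_cons, List.cons.injEq] at h' ⊢
    exact ⟨h a v h'.1, map_eq_map_some_mono h h'.2⟩

theorem evalVar_mono {L : Type} {s s' : ℕ → Option Loc}
    (h : ∀ u l, s u = some l → s' u = some l) (ι : L → Option Loc) (x : Var L) (l : Loc)
    (hx : evalVar s ι x = some l) : evalVar s' ι x = some l := by
  cases x with
  | inl u => exact h u l hx
  | inr x => exact hx

theorem Pure.Sat.mono {L : Type} {π : Pure (Var L)} {s s' : ℕ → Option Loc}
    (h : ∀ u l, s u = some l → s' u = some l) {ι : L → Option Loc} (hπ : π.Sat s ι) :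
    π.Sat s' ι := by
  refine ⟨fun e he => ?_, fun e he => ?_⟩
  · obtain ⟨l, h1, h2⟩ := hπ.1 e he
    exact ⟨l, evalVar_mono h _ _ _ h1, evalVar_mono h _ _ _ h2⟩
  · obtain ⟨l, m, h1, h2, h3⟩ := hπ.2 e he
    exact ⟨l, m, evalVar_mono h _ _ _ h1, evalVar_mono h _ _ _ h2, h3⟩

/-- There is no negation, and a disequality requires both sides to be defined, so a more defined
store can only help. This removes the partial stores that a separating conjunction may introduce. -/
theorem SL.Sat.mono {L : Type} [DecidableEq L] {I : ℕ → List Loc → State Loc null N → Prop}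
    (hI : StoreMono I) {φ : SL L} {S S' : State Loc null N} (h : State.StoreLE S S')
    {ι : L → Option Loc} (hφ : SL.Sat I φ S ι) : SL.Sat I φ S' ι := by
  induction φ generalizing S S' ι with
  | emp =>
    simp only [SL.Sat, State.dom] at hφ ⊢
    rw [← h.1]
    exact hφ
  | pto c =>
    obtain ⟨a, vs, h1, h2, h3, h4⟩ := hφ
    refine ⟨a, vs, evalVar_mono h.2 _ _ _ h1, ?_, by rwa [← h.1], by rwa [← h.1]⟩
    exact map_eq_map_some_mono (evalVar_mono h.2 ι) h2
  | call c =>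
    obtain ⟨vs, h1, h2⟩ := hφ
    exact ⟨vs, map_eq_map_some_mono (evalVar_mono h.2 ι) h1, hI _ _ _ _ h h2⟩
  | star φ ψ ihφ ihψ =>
    obtain ⟨S₁, S₂, ⟨h1, h2, h3, h4⟩, hφ, hψ⟩ := hφ
    -- Both halves receive the whole larger store; compatibility is then trivial.
    let T (S₀ : State Loc null N) : State Loc null N :=
      ⟨S'.store, S₀.heap, S'.store_nil, S₀.heap_null, S₀.heap_sel, S₀.heap_finite⟩
    refine ⟨T S₁, T S₂, ⟨?_, h2, ?_, ?_⟩, ihφ (S := S₁) (S' := T S₁) ⟨rfl, ?_⟩ hφ,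
      ihψ (S := S₂) (S' := T S₂) ⟨rfl, ?_⟩ hψ⟩
    · intro u l₁ l₂ e₁ e₂
      exact Option.some.inj (e₁.symm.trans e₂)
    · intro u
      simp only [T]
      cases S'.store u <;> rfl
    · intro l k
      rw [← h.1]
      exact h4 l k
    · intro u l e
      apply h.2
      rw [h3, e]
      rfl
    · intro u l e
      apply h.2
      rw [h3, e]
      cases e' : S₁.store u with
      | none => rfl
      | some l' => simp [h1 u l' l e' e]
  | andPure π φ ih => exact ⟨hφ.1.mono h.2, ih h hφ.2⟩
  | ex x φ ih =>
    obtain ⟨l, hl⟩ := hφ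
    exact ⟨l, ih h hl⟩

theorem storeMono_false : StoreMono (fun _ _ (_ : State Loc null N) => False) :=
  fun _ _ _ _ _ h => h

theorem RecSystem.storeMono_predSat (P : RecSystem) :
    StoreMono (P.PredSat : ℕ → List Loc → State Loc null N → Prop) := by
  rintro i vs S S' h ⟨t, ht⟩
  exact ⟨t, ht.mono storeMono_false h⟩

/-- The heap cell at `a` has exactly the selectors `1, …, vs.length`, leading to `vs`. -/
def State.CellAt (S : State Loc null N) (a : Loc) (vs : List Loc) : Prop :=
  ∀ k, S.heap a (k + 1) = vs[k]?

/-- A location is allocated only if it has a selector. With an empty target list the atom would hold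
in the empty heap, so `hc` is what forces `A = {a}`. -/
theorem PointsTo.sat_restrict {L : Type} (S : State Loc null N) {A : Set Loc}
    (hA : A ⊆ S.dom) {c : PointsTo (Var L)} (hc : c.dst ≠ []) {ι : L → Option Loc} :
    c.Sat (S.restrict A) ι ↔ ∃ (a : Loc) (vs : List Loc), evalVar S.store ι c.src = some a ∧
      c.dst.map (evalVar S.store ι) = vs.map some ∧ A = {a} ∧ S.CellAt a vs := by
  constructor
  · rintro ⟨a, vs, h1, h2, h3, h4⟩
    have hvs : vs ≠ [] := by
      rintro rfl
      simp [hc] at h2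
    have ha : a ∈ A := by
      by_contra h
      have := h3 0
      rw [S.restrict_heap_of_notMem h] at this
      cases vs with
      | nil => exact hvs rfl
      | cons v vs => simp at this
    refine ⟨a, vs, h1, h2, ?_, fun k => ?_⟩
    · ext l
      refine ⟨fun hl => ?_, fun hl => by rwa [Set.mem_singleton_iff.1 hl]⟩
      by_contra hne
      obtain ⟨k, hk⟩ := hA hl
      rw [← S.restrict_heap_of_mem hl] at hk
      exact hk (h4 l hne k)
    · rw [← h3, S.restrict_heap_of_mem ha]
  · rintro ⟨a, vs, h1, h2, rfl, h4⟩
    refine ⟨a, vs, h1, h2, fun k => ?_, fun l hl k => S.restrict_heap_of_notMem (by simpa using hl) k⟩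
    rw [S.restrict_heap_of_mem (by simp), h4]

variable {L : Type} [DecidableEq L] {I : ℕ → List Loc → State Loc null N → Prop}

/-- The heaps of the two halves are determined by their domains, and their stores may be enlarged to
that of `S` by `SL.Sat.mono`. All states in sight are thus restrictions of one fixed `S`, and a
subset of `S.dom` represents a state. -/
theorem SL.sat_star_restrict (hI : StoreMono I) (S : State Loc null N) {A : Set Loc}
    (hA : A ⊆ S.dom) {φ ψ : SL L} {ι : L → Option Loc} :
    SL.Sat I (.star φ ψ) (S.restrict A) ι ↔
      ∃ B C, (∀ l, l ∈ A ↔ l ∈ B ∨ l ∈ C) ∧ Disjoint B C ∧ SL.Sat I φ (S.restrict B) ι ∧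
        SL.Sat I ψ (S.restrict C) ι := by
  constructor
  · rintro ⟨S₁, S₂, ⟨h1, h2, h3, h4⟩, hφ, hψ⟩
    have key : ∀ l k, l ∈ A ∨ (S₁.heap l k = none ∧ S₂.heap l k = none) := by
      intro l k
      by_cases h : l ∈ A
      · exact Or.inl h
      · have := h4 l k
        rw [S.restrict_heap_of_notMem h] at this
        revert this
        cases S₁.heap l k <;> cases S₂.heap l k <;> simp
    have k1 : ∀ l ∈ S₁.dom, l ∈ A := by
      rintro l ⟨k, hk⟩
      exact (key l k).resolve_right fun h => hk h.1
    have k2 : ∀ l ∈ S₂.dom, l ∈ A := by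
      rintro l ⟨k, hk⟩
      exact (key l k).resolve_right fun h => hk h.2
    refine ⟨S₁.dom, S₂.dom, fun l => ⟨fun hl => ?_, fun hl => hl.elim (k1 l) (k2 l)⟩, h2,
      hφ.mono hI ⟨?_, ?_⟩, hψ.mono hI ⟨?_, ?_⟩⟩
    · obtain ⟨k, hk⟩ := hA hl
      rw [← S.restrict_heap_of_mem hl, h4] at hk
      by_contra hc
      rw [not_or, State.notMem_dom_iff, State.notMem_dom_iff] at hc
      exact hk (by rw [hc.1 k, hc.2 k]; rfl)
    · funext l k
      by_cases hl : l ∈ S₁.dom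
      · have h5 : S₂.heap l k = none :=
          (S₂.notMem_dom_iff).1 (fun h => Set.disjoint_left.1 h2 hl h) k
        rw [State.restrict_heap_of_mem _ hl, ← S.restrict_heap_of_mem (k1 l hl), h4, h5]
        cases S₁.heap l k <;> rfl
      · rw [State.restrict_heap_of_notMem _ hl, (S₁.notMem_dom_iff).1 hl]
    · intro u l hu
      have := h3 u
      rw [hu] at this
      exact this
    · funext l k
      by_cases hl : l ∈ S₂.dom
      · have h5 : S₁.heap l k = none :=
          (S₁.notMem_dom_iff).1 (fun h => Set.disjoint_left.1 h2 h hl) k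
        rw [State.restrict_heap_of_mem _ hl, ← S.restrict_heap_of_mem (k2 l hl), h4, h5]
        rfl
      · rw [State.restrict_heap_of_notMem _ hl, (S₂.notMem_dom_iff).1 hl]
    · intro u l hu
      have := h3 u
      rw [hu] at this
      cases e' : S₁.store u with
      | none => rw [e'] at this; exact this
      | some l' =>
        rw [e', h1 u l' l e' hu] at this
        exact this
  · rintro ⟨B, C, h1, h2, h3, h4⟩
    refine ⟨S.restrict B, S.restrict C, ⟨?_, ?_, ?_, ?_⟩, h3, h4⟩
    · intro u l₁ l₂ e₁ e₂
      exact Option.some.inj (e₁.symm.trans e₂)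
    · rw [S.dom_restrict fun l hl => hA ((h1 l).2 (.inl hl)),
        S.dom_restrict fun l hl => hA ((h1 l).2 (.inr hl))]
      exact h2
    · intro u
      dsimp only [State.restrict]
      cases S.store u <;> rfl
    · intro l k
      by_cases hB : l ∈ B
      · have hC : l ∉ C := Set.disjoint_left.1 h2 hB
        rw [S.restrict_heap_of_mem hB, S.restrict_heap_of_notMem hC,
          S.restrict_heap_of_mem ((h1 l).2 (.inl hB))]
        cases S.heap l k <;> rfl
      · rw [S.restrict_heap_of_notMem hB]
        by_cases hC : l ∈ C
        · rw [S.restrict_heap_of_mem hC, S.restrict_heap_of_mem ((h1 l).2 (.inr hC))]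
          rfl
        · rw [S.restrict_heap_of_notMem hC, S.restrict_heap_of_notMem]
          · rfl
          · rw [h1]; tauto

/-- The sets `B 0, …, B (n - 1)` are pairwise disjoint and their union is `A`. -/
def IsPartition (n : ℕ) (B : ℕ → Set Loc) (A : Set Loc) : Prop :=
  (∀ l, l ∈ A ↔ ∃ k < n, l ∈ B k) ∧
    ∀ j < n, ∀ k < n, ∀ l, l ∈ B j → l ∈ B k → j = k

theorem SL.sat_bigStar_restrict (hI : StoreMono I) (S : State Loc null N) {A : Set Loc}
    (hA : A ⊆ S.dom) {φs : List (SL L)} {ι : L → Option Loc} :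
    SL.Sat I (SL.bigStar φs) (S.restrict A) ι ↔
      ∃ B, IsPartition φs.length B A ∧
        ∀ k φ, φs[k]? = some φ → SL.Sat I φ (S.restrict (B k)) ι := by
  induction φs generalizing A with
  | nil =>
    simp only [SL.bigStar, List.foldr_nil, SL.Sat, S.dom_restrict hA, IsPartition]
    constructor
    · rintro rfl
      exact ⟨fun _ => ∅, by simp⟩
    · rintro ⟨B, ⟨h, -⟩, -⟩
      ext l
      simp [h l]
  | cons φ φs ih =>
    rw [SL.bigStar, List.foldr_cons, SL.sat_star_restrict hI S hA]
    constructor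
    · rintro ⟨B, C, h1, h2, h3, h4⟩
      obtain ⟨D, ⟨h5, h6⟩, h7⟩ := (ih fun l hl => hA ((h1 l).2 (.inr hl))).1 h4
      refine ⟨fun k => Nat.casesOn k B D, ⟨fun l => ?_, ?_⟩, ?_⟩
      · rw [h1, h5]
        constructor
        · rintro (h | ⟨k, hk, h⟩)
          · exact ⟨0, by simp, h⟩
          · exact ⟨k + 1, by simpa using hk, h⟩
        · rintro ⟨_ | k, hk, h⟩
          · exact .inl h
          · exact .inr ⟨k, by simpa using hk, h⟩
      · rintro (_ | j) hj (_ | k) hk l hl hl'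
        · rfl
        · exact absurd ((h5 l).2 ⟨k, by simpa using hk, hl'⟩) (Set.disjoint_left.1 h2 hl)
        · exact absurd ((h5 l).2 ⟨j, by simpa using hj, hl⟩) (Set.disjoint_left.1 h2 hl')
        · rw [h6 j (by simpa using hj) k (by simpa using hk) l hl hl']
      · rintro (_ | k) ψ hψ
        · obtain rfl : φ = ψ := by simpa using hψ
          exact h3
        · exact h7 k ψ (by simpa using hψ)
    · rintro ⟨B, ⟨h1, h2⟩, h3⟩
      have hsub : {l | ∃ k < φs.length, l ∈ B (k + 1)} ⊆ A := by
        rintro l ⟨k, hk, hl⟩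
        exact (h1 l).2 ⟨k + 1, by simpa using hk, hl⟩
      refine ⟨B 0, {l | ∃ k < φs.length, l ∈ B (k + 1)}, fun l => ?_, ?_, h3 0 φ (by simp), ?_⟩
      · rw [h1]
        constructor
        · rintro ⟨_ | k, hk, h⟩
          · exact .inl h
          · exact .inr ⟨k, by simpa using hk, h⟩
        · rintro (h | ⟨k, hk, h⟩)
          · exact ⟨0, by simp, h⟩
          · exact ⟨k + 1, by simpa using hk, h⟩
      · rw [Set.disjoint_left]
        rintro l hl ⟨k, hk, hl'⟩
        have := h2 0 (by simp) (k + 1) (by simpa using hk) l hl hl'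
        omega
      · refine (ih fun l hl => hA (hsub hl)).2 ⟨fun k => B (k + 1), ⟨fun l => Iff.rfl, ?_⟩, ?_⟩
        · intro j hj k hk l hl hl'
          have := h2 (j + 1) (by simpa using hj) (k + 1) (by simpa using hk) l hl hl'
          omega
        · intro k ψ hψ
          exact h3 (k + 1) ψ (by simpa using hψ)

theorem SL.sat_exs {xs : List L} {φ : SL L} {S : State Loc null N} {ι : L → Option Loc} :
    SL.Sat I (SL.exs xs φ) S ι ↔
      ∃ ι', (∀ x ∈ xs, ∃ l, ι' x = some l) ∧ (∀ x ∉ xs, ι' x = ι x) ∧ SL.Sat I φ S ι' := by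
  induction xs generalizing ι with
  | nil =>
    constructor
    · exact fun h => ⟨ι, by simp, by simp, h⟩
    · rintro ⟨ι', -, h, h'⟩
      obtain rfl : ι' = ι := funext fun x => h x (by simp)
      exact h'
  | cons x xs ih =>
    change (∃ l, SL.Sat I (SL.exs xs φ) S (Function.update ι x (some l))) ↔ _
    constructor
    · rintro ⟨l, hl⟩
      obtain ⟨ι', h1, h2, h3⟩ := ih.1 hl
      refine ⟨ι', fun y hy => ?_, fun y hy => ?_, h3⟩
      · by_cases hy' : y ∈ xs
        · exact h1 y hy'
        · obtain rfl : y = x := by simpa [hy'] using hy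
          exact ⟨l, by simp [h2 y hy']⟩
      · rw [List.mem_cons, not_or] at hy
        rw [h2 y hy.2, Function.update_of_ne hy.1]
    · rintro ⟨ι', h1, h2, h3⟩
      obtain ⟨l, hl⟩ := h1 x (by simp)
      refine ⟨l, ih.2 ⟨ι', fun y hy => h1 y (by simp [hy]), fun y hy => ?_, h3⟩⟩
      by_cases hy' : y = x
      · subst hy'
        simp [hl]
      · rw [Function.update_of_ne hy']
        exact h2 y (by simp [hy, hy'])

end Restriction

-- From characteristic formulae to an inductive predicate on heap domains

section Unfolding

variable {Loc : Type*} {null : Loc} {N : ℕ}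

/-- Satisfaction of a pure formula under a total valuation. -/
def Pure.Holds {V : Type} (π : Pure V) (ρ : V → Loc) : Prop :=
  (∀ e ∈ π.eqs, ρ e.1 = ρ e.2) ∧ ∀ e ∈ π.neqs, ρ e.1 ≠ ρ e.2

theorem Pure.Holds.eq_of_eqClosure {V : Type} {π : Pure V} {ρ : V → Loc} (h : π.Holds ρ) {a b : V}
    (hab : π.EqClosure a b) : ρ a = ρ b := by
  induction hab with
  | rel a b h' => exact h.1 _ h'
  | refl => rfl
  | symm _ _ _ ih => exact ih.symm
  | trans _ _ _ _ _ ih₁ ih₂ => exact ih₁.trans ih₂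

theorem Pure.sat_map_iff {V L : Type} {π : Pure V} {A : Set V} (hπ : π.VarsIn A)
    {g : V → Var L} {s : ℕ → Option Loc} {ι : L → Option Loc} {ρ : V → Loc}
    (h : ∀ x ∈ A, evalVar s ι (g x) = some (ρ x)) : (π.map g).Sat s ι ↔ π.Holds ρ := by
  simp only [Pure.Sat, Pure.map, Pure.Holds, List.mem_map, forall_exists_index, and_imp,
    forall_apply_eq_imp_iff₂, Prod.map_fst, Prod.map_snd]
  refine and_congr (forall₂_congr fun e he => ?_) (forall₂_congr fun e he => ?_)
  · rw [h _ (hπ.1 e he).1, h _ (hπ.1 e he).2]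
    simp [eq_comm]
  · rw [h _ (hπ.2 e he).1, h _ (hπ.2 e he).2]
    simp

theorem map_eq_map_some_iff_of_forall {V : Type*} {g : V → Option Loc} {ρ : V → Loc}
    {xs : List V} (h : ∀ x ∈ xs, g x = some (ρ x)) {vs : List Loc} :
    xs.map g = vs.map some ↔ xs.map ρ = vs := by
  have : xs.map g = (xs.map ρ).map some := by
    rw [List.map_map]
    exact List.map_congr_left h
  rw [this]
  exact (List.map_injective_iff.2 (Option.some_injective _)).eq_iff

/-- Read with `a` and `b` as the copies at a position and at a child position, this says that the
equalities for parameter passing fix the child's parameters to the values of the actual arguments.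
-/
theorem forall_mem_zip_iff {U V W : Type*} {g : U → Option Loc} {a : V → U} {b : W → U}
    {ρ : V → Loc} :
    ∀ {ys : List V} {xs : List W}, (∀ y ∈ ys, g (a y) = some (ρ y)) → ys.length = xs.length →
    ((∀ e ∈ (ys.map a).zip (xs.map b), ∃ l, g e.1 = some l ∧ g e.2 = some l) ↔
      xs.map (fun x => g (b x)) = (ys.map ρ).map some)
  | [], [], _, _ => by simp
  | [], _ :: _, _, h' => by simp at h'
  | _ :: _, [], _, h' => by simp at h'
  | y :: ys, x :: xs, hy, h' => by
    have := forall_mem_zip_iff (b := b) (fun y' hy' => hy y' (List.mem_cons_of_mem _ hy'))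
      (by simpa using h' : ys.length = xs.length)
    rw [List.map_cons, List.map_cons, List.zip_cons_cons, List.forall_mem_cons, this,
      hy y (by simp)]
    simp [eq_comm]

theorem map_lookup_zip {V : Type*} [DecidableEq V] :
    ∀ {xs : List V} {vs : List Loc}, xs.Nodup → xs.length = vs.length →
    xs.map (fun x => (xs.zip vs).lookup x) = vs.map some
  | [], [], _, _ => rfl
  | [], _ :: _, _, h => by simp at h
  | _ :: _, [], _, h => by simp at h
  | x :: xs, v :: vs, hx, h => by
    rw [List.nodup_cons] at hx
    rw [List.map_cons, List.map_cons, List.zip_cons_cons, List.lookup_cons_self]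
    congr 1
    rw [← map_lookup_zip hx.2 (by simpa using h : xs.length = vs.length)]
    refine List.map_congr_left fun y hy => ?_
    have : (y == x) = false := by
      rw [beq_eq_false_iff_ne]
      rintro rfl
      exact hx.1 hy
    rw [List.lookup_cons, this]

namespace RecSystem

theorem exists_of_mem_rules {P : RecSystem} {i : ℕ} {R : Rule} (h : R ∈ P.rules i) :
    i < P.length ∧ ∃ D ∈ P, P.params i = D.params ∧ R ∈ D.rules := by
  unfold rules at h
  cases hD : P[i]? with
  | none => simp [hD] at h
  | some D =>
    refine ⟨(List.getElem?_eq_some_iff.1 hD).1, D, List.mem_of_getElem? hD, ?_, ?_⟩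
    · simp [params, hD]
    · simpa [hD] using h

/-- The variables of a rule `R` of the predicate `P_i`. -/
def scope (P : RecSystem) (i : ℕ) (R : Rule) : Set ℕ := {x | x ∈ P.params i ∨ x ∈ R.exVars}

theorem WellFormed.nodup_params {P : RecSystem} (hP : P.WellFormed) (i : ℕ) :
    (P.params i).Nodup := by
  unfold params
  cases hD : P[i]? with
  | none => simp
  | some D => simpa using (hP D (List.mem_of_getElem? hD)).1

theorem WellFormed.rule {P : RecSystem} (hP : P.WellFormed) {i : ℕ} {R : Rule}
    (h : R ∈ P.rules i) : List.Disjoint (P.params i) R.exVars ∧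
    (∀ c ∈ R.head, c.WellFormed (P.scope i R)) ∧
    (∀ c ∈ R.tail, c.pred < P.length ∧ c.args.length = (P.params c.pred).length ∧
      ∀ y ∈ c.args, y ∈ P.scope i R) ∧ R.pure.VarsIn (P.scope i R) := by
  obtain ⟨-, D, hD, h1, h2⟩ := exists_of_mem_rules h
  simp only [scope, h1]
  exact (hP D hD).2 R h2

theorem Progress.head_eq {P : RecSystem} (hP : P.Progress) {i : ℕ} {R : Rule}
    (h : R ∈ P.rules i) : ∃ c, R.head = [c] := by
  obtain ⟨-, D, hD, h1, h2⟩ := exists_of_mem_rules h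
  exact hP D hD R h2

/-- `P_i` holds of `vs` in the part of the heap with domain `A`. -/
inductive PHolds (P : RecSystem) (S : State Loc null N) : ℕ → List Loc → Set Loc → Prop where
  | mk {i : ℕ} {R : Rule} {c : PointsTo ℕ} (ρ : ℕ → Loc) {A : Set Loc} (B : ℕ → Set Loc) :
    R ∈ P.rules i → R.head = [c] → R.pure.Holds ρ → S.CellAt (ρ c.src) (c.dst.map ρ) →
    (∀ l, l ∈ A ↔ l = ρ c.src ∨ ∃ k < R.tail.length, l ∈ B k) →
    (∀ k < R.tail.length, ρ c.src ∉ B k) →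
    (∀ j < R.tail.length, ∀ k < R.tail.length, ∀ l, l ∈ B j → l ∈ B k → j = k) →
    (∀ k o, R.tail[k]? = some o → PHolds P S o.pred (o.args.map ρ) (B k)) →
    PHolds P S i ((P.params i).map ρ) A

theorem exists_valuation {P : RecSystem} {i : ℕ} {p : List ℕ} {ι : ℕ × List ℕ → Option Loc} {vs : List Loc}
    (hι : (P.params i).map (fun x => ι (x, p)) = vs.map some) {x : ℕ} (hx : x ∈ P.params i) :
    ∃ v, ι (x, p) = some v := by
  have : ι (x, p) ∈ vs.map some := hι ▸ List.mem_map_of_mem hx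
  obtain ⟨v, -, hv⟩ := List.mem_map.1 this
  exact ⟨v, hv.symm⟩

/-- Position and valuation are arbitrary because the induction meets each subtree at a deeper
position and under the valuation built by its ancestors; only the values of the parameters at `p`
matter. -/
theorem pHolds_of_sat_charFormula {P : RecSystem} (hP : P.WellFormed) (hP' : P.Progress)
    (S : State Loc null N) {i : ℕ} (t : UnfoldingTree P i) :
    ∀ (p : List ℕ) (ι : ℕ × List ℕ → Option Loc) (vs : List Loc) (A : Set Loc), A ⊆ S.dom →
      (P.params i).map (fun x => ι (x, p)) = vs.map some →
      SL.Sat (fun _ _ _ => False) (P.charFormula t p) (S.restrict A) ι → PHolds P S i vs A := by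
  induction t with
  | node i j ch ih =>
    intro p ι vs A hA hι hsat
    have hR : (P.rules i).get j ∈ P.rules i := List.get_mem _ _
    obtain ⟨hdis, hhead, htail, hpure⟩ := hP.rule hR
    obtain ⟨c, hc⟩ := hP'.head_eq hR
    unfold charFormula at hsat
    generalize (P.rules i).get j = R at *
    obtain ⟨ι₁, hex, hnex, hsat⟩ := SL.sat_exs.1 hsat
    -- The default `null` is taken only outside the scope of the rule, where nothing is evaluated.
    set ρ : ℕ → Loc := fun x => (ι₁ (x, p)).getD null with hρ
    have hnex' : ∀ x ∉ R.exVars, ι₁ (x, p) = ι (x, p) := fun x hx => hnex _ (by simpa using hx)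
    have hval : ∀ x ∈ P.scope i R, evalVar S.store ι₁ (atPos p x) = some (ρ x) := by
      intro x hx
      change ι₁ (x, p) = some ((ι₁ (x, p)).getD null)
      by_cases hx' : x ∈ R.exVars
      · obtain ⟨v, hv⟩ := hex (x, p) (by simpa using hx')
        simp [hv]
      · obtain ⟨v, hv⟩ := exists_valuation hι (hx.resolve_right hx')
        simp [hnex' x hx', hv]
    have hparams : (P.params i).map ρ = vs := by
      refine (map_eq_map_some_iff_of_forall fun x hx => ?_).1 hι
      rw [← hval x (.inl hx)]
      exact (hnex' x (hdis hx)).symm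
    rw [← hparams]
    obtain ⟨hpi, hsat⟩ := hsat
    replace hpi := (Pure.sat_map_iff hpure (g := atPos p) hval).1 hpi
    obtain ⟨B, C, h1, h2, h3, h4⟩ := (SL.sat_star_restrict storeMono_false S hA).1 hsat
    have hB : B ⊆ S.dom := fun l hl => hA ((h1 l).2 (.inl hl))
    have hC : C ⊆ S.dom := fun l hl => hA ((h1 l).2 (.inr hl))
    rw [hc] at h3
    obtain ⟨D, hD, hD'⟩ := (SL.sat_bigStar_restrict storeMono_false S hB).1 h3
    have hBD : B = D 0 := by
      ext l
      rw [hD.1]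
      simp
    have hhd := hhead c (by simp [hc])
    replace hD' : PointsTo.Sat ⟨atPos p c.src, c.dst.map (atPos p)⟩ (S.restrict (D 0)) ι₁ :=
      hD' 0 (.pto _) (by simp)
    rw [← hBD, PointsTo.sat_restrict S hB (by simpa using hhd.2.1)] at hD'
    obtain ⟨a, ws, e1, e2, rfl, e4⟩ := hD'
    obtain rfl : ρ c.src = a := Option.some.inj ((hval _ hhd.1).symm.trans e1)
    rw [List.map_map] at e2
    replace e2 := (map_eq_map_some_iff_of_forall fun y hy => hval y (hhd.2.2 y hy)).1 e2
    subst e2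
    obtain ⟨E, hE, hE'⟩ := (SL.sat_bigStar_restrict storeMono_false S hC).1 h4
    rw [List.length_ofFn] at hE
    refine .mk ρ E hR hc hpi e4 (fun l => ?_) (fun k hk hl => ?_) hE.2 (fun k o hk => ?_)
    · rw [h1, hE.1]
      simp
    · exact Set.disjoint_left.1 h2 rfl ((hE.1 _).2 ⟨k, hk, hl⟩)
    · obtain ⟨hk', rfl⟩ := List.getElem?_eq_some_iff.1 hk
      have hs := hE' k _ (by rw [List.getElem?_ofFn, dif_pos hk'])
      obtain ⟨ι₂, -, hnex₂, hs⟩ := SL.sat_exs.1 hs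
      refine ih ⟨k, hk'⟩ _ _ _ _ (fun l hl => hC ((hE.1 l).2 ⟨k, hk', hl⟩)) ?_ hs.2
      have h6 := hs.1.1
      obtain ⟨-, h7, h8⟩ := htail _ (List.getElem_mem hk')
      simp only at h6
      refine (forall_mem_zip_iff (g := evalVar S.store ι₂) (a := atPos p)
        (b := atPos (p ++ [k])) (ρ := ρ) (fun y hy => ?_) h7).1 h6
      rw [← hval y (h8 y hy)]
      -- Binding the copies at `p ++ [k]` leaves those at `p` unchanged, as the two positions
      -- differ.
      simpa only [evalVar] using hnex₂ _ (by simp)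

/-- The tree is chosen before the position and the valuation, so the subtrees can be assembled first
and placed at their positions afterwards. -/
theorem exists_sat_charFormula_of_pHolds {P : RecSystem} (hP : P.WellFormed) 
    (S : State Loc null N) {i : ℕ} {vs : List Loc} {A : Set Loc} (h : PHolds P S i vs A) :
    A ⊆ S.dom → ∃ t : UnfoldingTree P i, ∀ (p : List ℕ) (ι : ℕ × List ℕ → Option Loc),
      (P.params i).map (fun x => ι (x, p)) = vs.map some →
      SL.Sat (fun _ _ _ => False) (P.charFormula t p) (S.restrict A) ι := by
  induction h with
  | @mk i R c ρ A B hR hc hpi hcell hA hsrc hdisj _ ih =>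
    intro hdom
    obtain ⟨hdis, hhead, htail, hpure⟩ := hP.rule hR
    have hBA : ∀ k < R.tail.length, B k ⊆ A := fun k hk l hl => (hA l).2 (.inr ⟨k, hk, hl⟩)
    obtain ⟨j, rfl⟩ := List.get_of_mem hR
    have ih' : ∀ k : Fin ((P.rules i).get j).tail.length, _ := fun k =>
      ih k.val (((P.rules i).get j).tail.get k) (List.getElem?_eq_getElem k.2)
        ((hBA k k.2).trans hdom)
    choose ch hch using ih'
    refine ⟨.node i j ch, fun p ι hι => ?_⟩
    unfold charFormula
    generalize (P.rules i).get j = R at *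
    set ι₁ : ℕ × List ℕ → Option Loc :=
      fun x => if x.2 = p ∧ x.1 ∈ R.exVars then some (ρ x.1) else ι x with hι₁
    have hval : ∀ x ∈ P.scope i R, evalVar S.store ι₁ (atPos p x) = some (ρ x) := by
      intro x hx
      by_cases hx' : x ∈ R.exVars
      · simp [evalVar, hι₁, hx']
      · have := List.map_inj_left.1 (hι.trans (List.map_map ..)) x (hx.resolve_right hx')
        simp [evalVar, hι₁, hx', this]
    refine SL.sat_exs.2 ⟨ι₁, ?_, ?_, ?_⟩
    · intro x hx
      obtain ⟨z, hz, rfl⟩ := List.mem_map.1 hx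
      exact ⟨ρ z, by simp [hι₁, hz]⟩
    · intro x hx
      refine if_neg fun h => hx ?_
      obtain ⟨x, q⟩ := x
      obtain ⟨rfl, h⟩ := h
      exact List.mem_map_of_mem h
    refine ⟨(Pure.sat_map_iff hpure (g := atPos p) hval).2 hpi,
      (SL.sat_star_restrict storeMono_false S hdom).2
        ⟨{ρ c.src}, {l | ∃ k < R.tail.length, l ∈ B k}, hA, ?_, ?_, ?_⟩⟩
    · rw [Set.disjoint_left]
      rintro _ rfl ⟨k, hk, hl⟩
      exact hsrc k hk hl
    · have hd : {ρ c.src} ⊆ S.dom := by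
        rintro _ rfl
        exact hdom ((hA _).2 (.inl rfl))
      rw [hc]
      refine (SL.sat_bigStar_restrict storeMono_false S hd).2 ⟨fun _ => {ρ c.src}, ?_, ?_⟩
      · exact ⟨by simp, by simp⟩
      · intro k φ hk
        obtain ⟨rfl, rfl⟩ : k = 0 ∧ SL.pto ⟨atPos p c.src, c.dst.map (atPos p)⟩ = φ := by
          cases k <;> simp_all
        have hhd := hhead c (by simp [hc])
        refine (PointsTo.sat_restrict S hd (by simpa using hhd.2.1)).2
          ⟨_, c.dst.map ρ, hval _ hhd.1, ?_, rfl, hcell⟩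
        rw [List.map_map]
        exact (map_eq_map_some_iff_of_forall fun y hy => hval y (hhd.2.2 y hy)).2 rfl
    · have hd : {l | ∃ k < R.tail.length, l ∈ B k} ⊆ S.dom :=
        fun l hl => hdom ((hA l).2 (.inr hl))
      refine (SL.sat_bigStar_restrict storeMono_false S hd).2 ⟨B, ⟨?_, ?_⟩, fun k φ hk => ?_⟩
      · simp
      · simpa using hdisj
      · obtain ⟨hk', rfl⟩ : ∃ h : k < R.tail.length, _ = φ := by
          rw [List.getElem?_ofFn] at hk
          split_ifs at hk with h
          exact ⟨h, Option.some.inj hk⟩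
        obtain ⟨-, h7, h8⟩ := htail _ (List.getElem_mem hk')
        set o := R.tail[k] with ho
        have hlook := map_lookup_zip (vs := o.args.map ρ) (hP.nodup_params o.pred)
          (by rw [List.length_map, h7])
        -- The formal parameters of the child are matched with the values of the actual arguments.
        -- The lookup succeeds on every parameter, so `null` is never used there.
        set f₂ : ℕ × List ℕ → Loc :=
          fun x => (((P.params o.pred).zip (o.args.map ρ)).lookup x.1).getD null with hf₂
        have hf : ∀ q : List ℕ, (P.params o.pred).map (fun x => some (f₂ (x, q))) =
            (o.args.map ρ).map some := by
          intro q
          rw [← hlook]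
          refine List.map_congr_left fun x hx => ?_
          have : ((P.params o.pred).zip (o.args.map ρ)).lookup x ∈ (o.args.map ρ).map some :=
            hlook ▸ List.mem_map_of_mem hx
          obtain ⟨v, -, hv⟩ := List.mem_map.1 this
          simp [hf₂, ← hv]
        set ι₂ : ℕ × List ℕ → Option Loc := fun x =>
          if x.2 = p ++ [k] ∧ x.1 ∈ P.params o.pred then some (f₂ x) else ι₁ x with hι₂
        have hι₂' : (P.params o.pred).map (fun x => ι₂ (x, p ++ [k])) =
            (o.args.map ρ).map some := by
          rw [← hf (p ++ [k])]
          refine List.map_congr_left fun x hx => ?_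
          simp [hι₂, hx]
        refine SL.sat_exs.2 ⟨ι₂, ?_, ?_, ⟨?_, by simp⟩, hch ⟨k, hk'⟩ _ _ hι₂'⟩
        · intro x hx
          obtain ⟨z, hz, rfl⟩ := List.mem_map.1 hx
          exact ⟨f₂ (z, p ++ [k]), if_pos ⟨rfl, hz⟩⟩
        · intro x hx
          refine if_neg fun h => hx ?_
          obtain ⟨x, q⟩ := x
          obtain ⟨rfl, h⟩ := h
          exact List.mem_map_of_mem h
        · refine (forall_mem_zip_iff (ρ := ρ) (fun y hy => ?_) h7).2 hι₂'
          rw [← hval y (h8 y hy)]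
          simp [evalVar, hι₂]

theorem predSat_restrict_iff {P : RecSystem} (hP : P.WellFormed) (hP' : P.Progress)
    (S : State Loc null N) {i : ℕ} {vs : List Loc} (hvs : vs.length = (P.params i).length)
    {A : Set Loc} (hA : A ⊆ S.dom) : P.PredSat i vs (S.restrict A) ↔ PHolds P S i vs A := by
  have hι : (P.params i).map (fun x => (fun v : ℕ × List ℕ => if v.2 = [] then
      ((P.params i).zip vs).lookup v.1 else none) (x, [])) = vs.map some := by
    simpa using map_lookup_zip (hP.nodup_params i) hvs.symm
  constructor
  · rintro ⟨t, ht⟩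
    exact pHolds_of_sat_charFormula hP hP' S t [] _ vs A hA hι ht
  · intro h
    obtain ⟨t, ht⟩ := exists_sat_charFormula_of_pHolds hP S h hA
    exact ⟨t, ht [] _ hι⟩

end RecSystem

end Unfolding

-- Unfolding trees whose nodes are locations

section Decoration

variable {Loc : Type*} {null : Loc} {N : ℕ}

/-- The data of the node of an unfolding tree which allocates a location: the predicate and the
rule at the node, the locations allocated by its children, and the values of its variables. -/
structure NodeData (Loc : Type*) where
  pred : ℕ
  rule : Rule
  child : ℕ → Loc
  val : ℕ → Loc

/-- `b` is a child of `a`. -/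
def NodeData.Step (d : Loc → NodeData Loc) (a b : Loc) : Prop :=
  ∃ k < (d a).rule.tail.length, (d a).child k = b

/-- The data `d` describe an unfolding tree of `P_i` whose nodes are the locations in `A` and whose
root is `r`, together with a valuation that witnesses `P_i(vs)`. -/
structure IsDecoration (P : RecSystem) (S : State Loc null N) (i : ℕ) (vs : List Loc)
    (A : Set Loc) (r : Loc) (d : Loc → NodeData Loc) : Prop where
  root_mem : r ∈ A
  root_pred : (d r).pred = i
  root_val : (P.params i).map (d r).val = vs
  rule_mem : ∀ l ∈ A, (d l).rule ∈ P.rules (d l).pred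
  pure : ∀ l ∈ A, (d l).rule.pure.Holds (d l).val
  cell : ∀ l ∈ A, ∀ c ∈ (d l).rule.head,
    (d l).val c.src = l ∧ S.CellAt l (c.dst.map (d l).val)
  child : ∀ l ∈ A, ∀ k o, (d l).rule.tail[k]? = some o →
    (d l).child k ∈ A ∧ (d ((d l).child k)).pred = o.pred ∧
    (P.params o.pred).map (d ((d l).child k)).val = o.args.map (d l).val ∧
    (d l).child k ≠ r ∧ ∃ t < N, S.heap l (t + 1) = some ((d l).child k)
  parent_unique : ∀ l ∈ A, ∀ l' ∈ A, ∀ k < (d l).rule.tail.length,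
    ∀ k' < (d l').rule.tail.length, (d l).child k = (d l').child k' → l = l' ∧ k = k'
  reach : ∀ l ∈ A, Relation.ReflTransGen (NodeData.Step d) r l

namespace IsDecoration

open Relation

variable {P : RecSystem} {S : State Loc null N} {i : ℕ} {vs : List Loc} {A : Set Loc} {r : Loc}
  {d : Loc → NodeData Loc}

theorem step_mem (h : IsDecoration P S i vs A r d) {a b : Loc} (ha : a ∈ A)
    (hab : NodeData.Step d a b) : b ∈ A ∧ b ≠ r := by
  obtain ⟨k, hk, rfl⟩ := hab
  obtain ⟨h1, -, -, h2, -⟩ := h.child a ha k _ (List.getElem?_eq_getElem hk)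
  exact ⟨h1, h2⟩

theorem reach_mem (h : IsDecoration P S i vs A r d) {a b : Loc} (ha : a ∈ A)
    (hab : ReflTransGen (NodeData.Step d) a b) : b ∈ A := by
  induction hab with
  | refl => exact ha
  | tail _ h' ih => exact (h.step_mem ih h').1

theorem step_left_unique (h : IsDecoration P S i vs A r d) {a b c : Loc} (ha : a ∈ A) (hb : b ∈ A)
    (hac : NodeData.Step d a c) (hbc : NodeData.Step d b c) : a = b := by
  obtain ⟨k, hk, rfl⟩ := hac
  obtain ⟨j, hj, e⟩ := hbc
  exact (h.parent_unique b hb a ha j hj k hk e).1.symm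

/-- Parents are unique, so a cycle through a node also passes through its parent. Moving up along
the path from the root would give a cycle through the root, which has no parent. -/
theorem acyclic (h : IsDecoration P S i vs A r d) {a : Loc} (ha : a ∈ A) :
    ¬ TransGen (NodeData.Step d) a a := by
  induction h.reach a ha with
  | refl =>
    intro hr
    obtain ⟨b, hb, hbr⟩ := TransGen.tail'_iff.1 hr
    exact (h.step_mem (h.reach_mem h.root_mem hb) hbr).2 rfl
  | @tail b c hb hbc ih =>
    intro hc
    have hbA := h.reach_mem h.root_mem hb
    obtain ⟨b', hb', hbc'⟩ := TransGen.tail'_iff.1 hc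
    obtain rfl := h.step_left_unique (h.reach_mem ha hb') hbA hbc' hbc
    exact ih hbA (TransGen.head' hbc hb')

/-- The ancestors of a node form a chain because each node has at most one parent. -/
theorem linear (h : IsDecoration P S i vs A r d) {a b x : Loc} (ha : a ∈ A) (hb : b ∈ A)
    (hax : ReflTransGen (NodeData.Step d) a x) (hbx : ReflTransGen (NodeData.Step d) b x) :
    ReflTransGen (NodeData.Step d) a b ∨ ReflTransGen (NodeData.Step d) b a := by
  induction hax with
  | refl => exact .inr hbx
  | @tail y z hay hyz ih =>
    rcases ReflTransGen.cases_tail hbx with rfl | ⟨y', hby, hyz'⟩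
    · exact .inl (hay.tail hyz)
    · obtain rfl := h.step_left_unique (h.reach_mem hb hby) (h.reach_mem ha hay) hyz' hyz
      exact ih hby

/-- The part of the heap that belongs to a node is its set of descendants. Acyclicity and finiteness
of `A` allow induction from the leaves upwards. -/
theorem pHolds (hP : P.Progress) (h : IsDecoration P S i vs A r d) (hA : A.Finite) :
    P.PHolds S i vs A := by
  have : Finite A := hA
  have wf : WellFounded fun x y : A => TransGen (NodeData.Step d) y.1 x.1 :=
    have : IsTrans A fun x y : A => TransGen (NodeData.Step d) y.1 x.1 :=
      ⟨fun _ _ _ h₁ h₂ => h₂.trans h₁⟩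
    have : Std.Irrefl fun x y : A => TransGen (NodeData.Step d) y.1 x.1 :=
      ⟨fun x => h.acyclic x.2⟩
    Finite.wellFounded_of_trans_of_irrefl _
  have key : ∀ a : A, P.PHolds S (d a).pred ((P.params (d a).pred).map (d a).val)
      {x | ReflTransGen (NodeData.Step d) a x} := by
    intro a
    induction a using wf.induction with
    | _ a ih =>
    obtain ⟨a, ha⟩ := a
    obtain ⟨c, hc⟩ := hP.head_eq (h.rule_mem a ha)
    obtain ⟨h1, h2⟩ := h.cell a ha c (by simp [hc])
    have hstep : ∀ k < (d a).rule.tail.length, NodeData.Step d a ((d a).child k) :=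
      fun k hk => ⟨k, hk, rfl⟩
    refine .mk (c := c) (d a).val (fun k => {x | ReflTransGen (NodeData.Step d) ((d a).child k) x})
      (h.rule_mem a ha) hc (h.pure a ha) (by rwa [h1]) (fun l => ?_) (fun k hk hl => ?_)
      (fun j hj k hk l hl hl' => ?_) (fun k o hk => ?_)
    · rw [h1, Set.mem_ofPred_eq, ReflTransGen.cases_head_iff, eq_comm]
      refine or_congr_right ⟨?_, ?_⟩
      · rintro ⟨_, ⟨k, hk, rfl⟩, hl⟩
        exact ⟨k, hk, hl⟩
      · rintro ⟨k, hk, hl⟩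
        exact ⟨_, hstep k hk, hl⟩
    · rw [h1] at hl
      exact h.acyclic ha (TransGen.head' (hstep k hk) hl)
    · by_contra hne
      -- No child of `a` is a descendant of another child: otherwise `a`, the only parent, would be
      -- its own descendant. With `linear` this separates the parts of distinct children.
      have aux : ∀ j < (d a).rule.tail.length, ∀ k < (d a).rule.tail.length, j ≠ k →
          ¬ ReflTransGen (NodeData.Step d) ((d a).child j) ((d a).child k) := by
        intro j hj k hk hne hjk
        rcases ReflTransGen.cases_tail hjk with e | ⟨y, hy, hyk⟩
        · exact hne (h.parent_unique a ha a ha j hj k hk e.symm).2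
        · obtain rfl := h.step_left_unique (h.reach_mem (h.step_mem ha (hstep j hj)).1 hy) ha hyk
            (hstep k hk)
          exact h.acyclic ha (TransGen.head' (hstep j hj) hy)
      rcases h.linear (h.step_mem ha (hstep j hj)).1 (h.step_mem ha (hstep k hk)).1 hl hl' with e | e
      · exact aux j hj k hk hne e
      · exact aux k hk j hj (Ne.symm hne) e
    · have hk' : k < (d a).rule.tail.length := (List.getElem?_eq_some_iff.1 hk).1
      obtain ⟨e1, e2, e3, -⟩ := h.child a ha k o hk
      have := ih ⟨_, e1⟩ (TransGen.single (hstep k hk'))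
      simpa only [e2, e3] using this
  have := key ⟨r, h.root_mem⟩
  simp only [h.root_pred, h.root_val] at this
  convert this using 1
  ext l
  exact ⟨h.reach l, h.reach_mem h.root_mem⟩

end IsDecoration

open Relation in
-- The decorations of the children have disjoint node sets and are glued below a new root, the
-- location allocated by the head. Connectivity supplies the edges from this root to the roots of
-- the children.
theorem RecSystem.PHolds.exists_isDecoration {P : RecSystem} (hC : P.Connected)
    {S : State Loc null N} {i : ℕ} {vs : List Loc} {A : Set Loc} (h : P.PHolds S i vs A) :
    ∃ r d, IsDecoration P S i vs A r d := by
  classical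
  induction h with
  | @mk i R c ρ A B hR hc hpi hcell hA hsrc hdisj _ ih =>
    have ih' : ∀ k, ∃ r d, ∀ o, R.tail[k]? = some o →
        IsDecoration P S o.pred (o.args.map ρ) (B k) r d := by
      intro k
      cases hk : R.tail[k]? with
      | none => exact ⟨null, fun _ => ⟨0, R, fun _ => null, fun _ => null⟩, by simp⟩
      | some o =>
        obtain ⟨r, d, h⟩ := ih k o hk
        exact ⟨r, d, by rintro _ ⟨⟩; exact h⟩
    choose r d hd using ih'
    have hlt : ∀ {k o}, R.tail[k]? = some o → k < R.tail.length :=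
      fun h => (List.getElem?_eq_some_iff.1 h).1
    have hd' : ∀ k (hk : k < R.tail.length),
        IsDecoration P S R.tail[k].pred (R.tail[k].args.map ρ) (B k) (r k) (d k) :=
      fun k hk => hd k _ (List.getElem?_eq_getElem hk)
    set a := ρ c.src with ha
    -- The choice in the second branch is forced by disjointness, and the last branch is reached
    -- only outside `A`.
    let D : Loc → NodeData Loc := fun l =>
      if l = a then ⟨i, R, r, ρ⟩
      else if h : ∃ k < R.tail.length, l ∈ B k then d h.choose l else d 0 l
    have hDa : D a = ⟨i, R, r, ρ⟩ := if_pos rfl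
    have hDB : ∀ k < R.tail.length, ∀ l ∈ B k, D l = d k l := by
      intro k hk l hl
      have h1 : l ≠ a := by
        rintro rfl
        exact hsrc k hk hl
      have h2 : ∃ k < R.tail.length, l ∈ B k := ⟨k, hk, hl⟩
      have h3 : h2.choose = k := hdisj _ h2.choose_spec.1 _ hk l h2.choose_spec.2 hl
      simp only [D, h1, if_false, h2, dif_pos, h3]
    have hroot : ∀ k (hk : k < R.tail.length), r k ∈ B k := fun k hk => (hd' k hk).root_mem
    have hchild : ∀ k (hk : k < R.tail.length), ∀ l ∈ B k, ∀ j < (d k l).rule.tail.length,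
        (d k l).child j ∈ B k ∧ (d k l).child j ≠ r k := by
      intro k hk l hl j hj
      exact (hd' k hk).step_mem hl ⟨j, hj, rfl⟩
    refine ⟨a, D, ?_⟩
    constructor
    · exact (hA a).2 (.inl rfl)
    · rw [hDa]
    · rw [hDa]
    · intro l hl
      rcases (hA l).1 hl with rfl | ⟨k, hk, hl⟩
      · rwa [hDa]
      · rw [hDB k hk l hl]
        exact (hd' k hk).rule_mem l hl
    · intro l hl
      rcases (hA l).1 hl with rfl | ⟨k, hk, hl⟩
      · rwa [hDa]
      · rw [hDB k hk l hl]
        exact (hd' k hk).pure l hl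
    · intro l hl
      rcases (hA l).1 hl with rfl | ⟨k, hk, hl⟩
      · rw [hDa]
        simp only [hc, List.mem_singleton]
        rintro _ rfl
        exact ⟨rfl, hcell⟩
      · rw [hDB k hk l hl]
        exact (hd' k hk).cell l hl
    · intro l hl k o
      rcases (hA l).1 hl with rfl | ⟨j, hj, hl⟩
      · rw [hDa]
        intro ho
        have hk := hlt ho
        have hdk := hd k o ho
        rw [hDB k hk _ (hroot k hk)]
        refine ⟨(hA _).2 (.inr ⟨k, hk, hroot k hk⟩), hdk.root_pred, hdk.root_val, ?_, ?_⟩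
        · intro e
          exact hsrc k hk (e ▸ hroot k hk)
        -- By connectivity, some target `b` of the head equals the `s`-th argument of the call, and
        -- every rule of the callee allocates its `s`-th parameter in the head. So the root `r k` is
        -- the value of `b`, which is the target of an edge leaving `a`.
        · obtain ⟨-, E, hE, -, hRE⟩ := exists_of_mem_rules hR
          obtain ⟨s, y, x, b, hb, h1, h2, h3, h4⟩ :=
            hC E hE R hRE c (by simp [hc]) o (List.mem_of_getElem? ho)
          have hru := hdk.rule_mem _ hdk.root_mem
          rw [hdk.root_pred] at hru
          obtain ⟨c', hc', rfl⟩ := h4 _ hru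
          have h5 := (hdk.cell _ hdk.root_mem c' hc').1
          have h6 := congrArg (fun l => l[s]?) hdk.root_val
          simp only [List.getElem?_map, h1, h3, Option.map_some, Option.some.injEq] at h6
          obtain ⟨t, ht⟩ := List.mem_iff_getElem?.1 hb
          have h7 : S.heap a (t + 1) = some (r k) := by
            rw [hcell t, List.getElem?_map, ht, Option.map_some, hpi.eq_of_eqClosure h2, ← h6, h5]
          refine ⟨t, ?_, h7⟩
          have := (S.heap_sel a (t + 1) (by simp [h7])).2
          omega
      · rw [hDB j hj l hl]
        intro ho
        obtain ⟨e1, e2, e3, e4, e5⟩ := (hd' j hj).child l hl k o ho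
        rw [hDB j hj _ e1]
        refine ⟨(hA _).2 (.inr ⟨j, hj, e1⟩), e2, e3, ?_, e5⟩
        intro e
        exact hsrc j hj (e ▸ e1)
    -- A common child of `l` and `l'` lies in a single part `B j`. If just one of the two nodes is
    -- the new root, the child would be the root of that part and yet have a parent inside it.
    · intro l hl l' hl' k hk k' hk'
      rcases (hA l).1 hl with rfl | ⟨j, hj, hl⟩ <;> rcases (hA l').1 hl' with rfl | ⟨j', hj', hl'⟩
      · simp only [hDa] at hk hk' ⊢
        intro e
        exact ⟨trivial, hdisj k hk k' hk' _ (hroot k hk) (e ▸ hroot k' hk')⟩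
      · simp only [hDa, hDB j' hj' l' hl'] at hk hk' ⊢
        intro e
        obtain ⟨h1, h2⟩ := hchild j' hj' l' hl' k' hk'
        obtain rfl := hdisj k hk j' hj' _ (hroot k hk) (e ▸ h1)
        exact absurd e.symm h2
      · simp only [hDa, hDB j hj l hl] at hk hk' ⊢
        intro e
        obtain ⟨h1, h2⟩ := hchild j hj l hl k hk
        obtain rfl := hdisj k' hk' j hj _ (hroot k' hk') (e ▸ h1)
        exact absurd e h2
      · simp only [hDB j hj l hl, hDB j' hj' l' hl'] at hk hk' ⊢
        intro e
        obtain rfl := hdisj j hj j' hj' _ (hchild j hj l hl k hk).1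
          (e ▸ (hchild j' hj' l' hl' k' hk').1)
        exact (hd' j hj).parent_unique l hl l' hl' k hk k' hk' e
    · intro l hlA
      rcases (hA l).1 hlA with rfl | ⟨k, hk, hl⟩
      · exact .refl
      · refine ReflTransGen.head (b := r k) ⟨k, by rwa [hDa], by rw [hDa]⟩ ?_
        have := (hd' k hk).reach l hl
        clear hl hlA
        induction this with
        | refl => exact .refl
        | @tail x y hx hxy ih =>
          refine ih.tail ?_
          have hxB := (hd' k hk).reach_mem (hroot k hk) hx
          simpa only [NodeData.Step, hDB k hk x hxB] using hxy

end Decoration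

-- Encoding decorations by sets of locations, with variable values as a least fixed point

section Marking

variable {Loc : Type*} {null : Loc} {N : ℕ}

/-- An encoding of the shape of an unfolding tree by sets of locations: `label i R` are the nodes
labelled with the rule `R` of `P_i`, and `sel k t` are the nodes whose `k`-th child is reached by
the selector `t + 1`. -/
structure Marking (Loc : Type*) where
  label : ℕ → Rule → Set Loc
  sel : ℕ → ℕ → Set Loc

namespace Marking

/-- `c` is the `k`-th child of `l`. -/
def IsChild (m : Marking Loc) (S : State Loc null N) (k : ℕ) (l c : Loc) : Prop :=
  ∃ t < N, l ∈ m.sel k t ∧ S.heap l (t + 1) = some c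

/-- The `s`-th entry of `vs` is `v`. -/
def argOf (vs : List Loc) (s : ℕ) (v : Loc) : Prop := vs[s]? = some v

/-- The sets `V x` of nodes at which the variable `x` takes the value `v` respect all equalities
that are enforced by the tree. -/
structure IsClosed (m : Marking Loc) (P : RecSystem) (S : State Loc null N) (i₀ : ℕ)
    (arg : ℕ → Loc → Prop) (r : Loc) (V : ℕ → Set Loc) (v : Loc) : Prop where
  root : ∀ (s x : ℕ), (P.params i₀)[s]? = some x → arg s v → r ∈ V x
  head : ∀ i R, R ∈ P.rules i → ∀ c ∈ R.head, v ∈ m.label i R → v ∈ V c.src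
  eqs : ∀ i R, R ∈ P.rules i → ∀ e ∈ R.pure.eqs, ∀ l ∈ m.label i R, (l ∈ V e.1 ↔ l ∈ V e.2)
  call : ∀ i R, R ∈ P.rules i → ∀ k o, R.tail[k]? = some o → ∀ (s y x : ℕ), o.args[s]? = some y →
    (P.params o.pred)[s]? = some x → ∀ l ∈ m.label i R, ∀ c, m.IsChild S k l c →
    (l ∈ V y ↔ c ∈ V x)

/-- The equalities in the tree enforce that the variable `x` has the value `v` at the node `l`. -/
def Val (m : Marking Loc) (P : RecSystem) (S : State Loc null N) (i₀ : ℕ) (arg : ℕ → Loc → Prop) (r : Loc)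
    (x : ℕ) (l v : Loc) : Prop :=
  ∀ V, m.IsClosed P S i₀ arg r V v → l ∈ V x

/-- The conditions on a node `l` labelled with the rule `R` of `P_i`. -/
structure NodeOk (m : Marking Loc) (P : RecSystem) (S : State Loc null N) (i₀ : ℕ) (arg : ℕ → Loc → Prop)
    (A : Set Loc) (r : Loc) (i : ℕ) (R : Rule) (l : Loc) : Prop where
  mem : l ∈ A
  label_unique : ∀ i' R', R' ∈ P.rules i' → l ∈ m.label i' R' → i = i' ∧ R = R'
  cell : ∀ c ∈ R.head, c.dst.length ≤ N ∧ ∀ k < N,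
    (∀ y, c.dst[k]? = some y → ∃ v, m.Val P S i₀ arg r y l v ∧ S.heap l (k + 1) = some v) ∧
    (c.dst[k]? = none → ∀ v, S.heap l (k + 1) ≠ some v)
  total : ∀ x ∈ P.params i ++ R.exVars, ∃ v, m.Val P S i₀ arg r x l v
  functional : ∀ x ∈ P.params i ++ R.exVars, ∀ v v', m.Val P S i₀ arg r x l v →
    m.Val P S i₀ arg r x l v' → v = v'
  neqs : ∀ e ∈ R.pure.neqs, ∀ v, ¬ (m.Val P S i₀ arg r e.1 l v ∧ m.Val P S i₀ arg r e.2 l v)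
  child : ∀ k o, R.tail[k]? = some o → ∃ c, m.IsChild S k l c ∧
    ∃ R' ∈ P.rules o.pred, c ∈ m.label o.pred R'
  child_unique : ∀ k < R.tail.length, ∀ c c', m.IsChild S k l c → m.IsChild S k l c' → c = c'
  child_ne_root : ∀ k < R.tail.length, ¬ m.IsChild S k l r
  parent_unique : ∀ k < R.tail.length, ∀ i' R', R' ∈ P.rules i' → ∀ k' < R'.tail.length,
    ∀ l' ∈ m.label i' R', ∀ c, m.IsChild S k l c → m.IsChild S k' l' c → l = l' ∧ k = k'

end Marking

open Marking

/-- The marking `m` describes an unfolding tree with root `r` and set of nodes `A` which witnesses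
`P_i₀(vs)`. -/
structure IsMarking (P : RecSystem) (S : State Loc null N) (i₀ : ℕ) (arg : ℕ → Loc → Prop) (A : Set Loc)
    (r : Loc) (m : Marking Loc) : Prop where
  root_label : ∃ R ∈ P.rules i₀, r ∈ m.label i₀ R
  label_mem : ∀ l ∈ A, ∃ i R, R ∈ P.rules i ∧ l ∈ m.label i R
  node : ∀ i R, R ∈ P.rules i → ∀ l ∈ m.label i R, m.NodeOk P S i₀ arg A r i R l
  reach : ∀ Y : Set Loc, r ∈ Y → (∀ i R, R ∈ P.rules i → ∀ k < R.tail.length,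
    ∀ l ∈ m.label i R, l ∈ Y → ∀ c, m.IsChild S k l c → c ∈ Y) → ∀ l ∈ A, l ∈ Y

variable {P : RecSystem} {S : State Loc null N} {i₀ : ℕ} {vs : List Loc} {A : Set Loc} {r : Loc}

theorem Marking.IsClosed.eqClosure {m : Marking Loc} {V : ℕ → Set Loc} {v : Loc}
    (h : m.IsClosed P S i₀ (argOf vs) r V v) {i : ℕ} {R : Rule} (hR : R ∈ P.rules i) {l : Loc}
    (hl : l ∈ m.label i R) {a b : ℕ} (hab : R.pure.EqClosure a b) : l ∈ V a ↔ l ∈ V b := by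
  induction hab with
  | rel a b h' => exact h.eqs i R hR _ h' l hl
  | refl => rfl
  | symm _ _ _ ih => exact ih.symm
  | trans _ _ _ _ _ ih₁ ih₂ => exact ih₁.trans ih₂

/-- The marking of a decoration. -/
def IsDecoration.marking (_ : IsDecoration P S i₀ vs A r d) : Marking Loc where
  label i R := {l | l ∈ A ∧ (d l).pred = i ∧ (d l).rule = R}
  sel k t := {l | l ∈ A ∧ S.heap l (t + 1) = some ((d l).child k)}

namespace IsDecoration

variable {d : Loc → NodeData Loc}

/-- Several selectors may lead to the same child, and `marking` records them all. `IsChild` depends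
only on their common target, and the edge stored in the decoration shows that at least one exists.
-/
theorem isChild_marking_iff (h : IsDecoration P S i₀ vs A r d) {l c : Loc} (hl : l ∈ A) {k : ℕ}
    (hk : k < (d l).rule.tail.length) : h.marking.IsChild S k l c ↔ c = (d l).child k := by
  constructor
  · rintro ⟨t, -, ⟨-, h1⟩, h2⟩
    exact Option.some.inj (h2.symm.trans h1)
  · rintro rfl
    obtain ⟨-, -, -, -, t, ht, e⟩ := h.child l hl k _ (List.getElem?_eq_getElem hk)
    exact ⟨t, ht, ⟨hl, e⟩, e⟩

theorem val_child (h : IsDecoration P S i₀ vs A r d) {l : Loc} (hl : l ∈ A) {k : ℕ} {o : Call ℕ}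
    (ho : (d l).rule.tail[k]? = some o) {s y x : ℕ} (hy : o.args[s]? = some y)
    (hx : (P.params o.pred)[s]? = some x) : (d ((d l).child k)).val x = (d l).val y := by
  have := congrArg (fun l => l[s]?) (h.child l hl k o ho).2.2.1
  simpa [hx, hy] using this

theorem val_root (h : IsDecoration P S i₀ vs A r d) {s x : ℕ}
    (hx : (P.params i₀)[s]? = some x) : vs[s]? = some ((d r).val x) := by
  rw [← h.root_val, List.getElem?_map, hx]
  rfl

/-- Soundness of the fixed point: the actual valuation yields a closed family, so the least closed
family asserts nothing false. -/
theorem isClosed_marking (h : IsDecoration P S i₀ vs A r d) (v : Loc) :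
    h.marking.IsClosed P S i₀ (argOf vs) r (fun x => {l | l ∈ A ∧ (d l).val x = v}) v where
  root s x hx hv := ⟨h.root_mem, Option.some.inj ((h.val_root hx).symm.trans hv)⟩
  head := by
    rintro i R hR c hc ⟨hv, -, rfl⟩
    exact ⟨hv, (h.cell v hv c hc).1⟩
  eqs := by
    rintro i R hR e he l ⟨hl, -, rfl⟩
    simp [(h.pure l hl).1 e he]
  call := by
    rintro i R hR k o ho s y x hy hx l ⟨hl, -, rfl⟩ c hc
    rw [h.isChild_marking_iff hl (List.getElem?_eq_some_iff.1 ho).1] at hc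
    subst hc
    simp [hl, (h.child l hl k o ho).1, h.val_child hl ho hy hx]

theorem eq_of_val (h : IsDecoration P S i₀ vs A r d) {x : ℕ} {l v : Loc}
    (hv : h.marking.Val P S i₀ (argOf vs) r x l v) : (d l).val x = v :=
  (hv _ (h.isClosed_marking v)).2

/-- The value of an allocated variable propagates upwards from the node that allocates it. The
induction follows the two mutually inductive allocation relations, with parameters of predicates and
variables of rules treated together. -/
theorem val_of_eventuallyAllocated (h : IsDecoration P S i₀ vs A r d) {R : Rule} {x : ℕ}
    (hx : P.EventuallyAllocated R x) :
    ∀ l ∈ A, (d l).rule = R → h.marking.Val P S i₀ (argOf vs) r x l ((d l).val x) := by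
  refine RecSystem.EventuallyAllocated.rec
    (motive_1 := fun i s _ => ∃ x, (P.params i)[s]? = some x ∧ ∀ l ∈ A, (d l).pred = i →
      h.marking.Val P S i₀ (argOf vs) r x l ((d l).val x))
    (motive_2 := fun R x _ => ∀ l ∈ A, (d l).rule = R →
      h.marking.Val P S i₀ (argOf vs) r x l ((d l).val x)) ?_ ?_ ?_ hx
  · rintro i s x hx - ih
    refine ⟨x, hx, ?_⟩
    rintro l hl rfl
    exact ih _ (h.rule_mem l hl) l hl rfl
  · rintro R _ ⟨c, hc, rfl⟩ l hl rfl V hV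
    -- The value of the head's source at `l` is `l` itself, so the closure condition `head` applies
    -- with `v = l`.
    rw [(h.cell l hl c hc).1] at hV
    exact hV.head _ _ (h.rule_mem l hl) c hc ⟨hl, rfl, rfl⟩
  · rintro R x y s o ho hy hyx - ⟨x', hx', ih⟩ l hl rfl V hV
    obtain ⟨k, hk⟩ := List.mem_iff_getElem?.1 ho
    have hk' := (List.getElem?_eq_some_iff.1 hk).1
    have hlab : l ∈ h.marking.label (d l).pred (d l).rule := ⟨hl, rfl, rfl⟩
    rw [← (hV.eqClosure (h.rule_mem l hl) hlab hyx)]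
    rw [← (h.pure l hl).eq_of_eqClosure hyx, ← h.val_child hl hk hy hx'] at hV
    rw [hV.call _ _ (h.rule_mem l hl) k o hk s y x' hy hx' l hlab _
      ((h.isChild_marking_iff hl hk').2 rfl)]
    obtain ⟨e1, e2, -⟩ := h.child l hl k o hk
    exact ih _ e1 e2 V hV

/-- Completeness of the fixed point. Existential variables are covered by establishment; parameters
are handled by descending from the root, where they equal the given arguments, each call passing
derivable values on to the child. -/
theorem val_marking (hP : P.WellFormed) (hE : P.Established) (h : IsDecoration P S i₀ vs A r d)
    {l : Loc} (hl : l ∈ A) :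
    ∀ x ∈ P.scope (d l).pred (d l).rule, h.marking.Val P S i₀ (argOf vs) r x l ((d l).val x) := by
  have hex : ∀ l ∈ A, ∀ x ∈ (d l).rule.exVars, h.marking.Val P S i₀ (argOf vs) r x l ((d l).val x) := by
    intro l hl x hx
    obtain ⟨-, D, hD, -, hR⟩ := RecSystem.exists_of_mem_rules (h.rule_mem l hl)
    exact h.val_of_eventuallyAllocated (hE D hD _ hR x hx) l hl rfl
  induction h.reach l hl with
  | refl =>
    rintro x (hx | hx)
    · intro V hV
      rw [h.root_pred] at hx
      obtain ⟨s, hs⟩ := List.mem_iff_getElem?.1 hx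
      exact hV.root s x hs (h.val_root hs)
    · exact hex r hl x hx
  | @tail b c hb hbc ih =>
    have hbA := h.reach_mem h.root_mem hb
    rintro x (hx | hx)
    · intro V hV
      obtain ⟨k, hk, rfl⟩ := hbc
      have ho := List.getElem?_eq_getElem hk
      set o := (d b).rule.tail[k] with ho'
      obtain ⟨e1, e2, -⟩ := h.child b hbA k o ho
      rw [e2] at hx
      obtain ⟨s, hs⟩ := List.mem_iff_getElem?.1 hx
      obtain ⟨-, hlen, hsc⟩ := (hP.rule (h.rule_mem b hbA)).2.2.1 o (List.getElem_mem hk)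
      have hs' : s < o.args.length := by
        rw [hlen]
        exact (List.getElem?_eq_some_iff.1 hs).1
      have hy := List.getElem?_eq_getElem hs'
      rw [h.val_child hbA ho hy hs] at hV
      rw [← hV.call _ _ (h.rule_mem b hbA) k o ho s _ x hy hs b ⟨hbA, rfl, rfl⟩ _
        ((h.isChild_marking_iff hbA hk).2 rfl)]
      exact ih hbA _ (hsc _ (List.getElem_mem hs')) V hV
    · exact hex c hl x hx

theorem isMarking (hP : P.WellFormed) (hE : P.Established) (h : IsDecoration P S i₀ vs A r d) :
    IsMarking P S i₀ (argOf vs) A r h.marking where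
  root_label := ⟨(d r).rule, h.root_pred ▸ h.rule_mem r h.root_mem, h.root_mem, h.root_pred, rfl⟩
  label_mem l hl := ⟨_, _, h.rule_mem l hl, hl, rfl, rfl⟩
  node := by
    rintro _ _ hR l ⟨hl, rfl, rfl⟩
    have hsc := h.val_marking hP hE hl
    have hwf := hP.rule (h.rule_mem l hl)
    have hlt : ∀ {k o}, (d l).rule.tail[k]? = some o → k < (d l).rule.tail.length :=
      fun h => (List.getElem?_eq_some_iff.1 h).1
    refine ⟨hl, ?_, ?_, ?_, ?_, ?_, ?_, ?_, ?_, ?_⟩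
    · rintro i' R' hR' ⟨-, rfl, rfl⟩
      exact ⟨rfl, rfl⟩
    · intro c hc
      obtain ⟨-, hcell⟩ := h.cell l hl c hc
      refine ⟨?_, fun k hk => ⟨fun y hy => ?_, fun hy v => ?_⟩⟩
      -- A head with more than `N` targets would produce an edge with selector `N + 1`.
      · by_contra hlen
        have h1 : S.heap l (N + 1) ≠ none := by
          rw [hcell N, List.getElem?_map, List.getElem?_eq_getElem (by omega)]
          simp
        have := (S.heap_sel _ _ h1).2
        omega
      · refine ⟨(d l).val y, hsc y ((hwf.2.1 c hc).2.2 y (List.mem_of_getElem? hy)), ?_⟩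
        rw [hcell k, List.getElem?_map, hy]
        rfl
      · rw [hcell k, List.getElem?_map, hy]
        simp
    · intro x hx
      exact ⟨_, hsc x (List.mem_append.1 hx)⟩
    · intro x _ v v' hv hv'
      rw [← h.eq_of_val hv, ← h.eq_of_val hv']
    · rintro e he v ⟨hv, hv'⟩
      exact (h.pure l hl).2 e he ((h.eq_of_val hv).trans (h.eq_of_val hv').symm)
    · intro k o ho
      obtain ⟨e1, e2, -⟩ := h.child l hl k o ho
      exact ⟨(d l).child k, (h.isChild_marking_iff hl (hlt ho)).2 rfl,
        (d ((d l).child k)).rule, e2 ▸ h.rule_mem _ e1, e1, e2, rfl⟩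
    · intro k hk c c' hc hc'
      rw [h.isChild_marking_iff hl hk] at hc hc'
      rw [hc, hc']
    · intro k hk hc
      rw [h.isChild_marking_iff hl hk] at hc
      exact (h.step_mem hl ⟨k, hk, rfl⟩).2 hc.symm
    · rintro k hk _ _ - k' hk' l' ⟨hl', rfl, rfl⟩ c hc hc'
      rw [h.isChild_marking_iff hl hk] at hc
      rw [h.isChild_marking_iff hl' hk'] at hc'
      exact h.parent_unique l hl l' hl' k hk k' hk' (hc.symm.trans hc')
  reach := by
    intro Y hr hY l hl
    induction h.reach l hl with
    | refl => exact hr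
    | @tail b c hb hbc ih =>
      have hbA := h.reach_mem h.root_mem hb
      obtain ⟨k, hk, rfl⟩ := hbc
      exact hY _ _ (h.rule_mem b hbA) k hk b ⟨hbA, rfl, rfl⟩ (ih hbA) _
        ((h.isChild_marking_iff hbA hk).2 rfl)

end IsDecoration

open Classical Relation in
-- Labels, children and values are picked by choice. The uniqueness, totality and functionality
-- conditions of `NodeOk` make every pick forced, so the equations of a decoration reduce to the
-- closure conditions that define `Val`.
theorem IsMarking.exists_isDecoration (hP : P.WellFormed) {m : Marking Loc}
    (h : IsMarking P S i₀ (argOf vs) A r m) (hvs : vs.length = (P.params i₀).length) :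
    ∃ d, IsDecoration P S i₀ vs A r d := by
  have : ∀ l, ∃ i R, l ∈ A → R ∈ P.rules i ∧ l ∈ m.label i R := by
    intro l
    by_cases hl : l ∈ A
    · obtain ⟨i, R, h1⟩ := h.label_mem l hl
      exact ⟨i, R, fun _ => h1⟩
    · exact ⟨0, ⟨[], [], [], [], []⟩, fun h => absurd h hl⟩
  choose pred rule hrule using this
  have : Nonempty Loc := ⟨null⟩
  let d : Loc → NodeData Loc := fun l =>
    { pred := pred l
      rule := rule l
      child := fun k => Classical.epsilon (m.IsChild S k l)
      val := fun x => Classical.epsilon (m.Val P S i₀ (argOf vs) r x l) }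
  have hlab : ∀ {i R l}, R ∈ P.rules i → l ∈ m.label i R →
      l ∈ A ∧ (d l).pred = i ∧ (d l).rule = R := by
    intro i R l hR hl
    have hn := h.node i R hR l hl
    obtain ⟨e1, e2⟩ := hn.label_unique _ _ (hrule l hn.mem).1 (hrule l hn.mem).2
    exact ⟨hn.mem, e1.symm, e2.symm⟩
  have hnode : ∀ l ∈ A, m.NodeOk P S i₀ (argOf vs) A r (d l).pred (d l).rule l :=
    fun l hl => h.node _ _ (hrule l hl).1 l (hrule l hl).2
  have hval : ∀ l ∈ A, ∀ x ∈ P.scope (d l).pred (d l).rule, ∀ v,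
      m.Val P S i₀ (argOf vs) r x l v → v = (d l).val x := by
    intro l hl x hx v hv
    exact (hnode l hl).functional x (List.mem_append.2 hx) _ _ hv (Classical.epsilon_spec ⟨v, hv⟩)
  have hval' : ∀ l ∈ A, ∀ x ∈ P.scope (d l).pred (d l).rule,
      m.Val P S i₀ (argOf vs) r x l ((d l).val x) := by
    intro l hl x hx
    exact Classical.epsilon_spec ((hnode l hl).total x (List.mem_append.2 hx))
  have hchild : ∀ l ∈ A, ∀ k < (d l).rule.tail.length, ∀ c,
      m.IsChild S k l c → c = (d l).child k :=
    fun l hl k hk c hc => (hnode l hl).child_unique k hk _ _ hc (Classical.epsilon_spec ⟨c, hc⟩)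
  have hchild' : ∀ l ∈ A, ∀ k < (d l).rule.tail.length, m.IsChild S k l ((d l).child k) := by
    intro l hl k hk
    obtain ⟨c, hc, -⟩ := (hnode l hl).child k _ (List.getElem?_eq_getElem hk)
    exact Classical.epsilon_spec ⟨c, hc⟩
  obtain ⟨R₀, hR₀, hr₀⟩ := h.root_label
  obtain ⟨hrA, hrp, hrr⟩ := hlab hR₀ hr₀
  refine ⟨d, hrA, hrp, ?_, fun l hl => (hrule l hl).1, ?_, ?_, ?_, ?_, ?_⟩
  · refine List.ext_getElem (by simp [hvs]) fun s hs hs' => ?_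
    rw [List.length_map] at hs
    rw [List.getElem_map]
    refine (hval r hrA _ (.inl (by rw [hrp]; exact List.getElem_mem hs)) _ fun V hV => ?_).symm
    exact hV.root s _ (List.getElem?_eq_getElem hs) (List.getElem?_eq_getElem hs')
  · intro l hl
    have hwf := (hP.rule (hrule l hl).1).2.2.2
    refine ⟨fun e he => (hval l hl _ (hwf.1 e he).2 _ fun V hV => ?_), fun e he e' => ?_⟩
    · rw [← hV.eqs _ _ (hrule l hl).1 e he l (hrule l hl).2]
      exact hval' l hl _ (hwf.1 e he).1 V hV
    · refine (hnode l hl).neqs e he _ ⟨hval' l hl _ (hwf.2 e he).1, ?_⟩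
      rw [e']
      exact hval' l hl _ (hwf.2 e he).2
  · intro l hl c hc
    have hwf := (hP.rule (hrule l hl).1).2.1 c hc
    refine ⟨(hval l hl _ hwf.1 _ fun V hV => ?_).symm, fun k => ?_⟩
    · exact hV.head _ _ (hrule l hl).1 c hc (hrule l hl).2
    · obtain ⟨h1, h2⟩ := (hnode l hl).cell c hc
      rw [List.getElem?_map]
      by_cases hk : k < N
      · cases hy : c.dst[k]? with
        | none => exact Option.eq_none_iff_forall_ne_some.2 ((h2 k hk).2 hy)
        | some y =>
          obtain ⟨v, hv, hv'⟩ := (h2 k hk).1 y hy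
          rw [hv', hval l hl y (hwf.2.2 y (List.mem_of_getElem? hy)) v hv]
          rfl
      · rw [List.getElem?_eq_none (by omega)]
        by_contra hne
        have := (S.heap_sel _ _ hne).2
        omega
  · intro l hl k o ho
    have hk := (List.getElem?_eq_some_iff.1 ho).1
    obtain ⟨c, hc, R', hR', hcl⟩ := (hnode l hl).child k o ho
    obtain rfl := hchild l hl k hk c hc
    obtain ⟨e1, e2, e3⟩ := hlab hR' hcl
    refine ⟨e1, e2, ?_, ?_, ?_⟩
    · obtain ⟨-, hlen, hsc⟩ := (hP.rule (hrule l hl).1).2.2.1 o (List.mem_of_getElem? ho)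
      refine List.ext_getElem (by simp [hlen]) fun s hs hs' => ?_
      rw [List.length_map] at hs hs'
      rw [List.getElem_map, List.getElem_map]
      refine (hval _ e1 _ (.inl (by rw [e2]; exact List.getElem_mem hs)) _ fun V hV => ?_).symm
      rw [← hV.call _ _ (hrule l hl).1 k o ho s _ _ (List.getElem?_eq_getElem hs')
        (List.getElem?_eq_getElem hs) l (hrule l hl).2 _ hc]
      exact hval' l hl _ (hsc _ (List.getElem_mem hs')) V hV
    · intro e
      exact (hnode l hl).child_ne_root k hk (e ▸ hc)
    · obtain ⟨t, ht, -, e⟩ := hc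
      exact ⟨t, ht, e⟩
  · intro l hl l' hl' k hk k' hk' e
    refine (hnode l hl).parent_unique k hk _ _ (hrule l' hl').1 k' hk' l' (hrule l' hl').2 _
      (hchild' l hl k hk) ?_
    rw [e]
    exact hchild' l' hl' k' hk'
  · refine h.reach {l | ReflTransGen (NodeData.Step d) r l} .refl ?_
    intro i R hR k hk l hl hrl c hc
    obtain ⟨e1, e2, rfl⟩ := hlab hR hl
    exact hrl.tail ⟨k, hk, (hchild l e1 k hk c hc).symm⟩

/-- Connectivity and establishment are used to build a marking, progress to read a tree off from it.
-/
theorem RecSystem.pHolds_iff_exists_isMarking (hP : P.WellFormed) (hB : P.IsBtw)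
    (hvs : vs.length = (P.params i₀).length) (hA : A.Finite) :
    P.PHolds S i₀ vs A ↔ ∃ r m, IsMarking P S i₀ (argOf vs) A r m := by
  constructor
  · intro h
    obtain ⟨r, d, hd⟩ := h.exists_isDecoration hB.2.1
    exact ⟨r, hd.marking, hd.isMarking hP hB.2.2⟩
  · rintro ⟨r, m, hm⟩
    obtain ⟨d, hd⟩ := hm.exists_isDecoration hP hvs
    exact hd.pHolds hB.1 hA

end Marking

-- Primitive recursive access to the syntax, automated with `fun_prop`

attribute [fun_prop] Primrec Primrec.const Primrec.comp Primrec.fst Primrec.snd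

section Primitive

variable {α β γ : Type} [Primcodable α] [Primcodable β] [Primcodable γ]

@[fun_prop]
theorem primrec_id : Primrec fun a : α => a := Primrec.id

@[fun_prop]
theorem primrec_prodMk {f : α → β} {g : α → γ} (hf : Primrec f) (hg : Primrec g) :
    Primrec fun a => (f a, g a) := Primrec.pair hf hg

@[fun_prop]
theorem primrec_natPair {f g : α → ℕ} (hf : Primrec f) (hg : Primrec g) :
    Primrec fun a => Nat.pair (f a) (g a) := Primrec₂.natPair.comp hf hg

@[fun_prop]
theorem primrec_add {f g : α → ℕ} (hf : Primrec f) (hg : Primrec g) :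
    Primrec fun a => f a + g a := Primrec.nat_add.comp hf hg

@[fun_prop]
theorem primrec_mul {f g : α → ℕ} (hf : Primrec f) (hg : Primrec g) :
    Primrec fun a => f a * g a := Primrec.nat_mul.comp hf hg

@[fun_prop]
theorem primrec_encode {f : α → β} (hf : Primrec f) :
    Primrec fun a => Encodable.encode (f a) := Primrec.encode.comp hf

@[fun_prop]
theorem primrec_getElem? {f : α → List β} {g : α → ℕ} (hf : Primrec f) (hg : Primrec g) :
    Primrec fun a => (f a)[g a]? := Primrec.list_getElem?.comp hf hg

@[fun_prop]
theorem primrec_append {f g : α → List β} (hf : Primrec f) (hg : Primrec g) :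
    Primrec fun a => f a ++ g a := Primrec.list_append.comp hf hg

@[fun_prop]
theorem primrec_length {f : α → List β} (hf : Primrec f) :
    Primrec fun a => (f a).length := Primrec.list_length.comp hf

@[fun_prop]
theorem primrec_range {f : α → ℕ} (hf : Primrec f) :
    Primrec fun a => List.range (f a) := Primrec.list_range.comp hf

@[fun_prop]
theorem primrec_toList {f : α → Option β} (hf : Primrec f) :
    Primrec fun a => (f a).toList := Primrec.optionToList.comp hf

@[fun_prop]
theorem Pure.primrec_eqs : Primrec (Pure.eqs : Pure α → _) :=
  Primrec.fst.comp (Primrec.of_equiv (e := Pure.equiv α))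

@[fun_prop]
theorem Pure.primrec_neqs : Primrec (Pure.neqs : Pure α → _) :=
  Primrec.snd.comp (Primrec.of_equiv (e := Pure.equiv α))

@[fun_prop]
theorem PointsTo.primrec_src : Primrec (PointsTo.src : PointsTo α → _) :=
  Primrec.fst.comp (Primrec.of_equiv (e := PointsTo.equiv α))

@[fun_prop]
theorem PointsTo.primrec_dst : Primrec (PointsTo.dst : PointsTo α → _) :=
  Primrec.snd.comp (Primrec.of_equiv (e := PointsTo.equiv α))

@[fun_prop]
theorem Call.primrec_pred : Primrec (Call.pred : Call α → _) :=
  Primrec.fst.comp (Primrec.of_equiv (e := Call.equiv α))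

@[fun_prop]
theorem Call.primrec_args : Primrec (Call.args : Call α → _) :=
  Primrec.snd.comp (Primrec.of_equiv (e := Call.equiv α))

@[fun_prop]
theorem Rule.primrec_exVars : Primrec Rule.exVars :=
  Primrec.fst.comp (Primrec.of_equiv (e := Rule.equiv))

@[fun_prop]
theorem Rule.primrec_head : Primrec Rule.head :=
  (Primrec.fst.comp Primrec.snd).comp (Primrec.of_equiv (e := Rule.equiv))

@[fun_prop]
theorem Rule.primrec_tail : Primrec Rule.tail :=
  (Primrec.fst.comp (Primrec.snd.comp Primrec.snd)).comp (Primrec.of_equiv (e := Rule.equiv))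

@[fun_prop]
theorem Rule.primrec_pure : Primrec Rule.pure :=
  (Primrec.snd.comp (Primrec.snd.comp Primrec.snd)).comp (Primrec.of_equiv (e := Rule.equiv))

@[fun_prop]
theorem PredDef.primrec_params : Primrec PredDef.params :=
  Primrec.fst.comp (Primrec.of_equiv (e := PredDef.equiv))

@[fun_prop]
theorem PredDef.primrec_rules : Primrec PredDef.rules :=
  Primrec.snd.comp (Primrec.of_equiv (e := PredDef.equiv))

@[fun_prop]
theorem BasicFormula.primrec_exVars : Primrec BasicFormula.exVars :=
  Primrec.fst.comp (Primrec.of_equiv (e := BasicFormula.equiv))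

@[fun_prop]
theorem BasicFormula.primrec_pure : Primrec BasicFormula.pure :=
  (Primrec.fst.comp Primrec.snd).comp (Primrec.of_equiv (e := BasicFormula.equiv))

@[fun_prop]
theorem BasicFormula.primrec_spatial : Primrec BasicFormula.spatial :=
  (Primrec.snd.comp Primrec.snd).comp (Primrec.of_equiv (e := BasicFormula.equiv))

@[fun_prop]
theorem TopFormula.primrec_exVars : Primrec TopFormula.exVars :=
  Primrec.fst.comp (Primrec.of_equiv (e := TopFormula.equiv))

@[fun_prop]
theorem TopFormula.primrec_basic : Primrec TopFormula.basic :=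
  (Primrec.fst.comp Primrec.snd).comp (Primrec.of_equiv (e := TopFormula.equiv))

@[fun_prop]
theorem TopFormula.primrec_calls : Primrec TopFormula.calls :=
  (Primrec.snd.comp Primrec.snd).comp (Primrec.of_equiv (e := TopFormula.equiv))

namespace RecSystem

@[fun_prop]
theorem primrec_params {f : α → RecSystem} {g : α → ℕ} (hf : Primrec f) (hg : Primrec g) :
    Primrec fun a => (f a).params (g a) :=
  Primrec.option_getD.comp (Primrec.option_map (primrec_getElem? hf hg)
    (PredDef.primrec_params.comp Primrec.snd).to₂) (Primrec.const [])

@[fun_prop]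
theorem primrec_rules {f : α → RecSystem} {g : α → ℕ} (hf : Primrec f) (hg : Primrec g) :
    Primrec fun a => (f a).rules (g a) :=
  Primrec.option_getD.comp (Primrec.option_map (primrec_getElem? hf hg)
    (PredDef.primrec_rules.comp Primrec.snd).to₂) (Primrec.const [])

/-- All rules of a system, together with the index of their predicate. -/
def allRules (P : RecSystem) : List (ℕ × Rule) :=
  (List.range P.length).flatMap fun i => (P.rules i).map fun R => (i, R)

theorem mem_allRules {P : RecSystem} {x : ℕ × Rule} : x ∈ P.allRules ↔ x.2 ∈ P.rules x.1 := by
  obtain ⟨i, R⟩ := x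
  simp only [allRules, List.mem_flatMap, List.mem_range, List.mem_map, Prod.mk.injEq]
  constructor
  · rintro ⟨_, -, _, h, rfl, rfl⟩
    exact h
  · intro h
    exact ⟨i, (exists_of_mem_rules h).1, R, h, rfl, rfl⟩

@[fun_prop]
theorem primrec_allRules : Primrec allRules :=
  Primrec.list_flatMap (by fun_prop : Primrec fun P : RecSystem => List.range P.length)
    (Primrec.list_map (by fun_prop : Primrec fun x : RecSystem × ℕ => x.1.rules x.2)
      (by fun_prop : Primrec fun y : (RecSystem × ℕ) × Rule => (y.1.2, y.2)).to₂).to₂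

end RecSystem

end Primitive

/-! ### Variables of MSO formulae -/

namespace MSO

section Variables

variable {Loc : Type*} {null : Loc} {N : ℕ} {S : State Loc null N}

/-- `Nat.pair` dominates both of its components, so the code of a formula bounds every variable
index in it. This bound is crude but available wherever the code is computed. -/
theorem sat_congr {φ : MSO} {ι ι' : ℕ → Loc} {ν ν' : ℕ → Set Loc}
    (hι : ∀ n ≤ φ.code, ι n = ι' n) (hν : ∀ n ≤ φ.code, ν n = ν' n) :
    Sat S φ ι ν ↔ Sat S φ ι' ν' := by
  have l := Nat.left_le_pair
  have r := Nat.right_le_pair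
  induction φ generalizing ι ι' ν ν' with
  | eq x y =>
    simp only [Sat]
    rw [hι x ((l _ _).trans (r _ _)), hι y ((r _ _).trans (r _ _))]
  | var u x =>
    simp only [Sat]
    rw [hι x ((r _ _).trans (r _ _))]
  | edge k x y =>
    simp only [Sat]
    rw [hι x ((l _ _).trans ((r _ _).trans (r _ _))), hι y ((r _ _).trans ((r _ _).trans (r _ _)))]
  | null x =>
    simp only [Sat]
    rw [hι x (r _ _)]
  | mem X x =>
    simp only [Sat]
    rw [hι x ((r _ _).trans (r _ _)), hν X ((l _ _).trans (r _ _))]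
  | and φ ψ ih₁ ih₂ =>
    have h₁ : φ.code ≤ (and φ ψ).code := (l _ _).trans (r _ _)
    have h₂ : ψ.code ≤ (and φ ψ).code := (r _ _).trans (r _ _)
    exact and_congr (ih₁ (fun n hn => hι n (hn.trans h₁)) fun n hn => hν n (hn.trans h₁))
      (ih₂ (fun n hn => hι n (hn.trans h₂)) fun n hn => hν n (hn.trans h₂))
  | not φ ih =>
    have h : φ.code ≤ (not φ).code := r _ _
    exact not_congr (ih (fun n hn => hι n (hn.trans h)) fun n hn => hν n (hn.trans h))
  | exFO x φ ih =>
    have h : φ.code ≤ (exFO x φ).code := (r _ _).trans (r _ _)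
    refine exists_congr fun a => ih (fun n hn => ?_) fun n hn => hν n (hn.trans h)
    by_cases hx : n = x
    · subst hx; simp
    · simp [hx, hι n (hn.trans h)]
  | exSO X φ ih =>
    have h : φ.code ≤ (exSO X φ).code := (r _ _).trans (r _ _)
    refine exists_congr fun a => ih (fun n hn => hι n (hn.trans h)) fun n hn => ?_
    by_cases hx : n = X
    · subst hx; simp
    · simp [hx, hν n (hn.trans h)]

theorem freeFO_le_code (φ : MSO) : ∀ n ∈ φ.freeFO, n ≤ φ.code := by
  have l := Nat.left_le_pair
  have r := Nat.right_le_pair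
  induction φ with
  | eq x y =>
    rintro n (rfl | rfl)
    · exact (l _ _).trans (r _ _)
    · exact (r _ _).trans (r _ _)
  | var u x =>
    rintro n rfl
    exact (r _ _).trans (r _ _)
  | edge k x y =>
    rintro n (rfl | rfl)
    · exact (l _ _).trans ((r _ _).trans (r _ _))
    · exact (r _ _).trans ((r _ _).trans (r _ _))
  | null x =>
    rintro n rfl
    exact r _ _
  | mem X x =>
    rintro n rfl
    exact (r _ _).trans (r _ _)
  | and φ ψ ih₁ ih₂ =>
    rintro n (h | h)
    · exact (ih₁ n h).trans ((l _ _).trans (r _ _))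
    · exact (ih₂ n h).trans ((r _ _).trans (r _ _))
  | not φ ih => exact fun n h => (ih n h).trans (r _ _)
  | exFO x φ ih => exact fun n h => (ih n h.1).trans ((r _ _).trans (r _ _))
  | exSO X φ ih => exact fun n h => (ih n h).trans ((r _ _).trans (r _ _))

theorem freeSO_le_code (φ : MSO) : ∀ n ∈ φ.freeSO, n ≤ φ.code := by
  have l := Nat.left_le_pair
  have r := Nat.right_le_pair
  induction φ with
  | eq x y => simp [freeSO]
  | var u x => simp [freeSO]
  | edge k x y => simp [freeSO]
  | null x => simp [freeSO]
  | mem X x =>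
    rintro n rfl
    exact (l _ _).trans (r _ _)
  | and φ ψ ih₁ ih₂ =>
    rintro n (h | h)
    · exact (ih₁ n h).trans ((l _ _).trans (r _ _))
    · exact (ih₂ n h).trans ((r _ _).trans (r _ _))
  | not φ ih => exact fun n h => (ih n h).trans (r _ _)
  | exFO x φ ih => exact fun n h => (ih n h).trans ((r _ _).trans (r _ _))
  | exSO X φ ih => exact fun n h => (ih n h.1).trans ((r _ _).trans (r _ _))

/-- `∃ x₁ … ∃ xₙ. φ` for first-order variables -/
def exFOs (l : List ℕ) (φ : MSO) : MSO := l.foldr exFO φ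

/-- `∃ X₁ … ∃ Xₙ. φ` for second-order variables -/
def exSOs (l : List ℕ) (φ : MSO) : MSO := l.foldr exSO φ

theorem sat_exFOs {l : List ℕ} {φ : MSO} {ι : ℕ → Loc} {ν : ℕ → Set Loc} :
    Sat S (exFOs l φ) ι ν ↔ ∃ ι', (∀ n ∉ l, ι' n = ι n) ∧ Sat S φ ι' ν := by
  induction l generalizing ι with
  | nil =>
    refine ⟨fun h => ⟨ι, by simp, h⟩, ?_⟩
    rintro ⟨ι', h, h'⟩
    obtain rfl : ι' = ι := funext fun n => h n (by simp)
    exact h'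
  | cons x l ih =>
    change (∃ a, Sat S (exFOs l φ) _ _) ↔ _
    constructor
    · rintro ⟨a, ha⟩
      obtain ⟨ι', h, h'⟩ := ih.1 ha
      refine ⟨ι', fun n hn => ?_, h'⟩
      rw [List.mem_cons, not_or] at hn
      rw [h n hn.2, Function.update_of_ne hn.1]
    · rintro ⟨ι', h, h'⟩
      refine ⟨ι' x, ih.2 ⟨ι', fun n hn => ?_, h'⟩⟩
      by_cases hx : n = x
      · subst hx; simp
      · simp [hx, h n (by simp [hx, hn])]

theorem sat_exSOs {l : List ℕ} {φ : MSO} {ι : ℕ → Loc} {ν : ℕ → Set Loc} :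
    Sat S (exSOs l φ) ι ν ↔ ∃ ν', (∀ n ∉ l, ν' n = ν n) ∧ Sat S φ ι ν' := by
  induction l generalizing ν with
  | nil =>
    refine ⟨fun h => ⟨ν, by simp, h⟩, ?_⟩
    rintro ⟨ν', h, h'⟩
    obtain rfl : ν' = ν := funext fun n => h n (by simp)
    exact h'
  | cons x l ih =>
    change (∃ a, Sat S (exSOs l φ) _ _) ↔ _
    constructor
    · rintro ⟨a, ha⟩
      obtain ⟨ν', h, h'⟩ := ih.1 ha
      refine ⟨ν', fun n hn => ?_, h'⟩
      rw [List.mem_cons, not_or] at hn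
      rw [h n hn.2, Function.update_of_ne hn.1]
    · rintro ⟨ν', h, h'⟩
      refine ⟨ν' x, ih.2 ⟨ν', fun n hn => ?_, h'⟩⟩
      by_cases hx : n = x
      · subst hx; simp
      · simp [hx, h n (by simp [hx, hn])]

theorem freeFO_exFOs (l : List ℕ) (φ : MSO) : (exFOs l φ).freeFO = φ.freeFO \ {n | n ∈ l} := by
  induction l with
  | nil => simp [exFOs]
  | cons x l ih =>
    change (exFOs l φ).freeFO \ {x} = _
    rw [ih]
    ext n
    simp
    tauto

theorem freeSO_exFOs (l : List ℕ) (φ : MSO) : (exFOs l φ).freeSO = φ.freeSO := by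
  induction l with
  | nil => rfl
  | cons x l ih => exact ih

theorem freeSO_exSOs (l : List ℕ) (φ : MSO) : (exSOs l φ).freeSO = φ.freeSO \ {n | n ∈ l} := by
  induction l with
  | nil => simp [exSOs]
  | cons x l ih =>
    change (exSOs l φ).freeSO \ {x} = _
    rw [ih]
    ext n
    simp
    tauto

end Variables

section Codes

variable {α : Type} [Primcodable α]

theorem primrec_code_and {f g : α → MSO} (hf : Primrec fun a => (f a).code)
    (hg : Primrec fun a => (g a).code) : Primrec fun a => (and (f a) (g a)).code :=
  (by fun_prop : Primrec fun a => Nat.pair 5 (Nat.pair (f a).code (g a).code))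

theorem primrec_code_exFO {n : α → ℕ} {f : α → MSO} (hn : Primrec n)
    (hf : Primrec fun a => (f a).code) : Primrec fun a => (exFO (n a) (f a)).code :=
  (by fun_prop : Primrec fun a => Nat.pair 7 (Nat.pair (n a) (f a).code))

theorem primrec_code_exSO {n : α → ℕ} {f : α → MSO} (hn : Primrec n)
    (hf : Primrec fun a => (f a).code) : Primrec fun a => (exSO (n a) (f a)).code :=
  (by fun_prop : Primrec fun a => Nat.pair 8 (Nat.pair (n a) (f a).code))

theorem primrec_code_exFOs {l : α → List ℕ} {f : α → MSO} (hl : Primrec l)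
    (hf : Primrec fun a => (f a).code) : Primrec fun a => (exFOs (l a) (f a)).code := by
  refine (Primrec.list_foldr hl hf
    (by fun_prop : Primrec fun x : α × (ℕ × ℕ) => Nat.pair 7 (Nat.pair x.2.1 x.2.2)).to₂).of_eq
      fun a => ?_
  induction l a with
  | nil => rfl
  | cons n l ih => exact congrArg (fun c => Nat.pair 7 (Nat.pair n c)) ih

theorem primrec_code_exSOs {l : α → List ℕ} {f : α → MSO} (hl : Primrec l)
    (hf : Primrec fun a => (f a).code) : Primrec fun a => (exSOs (l a) (f a)).code := by
  refine (Primrec.list_foldr hl hf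
    (by fun_prop : Primrec fun x : α × (ℕ × ℕ) => Nat.pair 8 (Nat.pair x.2.1 x.2.2)).to₂).of_eq
      fun a => ?_
  induction l a with
  | nil => rfl
  | cons n l ih => exact congrArg (fun c => Nat.pair 8 (Nat.pair n c)) ih

end Codes

end MSO

/-! ### Definable properties -/

/-- A property of states and interpretations of first-order and second-order variables, depending
on a parameter in `α`. -/
abbrev Query (N : ℕ) (α : Type) :=
  α → ∀ (Loc : Type u) (null : Loc), State Loc null N → (ℕ → Loc) → (ℕ → Set Loc) → Prop

/-- The property is expressed by MSO formulae which are computed from the parameter. -/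
def Definable {N : ℕ} {α : Type} [Primcodable α] (Q : Query.{u} N α) : Prop :=
  ∃ f : α → MSO, Primrec (fun a => (f a).code) ∧
    ∀ a Loc null (S : State Loc null N) ι ν, MSO.Sat S (f a) ι ν ↔ Q a Loc null S ι ν

namespace Definable

variable {N : ℕ} {α β : Type} [Primcodable α] [Primcodable β] {Q Q' : Query.{u} N α}

theorem congr (h : Definable Q)
    (h' : ∀ a Loc null S ι ν, Q a Loc null S ι ν ↔ Q' a Loc null S ι ν) : Definable Q' := by
  obtain ⟨f, hf, hfQ⟩ := h
  exact ⟨f, hf, fun a Loc null S ι ν => (hfQ a Loc null S ι ν).trans (h' ..)⟩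

theorem comp {g : β → α} (h : Definable Q) (hg : Primrec g) : Definable fun b => Q (g b) := by
  obtain ⟨f, hf, hfQ⟩ := h
  exact ⟨fun b => f (g b), hf.comp hg, fun b => hfQ (g b)⟩

theorem eq {x y : α → ℕ} (hx : Primrec x) (hy : Primrec y) :
    Definable (N := N) fun a _ _ _ ι _ => ι (x a) = ι (y a) :=
  ⟨fun a => .eq (x a) (y a),
    (by fun_prop : Primrec fun a => Nat.pair 0 (Nat.pair (x a) (y a))), fun _ _ _ _ _ _ => Iff.rfl⟩

theorem var {u x : α → ℕ} (hu : Primrec u) (hx : Primrec x) :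
    Definable (N := N) fun a _ _ S ι _ => S.store (u a) = some (ι (x a)) :=
  ⟨fun a => .var (u a) (x a),
    (by fun_prop : Primrec fun a => Nat.pair 1 (Nat.pair (u a) (x a))), fun _ _ _ _ _ _ => Iff.rfl⟩

theorem edge {k x y : α → ℕ} (hk : Primrec k) (hx : Primrec x) (hy : Primrec y) :
    Definable (N := N) fun a _ _ S ι _ => S.heap (ι (x a)) (k a) = some (ι (y a)) :=
  ⟨fun a => .edge (k a) (x a) (y a),
    (by fun_prop : Primrec fun a => Nat.pair 2 (Nat.pair (k a) (Nat.pair (x a) (y a)))),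
    fun _ _ _ _ _ _ => Iff.rfl⟩

theorem mem {X x : α → ℕ} (hX : Primrec X) (hx : Primrec x) :
    Definable (N := N) fun a _ _ _ ι ν => ι (x a) ∈ ν (X a) :=
  ⟨fun a => .mem (X a) (x a),
    (by fun_prop : Primrec fun a => Nat.pair 4 (Nat.pair (X a) (x a))), fun _ _ _ _ _ _ => Iff.rfl⟩

theorem and (h : Definable Q) (h' : Definable Q') :
    Definable fun a L n S ι ν => Q a L n S ι ν ∧ Q' a L n S ι ν := by
  obtain ⟨f, hf, hfQ⟩ := h
  obtain ⟨g, hg, hgQ⟩ := h'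
  exact ⟨_, MSO.primrec_code_and hf hg,
    fun a L n S ι ν => and_congr (hfQ a L n S ι ν) (hgQ a L n S ι ν)⟩

theorem not (h : Definable Q) : Definable fun a L n S ι ν => ¬ Q a L n S ι ν := by
  obtain ⟨f, hf, hfQ⟩ := h
  exact ⟨fun a => .not (f a), (by fun_prop : Primrec fun a => Nat.pair 6 (f a).code),
    fun a L n S ι ν => not_congr (hfQ a L n S ι ν)⟩

theorem imp (h : Definable Q) (h' : Definable Q') :
    Definable fun a L n S ι ν => Q a L n S ι ν → Q' a L n S ι ν :=
  (h.and h'.not).not.congr fun a L n S ι ν => by tauto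

theorem or (h : Definable Q) (h' : Definable Q') :
    Definable fun a L n S ι ν => Q a L n S ι ν ∨ Q' a L n S ι ν :=
  (h.not.and h'.not).not.congr fun a L n S ι ν => by tauto

theorem iff (h : Definable Q) (h' : Definable Q') :
    Definable fun a L n S ι ν => (Q a L n S ι ν ↔ Q' a L n S ι ν) :=
  ((h.imp h').and (h'.imp h)).congr fun a L n S ι ν => by tauto

theorem ex {x : α → ℕ} (hx : Primrec x) (h : Definable Q) :
    Definable fun a L n S ι ν => ∃ l, Q a L n S (Function.update ι (x a) l) ν := by
  obtain ⟨f, hf, hfQ⟩ := h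
  exact ⟨_, MSO.primrec_code_exFO hx hf,
    fun a L n S ι ν => exists_congr fun l => hfQ a L n S _ ν⟩

theorem all {x : α → ℕ} (hx : Primrec x) (h : Definable Q) :
    Definable fun a L n S ι ν => ∀ l, Q a L n S (Function.update ι (x a) l) ν :=
  (h.not.ex hx).not.congr fun a L n S ι ν => by simp

theorem exSO {X : α → ℕ} (hX : Primrec X) (h : Definable Q) :
    Definable fun a L n S ι ν => ∃ A, Q a L n S ι (Function.update ν (X a) A) := by
  obtain ⟨f, hf, hfQ⟩ := h
  exact ⟨_, MSO.primrec_code_exSO hX hf,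
    fun a L n S ι ν => exists_congr fun l => hfQ a L n S ι _⟩

theorem allSO {X : α → ℕ} (hX : Primrec X) (h : Definable Q) :
    Definable fun a L n S ι ν => ∀ A, Q a L n S ι (Function.update ν (X a) A) :=
  (h.not.exSO hX).not.congr fun a L n S ι ν => by simp

theorem exList {l : α → List ℕ} (hl : Primrec l) (h : Definable Q) :
    Definable fun a L n S ι ν => ∃ ι', (∀ k ∉ l a, ι' k = ι k) ∧ Q a L n S ι' ν := by
  obtain ⟨f, hf, hfQ⟩ := h
  refine ⟨_, MSO.primrec_code_exFOs hl hf, fun a L n S ι ν => MSO.sat_exFOs.trans ?_⟩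
  exact exists_congr fun ι' => and_congr_right fun _ => hfQ a L n S ι' ν

/-- The quantification over infinitely many second-order variables is possible because a formula
has only finitely many variables. -/
theorem exFamily {p : ℕ → Prop} (hp : PrimrecPred p) (h : Definable Q) :
    Definable fun a L n S ι ν => ∃ ν', (∀ k, ¬ p k → ν' k = ν k) ∧ Q a L n S ι ν' := by
  classical
  obtain ⟨f, hf, hfQ⟩ := h
  refine ⟨_, MSO.primrec_code_exSOs ((Primrec.listFilter hp).comp
    (by fun_prop : Primrec fun a => List.range ((f a).code + 1))) hf,
      fun a L n S ι ν => MSO.sat_exSOs.trans ⟨?_, ?_⟩⟩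
  · rintro ⟨ν', h, h'⟩
    exact ⟨ν', fun k hk => h k (by simp [hk]), (hfQ ..).1 h'⟩
  · rintro ⟨ν', h, h'⟩
    -- Indices above the code are not bound by the formula and keep their old sets; by
    -- `MSO.sat_congr` the formula cannot see the difference.
    refine ⟨fun k => if k ≤ (f a).code then ν' k else ν k, fun k hk => ?_, ?_⟩
    · by_cases hk' : k ≤ (f a).code
      · simp only [hk', if_true]
        refine h k fun hpk => hk ?_
        simpa [hpk] using Nat.lt_succ_of_le hk'
      · simp only [hk', if_false]
    · refine (MSO.sat_congr (fun _ _ => rfl) fun k hk => ?_).1 ((hfQ ..).2 h')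
      simp [hk]

theorem allFamily {p : ℕ → Prop} (hp : PrimrecPred p) (h : Definable Q) :
    Definable fun a L n S ι ν => ∀ ν', (∀ k, ¬ p k → ν' k = ν k) → Q a L n S ι ν' :=
  (h.not.exFamily hp).not.congr fun a L n S ι ν => by simp

/-- Here `b` ranges over syntactic data computed from the parameter, so the quantifier unrolls into
a finite conjunction and costs no MSO variable. -/
theorem forall_mem {l : α → List β} {Q : Query.{u} N (α × β)} (hl : Primrec l) (h : Definable Q) :
    Definable fun a L n S ι ν => ∀ b ∈ l a, Q (a, b) L n S ι ν := by
  obtain ⟨f, hf, hfQ⟩ := h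
  refine ⟨fun a => (l a).foldr (fun b φ => .and (f (a, b)) φ) (.eq 0 0), ?_, ?_⟩
  · refine (Primrec.list_foldr hl (Primrec.const (MSO.code (.eq 0 0)))
      (h := fun a x => Nat.pair 5 (Nat.pair (f (a, x.1)).code x.2)) ?_).of_eq fun a => ?_
    · have : Primrec fun x : α × (β × ℕ) => (f (x.1, x.2.1)).code :=
        hf.comp (by fun_prop : Primrec fun x : α × (β × ℕ) => (x.1, x.2.1))
      exact (by fun_prop : Primrec fun x : α × (β × ℕ) =>
        Nat.pair 5 (Nat.pair (f (x.1, x.2.1)).code x.2.2))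
    · dsimp only
      induction l a with
      | nil => rfl
      | cons b l ih => exact congrArg (fun c => Nat.pair 5 (Nat.pair (f (a, b)).code c)) ih
  · intro a L n S ι ν
    dsimp only
    induction l a with
    | nil => simp [MSO.Sat]
    | cons b l ih =>
      rw [List.forall_mem_cons, ← ih, ← hfQ]
      rfl

theorem exists_mem {l : α → List β} {Q : Query.{u} N (α × β)} (hl : Primrec l) (h : Definable Q) :
    Definable fun a L n S ι ν => ∃ b ∈ l a, Q (a, b) L n S ι ν :=
  (h.not.forall_mem hl).not.congr fun a L n S ι ν => by simp

theorem forall_lt {m : α → ℕ} {Q : Query.{u} N (α × ℕ)} (hm : Primrec m) (h : Definable Q) :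
    Definable fun a L n S ι ν => ∀ k < m a, Q (a, k) L n S ι ν :=
  (h.forall_mem (by fun_prop : Primrec fun a => List.range (m a))).congr
    fun a L n S ι ν => by simp

theorem exists_lt {m : α → ℕ} {Q : Query.{u} N (α × ℕ)} (hm : Primrec m) (h : Definable Q) :
    Definable fun a L n S ι ν => ∃ k < m a, Q (a, k) L n S ι ν :=
  (h.exists_mem (by fun_prop : Primrec fun a => List.range (m a))).congr
    fun a L n S ι ν => by simp

theorem forall_some {o : α → Option β} {Q : Query.{u} N (α × β)} (ho : Primrec o)
    (h : Definable Q) : Definable fun a L n S ι ν => ∀ b, o a = some b → Q (a, b) L n S ι ν :=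
  (h.forall_mem (by fun_prop : Primrec fun a => (o a).toList)).congr
    fun a L n S ι ν => by simp

theorem exists_some {o : α → Option β} {Q : Query.{u} N (α × β)} (ho : Primrec o)
    (h : Definable Q) : Definable fun a L n S ι ν => ∃ b, o a = some b ∧ Q (a, b) L n S ι ν :=
  (h.exists_mem (by fun_prop : Primrec fun a => (o a).toList)).congr
    fun a L n S ι ν => by simp

theorem forall_getElem? {l : α → List β} {Q : Query.{u} N (α × ℕ × β)} (hl : Primrec l)
    (h : Definable Q) :
    Definable fun a L n S ι ν => ∀ k b, (l a)[k]? = some b → Q (a, k, b) L n S ι ν := by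
  have := ((h.comp (by fun_prop : Primrec fun x : (α × ℕ) × β => (x.1.1, x.1.2, x.2))).forall_some
    (by fun_prop : Primrec fun x : α × ℕ => (l x.1)[x.2]?)).forall_lt
    (by fun_prop : Primrec fun a => (l a).length)
  refine this.congr fun a L n S ι ν => forall_congr' fun k => ?_
  exact ⟨fun h b hb => h (List.getElem?_eq_some_iff.1 hb).1 b hb, fun h _ => h⟩

theorem ofPred {p : α → Prop} (hp : PrimrecPred p) :
    Definable (N := N) fun a _ _ _ _ _ => p a := by
  obtain ⟨_, hp⟩ := hp
  refine ⟨fun a => if p a then .eq 0 0 else .not (.eq 0 0), ?_, ?_⟩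
  · refine (Primrec.ite hp.primrecPred (Primrec.const (MSO.code (.eq 0 0)))
      (Primrec.const (MSO.code (.not (.eq 0 0))))).of_eq fun a => ?_
    dsimp only
    split_ifs <;> rfl
  · intro a L n S ι ν
    dsimp only
    split_ifs with h <;> simp [h, MSO.Sat]

theorem ofEq {f g : α → β} (hf : Primrec f) (hg : Primrec g) :
    Definable (N := N) fun a _ _ _ _ _ => f a = g a :=
  ofPred (Primrec.eq.comp hf hg)

theorem ofLE {f g : α → ℕ} (hf : Primrec f) (hg : Primrec g) :
    Definable (N := N) fun a _ _ _ _ _ => f a ≤ g a :=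
  ofPred (Primrec.nat_le.comp hf hg)

theorem sumCases {s : α → ℕ ⊕ ℕ} {Q Q' : Query.{u} N (α × ℕ)} (hs : Primrec s) (h : Definable Q)
    (h' : Definable Q') : Definable fun a L n S ι ν =>
      Sum.elim (fun b => Q (a, b) L n S ι ν) (fun b => Q' (a, b) L n S ι ν) (s a) := by
  obtain ⟨f, hf, hfQ⟩ := h
  obtain ⟨g, hg, hgQ⟩ := h'
  refine ⟨fun a => Sum.elim (fun b => f (a, b)) (fun b => g (a, b)) (s a), ?_, ?_⟩
  · refine (Primrec.sumCasesOn hs hf.to₂ hg.to₂).of_eq fun a => ?_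
    dsimp only
    cases s a <;> rfl
  · intro a L n S ι ν
    dsimp only
    cases s a
    · exact hfQ ..
    · exact hgQ ..

/-- The free variables other than the set variable `0` can be quantified existentially. -/
theorem exists_closed
    {Q : α → ∀ (Loc : Type u) (null : Loc), State Loc null N → (ℕ → Loc) → Set Loc → Prop}
    (h : Definable fun a L n S ι ν => Q a L n S ι (ν 0)) :
    ∃ f : α → MSO, Primrec (fun a => (f a).code) ∧ ∀ a, (f a).freeFO = ∅ ∧ (f a).freeSO ⊆ {0} ∧
      ∀ Loc null (S : State Loc null N) ι ν,
        MSO.Sat S (f a) ι ν ↔ ∃ ι', Q a Loc null S ι' (ν 0) := by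
  obtain ⟨f, hf, hfQ⟩ := h
  have hp : PrimrecPred fun k : ℕ => k ≠ 0 :=
    (Primrec.eq.comp Primrec.id (Primrec.const 0)).not
  -- All set variables that can occur, other than `0`, become bound. This does not change the
  -- meaning, since `Q` depends on `ν` only through `ν 0`.
  let g : α → MSO := fun a => .exSOs ((List.range ((f a).code + 1)).filter fun k => k ≠ 0) (f a)
  have hg : Primrec fun a => (g a).code := MSO.primrec_code_exSOs ((Primrec.listFilter hp).comp
    (by fun_prop : Primrec fun a => List.range ((f a).code + 1))) hf
  have hgQ : ∀ a L n (S : State L n N) ι ν, MSO.Sat S (g a) ι ν ↔ Q a L n S ι (ν 0) := by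
    intro a L n S ι ν
    simp only [g, MSO.sat_exSOs, hfQ]
    constructor
    · rintro ⟨ν', h1, h2⟩
      rwa [h1 0 (by simp)] at h2
    · exact fun h => ⟨ν, fun _ _ => rfl, h⟩
  refine ⟨fun a => .exFOs (List.range ((g a).code + 1)) (g a), MSO.primrec_code_exFOs
    (by fun_prop) hg, fun a => ⟨?_, ?_, fun L n S ι ν => ?_⟩⟩
  · rw [MSO.freeFO_exFOs, Set.sdiff_eq_empty]
    intro k hk
    simpa using Nat.lt_succ_of_le (MSO.freeFO_le_code _ _ hk)
  · rw [MSO.freeSO_exFOs, MSO.freeSO_exSOs]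
    rintro k ⟨hk, hk'⟩
    by_contra h0
    refine hk' ?_
    simpa [show k ≠ 0 from h0] using Nat.lt_succ_of_le (MSO.freeSO_le_code _ _ hk)
  · rw [MSO.sat_exFOs]
    constructor
    · rintro ⟨ι', -, h⟩
      exact ⟨ι', (hgQ ..).1 h⟩
    · rintro ⟨ι', h⟩
      refine ⟨fun k => if k ≤ (g a).code then ι' k else ι k, fun k hk => ?_, ?_⟩
      · exact if_neg fun h => hk (by simpa using Nat.lt_succ_of_le h)
      · refine (MSO.sat_congr (fun k hk => ?_) fun _ _ => rfl).1 ((hgQ ..).2 h)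
        simp [hk]

end Definable

-- Layout of MSO variables for markings and logical variables

section DefinableMarking

variable {Loc : Type u} {null : Loc} {N : ℕ}

/-- The marking stored in the set variables with indices `3n + 3` and `3n + 4`. -/
def markingOf (ν : ℕ → Set Loc) : Marking Loc where
  label i R := ν (3 * Encodable.encode (i, R) + 3)
  sel k t := ν (3 * Nat.pair k t + 4)

/-- The value of a variable, where the logical variable `x` is the first-order variable `x + 10`. -/
def valueOf (S : State Loc null N) (ι : ℕ → Loc) : Var ℕ → Option Loc :=
  evalVar S.store fun x => some (ι (x + 10))

/-- The value of the `s`-th argument is `v`. -/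
def argValue (S : State Loc null N) (ι : ℕ → Loc) (args : List (Var ℕ)) (s : ℕ) (v : Loc) : Prop :=
  ∃ y, args[s]? = some y ∧ valueOf S ι y = some v

@[simp] theorem valueOf_update (S : State Loc null N) (ι : ℕ → Loc) {n : ℕ} (h : n < 10) (l : Loc) :
    valueOf S (Function.update ι n l) = valueOf S ι := by
  unfold valueOf
  congr 1
  funext x
  rw [Function.update_of_ne (by omega)]

@[simp] theorem argValue_update (S : State Loc null N) (ι : ℕ → Loc) {n : ℕ} (h : n < 10) (l : Loc)
    (args : List (Var ℕ)) : argValue S (Function.update ι n l) args = argValue S ι args := by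
  unfold argValue
  rw [valueOf_update S ι h]

/-- The indices `0`, `1`, `2` are left for auxiliary sets, and the residue `2` from `5` on for the
families `V` of `Marking.Val`; changing those does not disturb the marking. -/
theorem markingOf_congr {ν ν' : ℕ → Set Loc} (h : ∀ k, 3 ≤ k → k % 3 ≠ 2 → ν k = ν' k) :
    markingOf ν = markingOf ν' := by
  unfold markingOf
  congr 1
  · funext i R
    exact h _ (by omega) (by omega)
  · funext k t
    exact h _ (by omega) (by omega)

@[simp] theorem markingOf_update (ν : ℕ → Set Loc) {n : ℕ} (h : n < 3) (A : Set Loc) :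
    markingOf (Function.update ν n A) = markingOf ν :=
  markingOf_congr fun k hk _ => Function.update_of_ne (by omega) _ _

/-- Quantifying over the set variables from `3` on amounts to quantifying over all markings. -/
theorem exists_markingOf (m : Marking Loc) (ν : ℕ → Set Loc) :
    ∃ ν', (∀ k, ¬ 3 ≤ k → ν' k = ν k) ∧ markingOf ν' = m := by
  refine ⟨fun k => if 3 ≤ k then
    if k % 3 = 0 then
      ((Encodable.decode ((k - 3) / 3) : Option (ℕ × Rule)).map fun x => m.label x.1 x.2).getD ∅
    else m.sel (Nat.unpair ((k - 4) / 3)).1 (Nat.unpair ((k - 4) / 3)).2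
    else ν k, fun k hk => if_neg hk, ?_⟩
  obtain ⟨label, sel⟩ := m
  unfold markingOf
  congr 1
  · funext i R
    simp only
    rw [if_pos (by omega), if_pos (by omega)]
    simp
  · funext k t
    simp only
    rw [if_pos (by omega), if_neg (by omega)]
    simp

end DefinableMarking

-- Definability of markings

namespace Definable

variable {N : ℕ} {α : Type} [Primcodable α]

theorem valueOf {y : α → Var ℕ} {v : α → ℕ} (hy : Primrec y) (hv : Primrec v) :
    Definable.{u} (N := N) fun a _ _ S ι _ => valueOf S ι (y a) = some (ι (v a)) := by
  refine (sumCases hy (var (u := fun p : α × ℕ => p.2) (x := fun p => v p.1) (by fun_prop)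
    (by fun_prop)) (eq (x := fun p : α × ℕ => p.2 + 10) (y := fun p => v p.1) (by fun_prop)
    (by fun_prop))).congr fun a L n S ι ν => ?_
  cases y a <;> simp [SepLog.valueOf, evalVar]

theorem argValue {args : α → List (Var ℕ)} {s v : α → ℕ} (hargs : Primrec args) (hs : Primrec s)
    (hv : Primrec v) :
    Definable.{u} (N := N) fun a _ _ S ι _ => argValue S ι (args a) (s a) (ι (v a)) :=
  exists_some (by fun_prop : Primrec fun a => (args a)[s a]?)
    (valueOf (y := fun p : α × Var ℕ => p.2) (v := fun p => v p.1) (by fun_prop) (by fun_prop))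

theorem label {i : α → ℕ} {R : α → Rule} {x : α → ℕ} (hi : Primrec i) (hR : Primrec R)
    (hx : Primrec x) :
    Definable.{u} (N := N) fun a _ _ _ ι ν => ι (x a) ∈ (markingOf ν).label (i a) (R a) :=
  mem (X := fun a => 3 * Encodable.encode (i a, R a) + 3) (by fun_prop) hx

theorem isChild {k x y : α → ℕ} (hk : Primrec k) (hx : Primrec x) (hy : Primrec y) :
    Definable.{u} (N := N) fun a _ _ S ι ν =>
      (markingOf ν).IsChild S (k a) (ι (x a)) (ι (y a)) :=
  ((mem (X := fun p : α × ℕ => 3 * Nat.pair (k p.1) p.2 + 4) (x := fun p => x p.1) (by fun_prop)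
    (by fun_prop)).and (edge (k := fun p : α × ℕ => p.2 + 1) (x := fun p => x p.1)
      (y := fun p => y p.1) (by fun_prop) (by fun_prop) (by fun_prop))).exists_lt
        (Primrec.const N)

/-- Variable `0` is the root, `3` a node, `4` its child, and `V x` is the set variable `3 * x + 5`.
The variable `v` never occurs below a quantifier over `3` or `4`, so any index may be used for it.
-/
theorem isClosed (v : ℕ) :
    Definable.{u} (N := N) fun (a : RecSystem × Call (Var ℕ)) _ _ S ι ν =>
      (markingOf ν).IsClosed a.1 S a.2.pred (SepLog.argValue S ι a.2.args) (ι 0)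
        (fun x => ν (3 * x + 5)) (ι v) := by
  have root := forall_getElem?
    (by fun_prop : Primrec fun a : RecSystem × Call (Var ℕ) => a.1.params a.2.pred)
    ((argValue.{u} (N := N) (args := fun p => p.1.2.args) (s := fun p => p.2.1) (v := fun _ => v)
      (by fun_prop) (by fun_prop) (by fun_prop)).imp
      (mem (X := fun p => 3 * p.2.2 + 5) (x := fun _ => 0) (by fun_prop) (by fun_prop)))
  have head := forall_mem
    (by fun_prop : Primrec fun a : RecSystem × Call (Var ℕ) => a.1.allRules)
    (forall_mem (by fun_prop : Primrec fun p : _ × (ℕ × Rule) => p.2.2.head)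
    ((label.{u} (N := N) (i := fun p => p.1.2.1) (R := fun p => p.1.2.2) (x := fun _ => v)
      (by fun_prop) (by fun_prop) (by fun_prop)).imp
      (mem (X := fun p => 3 * p.2.src + 5) (x := fun _ => v) (by fun_prop) (by fun_prop))))
  have eqs := forall_mem
    (by fun_prop : Primrec fun a : RecSystem × Call (Var ℕ) => a.1.allRules)
    (forall_mem (by fun_prop : Primrec fun p : _ × (ℕ × Rule) => p.2.2.pure.eqs)
    (all (x := fun _ => 3) (by fun_prop)
    ((label.{u} (N := N) (i := fun p => p.1.2.1) (R := fun p => p.1.2.2) (x := fun _ => 3)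
      (by fun_prop) (by fun_prop) (by fun_prop)).imp
      ((mem (X := fun p => 3 * p.2.1 + 5) (x := fun _ => 3) (by fun_prop) (by fun_prop)).iff
      (mem (X := fun p => 3 * p.2.2 + 5) (x := fun _ => 3) (by fun_prop) (by fun_prop))))))
  have call := forall_mem
    (by fun_prop : Primrec fun a : RecSystem × Call (Var ℕ) => a.1.allRules)
    (forall_getElem? (by fun_prop : Primrec fun p : _ × (ℕ × Rule) => p.2.2.tail)
    (forall_getElem? (by fun_prop : Primrec fun p : _ × (ℕ × Call ℕ) => p.2.2.args)
    (forall_some (by fun_prop : Primrec fun p : (((RecSystem × Call (Var ℕ)) × (ℕ × Rule)) ×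
      (ℕ × Call ℕ)) × (ℕ × ℕ) => (p.1.1.1.1.params p.1.2.2.pred)[p.2.1]?)
    (all (x := fun _ => 3) (by fun_prop)
    ((label.{u} (N := N) (i := fun p => p.1.1.1.2.1) (R := fun p => p.1.1.1.2.2) (x := fun _ => 3)
      (by fun_prop) (by fun_prop) (by fun_prop)).imp
    (all (x := fun _ => 4) (by fun_prop)
    ((isChild (k := fun p => p.1.1.2.1) (x := fun _ => 3) (y := fun _ => 4) (by fun_prop)
      (by fun_prop) (by fun_prop)).imp
      ((mem (X := fun p => 3 * p.1.2.2 + 5) (x := fun _ => 3) (by fun_prop) (by fun_prop)).iff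
      (mem (X := fun p => 3 * p.2 + 5) (x := fun _ => 4) (by fun_prop) (by fun_prop))))))))))
  refine (root.and (head.and (eqs.and call))).congr fun a L n S ι ν => ?_
  simp only [RecSystem.mem_allRules, Prod.forall, Function.update_self, ne_eq,
    Nat.reduceEqDiff, not_false_eq_true, Function.update_of_ne]
  constructor
  · rintro ⟨h1, h2, h3, h4⟩
    exact ⟨h1, h2, fun i R hR e he => h3 i R hR e.1 e.2 he,
      fun i R hR k o ho s y x hy hx => h4 i R hR k o ho s y hy x hx⟩
  · rintro ⟨h1, h2, h3, h4⟩
    exact ⟨h1, h2, fun i R hR a b he => h3 i R hR (a, b) he,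
      fun i R hR k o ho s y hy x hx => h4 i R hR k o ho s y x hy hx⟩

theorem primrecPred_mod : PrimrecPred fun k : ℕ => k % 3 = 2 ∧ 5 ≤ k :=
  (Primrec.eq.comp (Primrec.nat_mod.comp Primrec.id (Primrec.const 3)) (Primrec.const 2)).and
    (Primrec.nat_le.comp (Primrec.const 5) Primrec.id)

theorem val {g : α → RecSystem × Call (Var ℕ)} {x : α → ℕ} (hg : Primrec g) (hx : Primrec x) (v : ℕ) :
    Definable.{u} (N := N) fun a _ _ S ι ν =>
      (markingOf ν).Val (g a).1 S (g a).2.pred (SepLog.argValue S ι (g a).2.args) (ι 0) (x a)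
        (ι 1) (ι v) := by
  refine ((((isClosed.{u} (N := N) v).comp hg).imp (mem (X := fun a => 3 * x a + 5)
    (x := fun _ => 1) (by fun_prop) (by fun_prop))).allFamily primrecPred_mod).congr
      fun a L n S ι ν => ?_
  constructor
  · intro h V hV
    -- The family `V` is written into the residue class `2`, which leaves the marking intact.
    have := h (fun k => if k % 3 = 2 ∧ 5 ≤ k then V ((k - 5) / 3) else ν k)
      (fun k hk => if_neg hk)
    have hm : markingOf (fun k => if k % 3 = 2 ∧ 5 ≤ k then V ((k - 5) / 3) else ν k) =
        markingOf ν := markingOf_congr fun k _ hk => if_neg fun h => hk h.1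
    have hV' : ∀ x, (if (3 * x + 5) % 3 = 2 ∧ 5 ≤ 3 * x + 5 then V ((3 * x + 5 - 5) / 3)
        else ν (3 * x + 5)) = V x := by
      intro x
      rw [if_pos (by omega)]
      congr 1
      omega
    simp only [hm, hV'] at this
    exact this hV
  · intro h ν' hν' hcl
    have hm : markingOf ν' = markingOf ν := markingOf_congr fun k _ hk => hν' k fun h => hk h.1
    rw [hm] at hcl
    exact h _ hcl

/-- A node of a marking with its label. -/
abbrev NodeParam := (RecSystem × Call (Var ℕ)) × (ℕ × Rule)

/-- Roles of the first-order variables: `0` is the root, `1` the node, `2` and `5` are values, `3`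
is another node, and `4` is a child, with `5` as a second child where uniqueness is stated. The set
variable `0` holds `A`. -/
theorem nodeOk :
    Definable.{u} (N := N) fun (a : NodeParam) _ _ S ι ν =>
      (markingOf ν).NodeOk a.1.1 S a.1.2.pred (SepLog.argValue S ι a.1.2.args) (ν 0) (ι 0)
        a.2.1 a.2.2 (ι 1) := by
  have hmem := mem.{u} (N := N) (X := fun _ : NodeParam => 0) (x := fun _ => 1) (by fun_prop)
    (by fun_prop)
  have unique := forall_mem (by fun_prop : Primrec fun a : NodeParam => a.1.1.allRules)
    ((label.{u} (N := N) (i := fun p => p.2.1) (R := fun p => p.2.2) (x := fun _ => 1)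
      (by fun_prop) (by fun_prop) (by fun_prop)).imp
      (ofEq (f := fun p => p.1.2) (g := fun p => p.2) (by fun_prop) (by fun_prop)))
  have cell := forall_mem (by fun_prop : Primrec fun a : NodeParam => a.2.2.head)
    ((ofLE.{u} (N := N) (f := fun p => p.2.dst.length) (g := fun _ => N) (by fun_prop)
      (by fun_prop)).and
    (forall_lt (m := fun _ => N) (by fun_prop)
    ((forall_some (by fun_prop : Primrec fun p : (NodeParam × PointsTo ℕ) × ℕ => p.1.2.dst[p.2]?)
      (ex (x := fun _ => 2) (by fun_prop)
      ((val (g := fun p => p.1.1.1.1) (x := fun p => p.2) (by fun_prop) (by fun_prop) 2).and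
      (edge (k := fun p => p.1.2 + 1) (x := fun _ => 1) (y := fun _ => 2) (by fun_prop)
        (by fun_prop) (by fun_prop))))).and
    ((ofEq (f := fun p => p.1.2.dst[p.2]?) (g := fun _ => none) (by fun_prop) (by fun_prop)).imp
      (all (x := fun _ => 2) (by fun_prop) (edge (k := fun p => p.2 + 1) (x := fun _ => 1)
        (y := fun _ => 2) (by fun_prop) (by fun_prop) (by fun_prop)).not)))))
  have total := forall_mem
    (by fun_prop : Primrec fun a : NodeParam => a.1.1.params a.2.1 ++ a.2.2.exVars)
    (ex (x := fun _ => 2) (by fun_prop)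
    (val.{u} (N := N) (g := fun p => p.1.1) (x := fun p => p.2) (by fun_prop) (by fun_prop) 2))
  have functional := forall_mem
    (by fun_prop : Primrec fun a : NodeParam => a.1.1.params a.2.1 ++ a.2.2.exVars)
    (all (x := fun _ => 2) (by fun_prop) (all (x := fun _ => 5) (by fun_prop)
    ((val.{u} (N := N) (g := fun p => p.1.1) (x := fun p => p.2) (by fun_prop) (by fun_prop) 2).imp
    ((val (g := fun p => p.1.1) (x := fun p => p.2) (by fun_prop) (by fun_prop) 5).imp
    (eq (x := fun _ => 2) (y := fun _ => 5) (by fun_prop) (by fun_prop))))))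
  have neqs := forall_mem (by fun_prop : Primrec fun a : NodeParam => a.2.2.pure.neqs)
    (all (x := fun _ => 2) (by fun_prop)
    ((val.{u} (N := N) (g := fun p => p.1.1) (x := fun p => p.2.1) (by fun_prop)
      (by fun_prop) 2).and
    (val (g := fun p => p.1.1) (x := fun p => p.2.2) (by fun_prop) (by fun_prop) 2)).not)
  have child := forall_getElem? (by fun_prop : Primrec fun a : NodeParam => a.2.2.tail)
    (ex (x := fun _ => 4) (by fun_prop)
    ((isChild.{u} (N := N) (k := fun p => p.2.1) (x := fun _ => 1) (y := fun _ => 4) (by fun_prop)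
      (by fun_prop) (by fun_prop)).and
    (exists_mem (by fun_prop : Primrec fun p : NodeParam × (ℕ × Call ℕ) =>
      p.1.1.1.rules p.2.2.pred)
    (label (i := fun p => p.1.2.2.pred) (R := fun p => p.2) (x := fun _ => 4) (by fun_prop)
      (by fun_prop) (by fun_prop)))))
  have childUnique := forall_lt (by fun_prop : Primrec fun a : NodeParam => a.2.2.tail.length)
    (all (x := fun _ => 4) (by fun_prop) (all (x := fun _ => 5) (by fun_prop)
    ((isChild.{u} (N := N) (k := fun p => p.2) (x := fun _ => 1) (y := fun _ => 4) (by fun_prop)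
      (by fun_prop) (by fun_prop)).imp
    ((isChild (k := fun p => p.2) (x := fun _ => 1) (y := fun _ => 5) (by fun_prop)
      (by fun_prop) (by fun_prop)).imp
    (eq (x := fun _ => 4) (y := fun _ => 5) (by fun_prop) (by fun_prop))))))
  have neRoot := forall_lt (by fun_prop : Primrec fun a : NodeParam => a.2.2.tail.length)
    (isChild.{u} (N := N) (k := fun p => p.2) (x := fun _ => 1) (y := fun _ => 0) (by fun_prop)
      (by fun_prop) (by fun_prop)).not
  have parent := forall_lt (by fun_prop : Primrec fun a : NodeParam => a.2.2.tail.length)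
    (forall_mem (by fun_prop : Primrec fun p : NodeParam × ℕ => p.1.1.1.allRules)
    (forall_lt (by fun_prop : Primrec fun p : (NodeParam × ℕ) × (ℕ × Rule) => p.2.2.tail.length)
    (all (x := fun _ => 3) (by fun_prop)
    ((label.{u} (N := N) (i := fun p => p.1.2.1) (R := fun p => p.1.2.2) (x := fun _ => 3)
      (by fun_prop) (by fun_prop) (by fun_prop)).imp
    (all (x := fun _ => 4) (by fun_prop)
    ((isChild (k := fun p => p.1.1.2) (x := fun _ => 1) (y := fun _ => 4) (by fun_prop)
      (by fun_prop) (by fun_prop)).imp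
    ((isChild (k := fun p => p.2) (x := fun _ => 3) (y := fun _ => 4) (by fun_prop)
      (by fun_prop) (by fun_prop)).imp
    ((eq (x := fun _ => 1) (y := fun _ => 3) (by fun_prop) (by fun_prop)).and
    (ofEq (f := fun p => p.1.1.2) (g := fun p => p.2) (by fun_prop) (by fun_prop))))))))))
  refine (hmem.and (unique.and (cell.and (total.and (functional.and (neqs.and (child.and
    (childUnique.and (neRoot.and parent))))))))).congr fun a L n S ι ν => ?_
  simp only [RecSystem.mem_allRules, Prod.forall, Function.update_self, ne_eq,
    Nat.reduceEqDiff, not_false_eq_true, Function.update_of_ne, argValue_update, Nat.reduceLT]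
  constructor
  · rintro ⟨h1, h2, h3, h4, h5, h6, h7, h8, h9, h10⟩
    exact ⟨h1, fun i' R' hR' hl => Prod.ext_iff.1 (h2 i' R' hR' hl), h3, h4, h5,
      fun e he => h6 e.1 e.2 he, h7, h8, h9,
      fun k hk i' R' hR' k' hk' l' hl' c hc hc' => h10 k hk i' R' hR' k' hk' l' hl' c hc hc'⟩
  · rintro ⟨h1, h2, h3, h4, h5, h6, h7, h8, h9, h10⟩
    exact ⟨h1, fun i' R' hR' hl => Prod.ext_iff.2 (h2 i' R' hR' hl), h3, h4, h5,
      fun a b he => h6 (a, b) he, h7, h8, h9,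
      fun k hk i' R' hR' k' hk' l' hl' c hc hc' => h10 k hk i' R' hR' k' hk' l' hl' c hc hc'⟩

theorem isMarking :
    Definable.{u} (N := N) fun (a : RecSystem × Call (Var ℕ)) _ _ S ι ν =>
      IsMarking a.1 S a.2.pred (SepLog.argValue S ι a.2.args) (ν 0) (ι 0) (markingOf ν) := by
  have root := exists_mem
    (by fun_prop : Primrec fun a : RecSystem × Call (Var ℕ) => a.1.rules a.2.pred)
    (label.{u} (N := N) (i := fun p => p.1.2.pred) (R := fun p => p.2) (x := fun _ => 0)
      (by fun_prop) (by fun_prop) (by fun_prop))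
  have cover := all (x := fun _ => 1) (by fun_prop)
    ((mem.{u} (N := N) (X := fun _ => 0) (x := fun _ => 1) (by fun_prop) (by fun_prop)).imp
    (exists_mem (by fun_prop : Primrec fun a : RecSystem × Call (Var ℕ) => a.1.allRules)
    (label (i := fun p => p.2.1) (R := fun p => p.2.2) (x := fun _ => 1)
      (by fun_prop) (by fun_prop) (by fun_prop))))
  have node := forall_mem
    (by fun_prop : Primrec fun a : RecSystem × Call (Var ℕ) => a.1.allRules)
    (all (x := fun _ => 1) (by fun_prop)
    ((label.{u} (N := N) (i := fun p => p.2.1) (R := fun p => p.2.2) (x := fun _ => 1)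
      (by fun_prop) (by fun_prop) (by fun_prop)).imp nodeOk))
  have closed := forall_mem
    (by fun_prop : Primrec fun a : RecSystem × Call (Var ℕ) => a.1.allRules)
    (forall_lt (by fun_prop : Primrec fun p : _ × (ℕ × Rule) => p.2.2.tail.length)
    (all (x := fun _ => 3) (by fun_prop)
    ((label.{u} (N := N) (i := fun p => p.1.2.1) (R := fun p => p.1.2.2) (x := fun _ => 3)
      (by fun_prop) (by fun_prop) (by fun_prop)).imp
    ((mem (X := fun _ => 1) (x := fun _ => 3) (by fun_prop) (by fun_prop)).imp
    (all (x := fun _ => 4) (by fun_prop)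
    ((isChild (k := fun p => p.2) (x := fun _ => 3) (y := fun _ => 4) (by fun_prop)
      (by fun_prop) (by fun_prop)).imp
    (mem (X := fun _ => 1) (x := fun _ => 4) (by fun_prop) (by fun_prop))))))))
  -- Reachability is expressed through all sets, held by the set variable `1`, that contain the root
  -- and are closed under taking children.
  have reach := allSO (X := fun _ => 1) (by fun_prop)
    ((mem.{u} (N := N) (X := fun _ : RecSystem × Call (Var ℕ) => 1) (x := fun _ => 0)
      (by fun_prop) (by fun_prop)).imp (closed.imp (all (x := fun _ => 3) (by fun_prop)
    ((mem (X := fun _ => 0) (x := fun _ => 3) (by fun_prop) (by fun_prop)).imp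
    (mem (X := fun _ => 1) (x := fun _ => 3) (by fun_prop) (by fun_prop))))))
  refine (root.and (cover.and (node.and reach))).congr fun a L n S ι ν => ?_
  simp only [RecSystem.mem_allRules, Prod.forall, Prod.exists, Function.update_self, ne_eq,
    Nat.reduceEqDiff, not_false_eq_true, Function.update_of_ne, argValue_update, Nat.reduceLT,
    markingOf_update, zero_ne_one]
  constructor
  · rintro ⟨h1, h2, h3, h4⟩
    exact ⟨h1, h2, h3, h4⟩
  · rintro ⟨h1, h2, h3, h4⟩
    exact ⟨h1, h2, h3, h4⟩

/-- The first conjunct is needed because an undefined pointer variable must falsify the call,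
whereas in the marking it would merely leave one parameter unconstrained by the root. -/
theorem call :
    Definable.{u} (N := N) fun (a : RecSystem × Call (Var ℕ)) _ _ S ι ν =>
      (∀ (s : ℕ) (y : Var ℕ), a.2.args[s]? = some y → ∃ v, SepLog.valueOf S ι y = some v) ∧
      ∃ r m, IsMarking a.1 S a.2.pred (SepLog.argValue S ι a.2.args) (ν 0) r m := by
  have args := forall_getElem?
    (by fun_prop : Primrec fun a : RecSystem × Call (Var ℕ) => a.2.args)
    (ex (x := fun _ => 0) (by fun_prop)
    (valueOf.{u} (N := N) (y := fun p => p.2.2) (v := fun _ => 0) (by fun_prop) (by fun_prop)))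
  have marking := ex (x := fun _ => 0) (by fun_prop) (isMarking.{u} (N := N).exFamily
    (Primrec.nat_le.comp (Primrec.const 3) Primrec.id : PrimrecPred fun k : ℕ => 3 ≤ k))
  refine (args.and marking).congr fun a L n S ι ν => ?_
  simp only [Function.update_self, valueOf_update, argValue_update, Nat.reduceLT]
  refine and_congr_right fun _ => exists_congr fun r => ?_
  constructor
  · rintro ⟨ν', h, h'⟩
    rw [h 0 (by omega)] at h'
    exact ⟨_, h'⟩
  · rintro ⟨m, hm⟩
    obtain ⟨ν', h, rfl⟩ := exists_markingOf m ν
    refine ⟨ν', h, ?_⟩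
    rwa [h 0 (by omega)]

end Definable

-- Definability of separating conjunctions

namespace Definable

variable {N : ℕ} {α β : Type} [Primcodable α] [Primcodable β]

/-- A property which depends on the set variable `0` can be applied to another set variable. -/
theorem atSet {Q : α → ∀ (Loc : Type u) (null : Loc), State Loc null N → (ℕ → Loc) → Set Loc → Prop}
    (h : Definable fun a L n S ι ν => Q a L n S ι (ν 0)) {X : α → ℕ} (hX : Primrec X)
    (hX0 : ∀ a, X a ≠ 0) : Definable fun a L n S ι ν => Q a L n S ι (ν (X a)) := by
  have heq := all.{u} (N := N) (x := fun _ => 3) (by fun_prop)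
    ((mem (X := fun _ : α => 0) (x := fun _ => 3) (by fun_prop) (by fun_prop)).iff
      (mem (X := X) (x := fun _ => 3) (by fun_prop) (by fun_prop)))
  refine (exSO (X := fun _ => 0) (by fun_prop) (heq.and h)).congr fun a L n S ι ν => ?_
  simp only [Function.update_self, Function.update_of_ne (hX0 a), ← Set.ext_iff]
  exact ⟨fun ⟨A, e, h⟩ => e ▸ h, fun h => ⟨_, rfl, h⟩⟩

theorem star
    {Q Q' : α → ∀ (Loc : Type u) (null : Loc), State Loc null N → (ℕ → Loc) → Set Loc → Prop}
    (h : Definable fun a L n S ι ν => Q a L n S ι (ν 0))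
    (h' : Definable fun a L n S ι ν => Q' a L n S ι (ν 0)) :
    Definable fun a L n S ι ν => ∃ B C, (∀ l, l ∈ ν 0 ↔ l ∈ B ∨ l ∈ C) ∧ Disjoint B C ∧
      Q a L n S ι B ∧ Q' a L n S ι C := by
  have union := all.{u} (N := N) (x := fun _ => 3) (by fun_prop)
    ((mem (X := fun _ : α => 0) (x := fun _ => 3) (by fun_prop) (by fun_prop)).iff
      ((mem (X := fun _ => 1) (x := fun _ => 3) (by fun_prop) (by fun_prop)).or
      (mem (X := fun _ => 2) (x := fun _ => 3) (by fun_prop) (by fun_prop))))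
  have disj := all.{u} (N := N) (x := fun _ => 3) (by fun_prop)
    ((mem (X := fun _ : α => 1) (x := fun _ => 3) (by fun_prop) (by fun_prop)).imp
      (mem (X := fun _ => 2) (x := fun _ => 3) (by fun_prop) (by fun_prop)).not)
  refine (exSO (X := fun _ => 1) (by fun_prop) (exSO (X := fun _ => 2) (by fun_prop)
    (union.and (disj.and ((h.atSet (X := fun _ => 1) (by fun_prop) (by simp)).and
      (h'.atSet (X := fun _ => 2) (by fun_prop) (by simp))))))).congr fun a L n S ι ν => ?_
  simp [Set.disjoint_left]

/-- The part `B k` is held by the set variable `k + 3`. The formula for `Q` may bind the same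
variables inside; there is no conflict, since by its type `Q` sees only one set, supplied through
`atSet`. -/
theorem bigStar {l : α → List β}
    {Q : α × β → ∀ (Loc : Type u) (null : Loc), State Loc null N → (ℕ → Loc) → Set Loc → Prop}
    (hl : Primrec l) (h : Definable fun a L n S ι ν => Q a L n S ι (ν 0)) :
    Definable fun a L n S ι ν => ∃ B, IsPartition (l a).length B (ν 0) ∧
      ∀ k b, (l a)[k]? = some b → Q (a, b) L n S ι (B k) := by
  have union := all.{u} (N := N) (x := fun _ => 3) (by fun_prop)
    ((mem (X := fun _ : α => 0) (x := fun _ => 3) (by fun_prop) (by fun_prop)).iff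
      ((mem (X := fun p : α × ℕ => p.2 + 3) (x := fun _ => 3) (by fun_prop) (by fun_prop)).exists_lt
        (m := fun a => (l a).length) (by fun_prop)))
  have disj := forall_lt (m := fun a => (l a).length) (by fun_prop)
    (forall_lt (m := fun p : α × ℕ => (l p.1).length) (by fun_prop)
    (all (x := fun _ => 3) (by fun_prop)
    ((mem.{u} (N := N) (X := fun p => p.1.2 + 3) (x := fun _ => 3) (by fun_prop) (by fun_prop)).imp
    ((mem (X := fun p => p.2 + 3) (x := fun _ => 3) (by fun_prop) (by fun_prop)).imp
    (ofEq (f := fun p => p.1.2) (g := fun p => p.2) (by fun_prop) (by fun_prop))))))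
  have parts := forall_getElem? hl ((h.comp (by fun_prop :
    Primrec fun p : α × (ℕ × β) => (p.1, p.2.2))).atSet (X := fun p => p.2.1 + 3) (by fun_prop)
      (by simp))
  refine ((union.and (disj.and parts)).exFamily (Primrec.nat_le.comp (Primrec.const 3) Primrec.id :
    PrimrecPred fun k : ℕ => 3 ≤ k)).congr fun a L n S ι ν => ?_
  simp only [Function.update_self]
  constructor
  · rintro ⟨ν', h, h1, h2, h3⟩
    rw [h 0 (by omega)] at h1
    exact ⟨fun k => ν' (k + 3), ⟨h1, h2⟩, h3⟩
  · rintro ⟨B, ⟨h1, h2⟩, h3⟩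
    exact ⟨fun k => if 3 ≤ k then B (k - 3) else ν k, fun k hk => if_neg hk, by simpa using h1,
      by simpa using h2, by simpa using h3⟩

end Definable

/-! ### The translation -/

section Translation

variable {Loc : Type u} {null : Loc} {N : ℕ}

/-- Eliminates the quantifier over lists of locations: as selectors are at most `N`, a bounded
conjunction of edge conditions suffices. -/
theorem exists_cellAt_iff (S : State Loc null N) {V : Type*} (g : V → Option Loc) (dst : List V)
    (a : Loc) : (∃ vs : List Loc, dst.map g = vs.map some ∧ S.CellAt a vs) ↔
      dst.length ≤ N ∧ ∀ k < N,
        (∀ y, dst[k]? = some y → ∃ v, g y = some v ∧ S.heap a (k + 1) = some v) ∧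
        (dst[k]? = none → ∀ v, ¬ S.heap a (k + 1) = some v) := by
  constructor
  · rintro ⟨vs, h1, h2⟩
    have hlen : dst.length = vs.length := by simpa using congrArg List.length h1
    refine ⟨?_, fun k _ => ⟨fun y hy => ?_, fun hy v => ?_⟩⟩
    · by_contra hlt
      have h3 : S.heap a (N + 1) ≠ none := by
        rw [h2 N, List.getElem?_eq_getElem (by omega)]
        simp
      have := (S.heap_sel _ _ h3).2
      omega
    · have := congrArg (fun l => l[k]?) h1
      simp only [List.getElem?_map, hy, ← h2 k, Option.map_some] at this
      cases hv : S.heap a (k + 1) with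
      | none => simp [hv] at this
      | some v => exact ⟨v, by simpa [hv] using this, rfl⟩
    · rw [h2 k, List.getElem?_eq_none (by simpa [hlen] using hy)]
      simp
  · rintro ⟨h1, h2⟩
    refine ⟨dst.map fun y => (g y).getD null, ?_, fun k => ?_⟩
    · rw [map_eq_map_some_iff_of_forall fun y hy => ?_]
      obtain ⟨k, hk⟩ := List.mem_iff_getElem?.1 hy
      have hk' := (List.getElem?_eq_some_iff.1 hk).1
      obtain ⟨v, hv, -⟩ := (h2 k (by omega)).1 y hk
      simp [hv]
    · rw [List.getElem?_map]
      by_cases hk : k < N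
      · cases hy : dst[k]? with
        | none => exact Option.eq_none_iff_forall_ne_some.2 ((h2 k hk).2 hy)
        | some y =>
          obtain ⟨v, hv, hv'⟩ := (h2 k hk).1 y hy
          simp [hv, hv']
      · rw [List.getElem?_eq_none (by omega)]
        by_contra hne
        have := (S.heap_sel _ _ hne).2
        omega

/-- The meaning of a pure formula over the first-order variables. -/
def Pure.Means (π : Pure (Var ℕ)) (S : State Loc null N) (ι : ℕ → Loc) : Prop :=
  (∀ e ∈ π.eqs, ∃ l, valueOf S ι e.1 = some l ∧ valueOf S ι e.2 = some l) ∧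
  ∀ e ∈ π.neqs, ∃ l m, valueOf S ι e.1 = some l ∧ valueOf S ι e.2 = some m ∧ l ≠ m

/-- The meaning of a points-to atom over the first-order variables, for a heap with domain `A`. -/
def PointsTo.Means (c : PointsTo (Var ℕ)) (S : State Loc null N) (ι : ℕ → Loc) (A : Set Loc) :
    Prop :=
  ∃ a, valueOf S ι c.src = some a ∧ (∀ l, l ∈ A ↔ l = a) ∧ c.dst.length ≤ N ∧ ∀ k < N,
    (∀ y, c.dst[k]? = some y → ∃ v, valueOf S ι y = some v ∧ S.heap a (k + 1) = some v) ∧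
    (c.dst[k]? = none → ∀ v, ¬ S.heap a (k + 1) = some v)

/-- The meaning of a predicate occurrence over the first-order variables, for a heap with domain
`A`. -/
def Call.Means (P : RecSystem) (c : Call (Var ℕ)) (S : State Loc null N) (ι : ℕ → Loc)
    (A : Set Loc) : Prop :=
  (∀ (s : ℕ) (y : Var ℕ), c.args[s]? = some y → ∃ v, valueOf S ι y = some v) ∧
    ∃ r m, IsMarking P S c.pred (argValue S ι c.args) A r m

/-- The meaning of a basic formula, for a heap with domain `A`. -/
def BasicFormula.Means (φ : BasicFormula) (S : State Loc null N) (ι : ℕ → Loc) (A : Set Loc) :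
    Prop :=
  ∃ ι', (∀ k ∉ φ.exVars.map (· + 10), ι' k = ι k) ∧ φ.pure.Means S ι' ∧
    ∃ B, IsPartition φ.spatial.length B A ∧
      ∀ (k : ℕ) (c : PointsTo (Var ℕ)), φ.spatial[k]? = some c → c.Means S ι' (B k)

/-- The meaning of a top level formula, for a heap with domain `A`. -/
def TopFormula.Means (P : RecSystem) (φ : TopFormula) (S : State Loc null N) (ι : ℕ → Loc)
    (A : Set Loc) : Prop :=
  ∃ ι', (∀ k ∉ φ.exVars.map (· + 10), ι' k = ι k) ∧
    ∃ B C, (∀ l, l ∈ A ↔ l ∈ B ∨ l ∈ C) ∧ Disjoint B C ∧ φ.basic.Means S ι' B ∧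
      ∃ D, IsPartition φ.calls.length D C ∧ 
        ∀ (k : ℕ) (c : Call (Var ℕ)), φ.calls[k]? = some c → c.Means P S ι' (D k)

/-- The logical variables in `xs` have the same value under both interpretations. -/
def Agree (xs : List ℕ) (ι' : ℕ → Option Loc) (ι : ℕ → Loc) : Prop :=
  ∀ x ∈ xs, ι' x = some (ι (x + 10))

theorem Agree.evalVar_eq {xs : List ℕ} {ι' : ℕ → Option Loc} {ι : ℕ → Loc} (h : Agree xs ι' ι)
    (S : State Loc null N) {y : Var ℕ} (hy : y ∈ TopFormula.scope xs) :
    evalVar S.store ι' y = valueOf S ι y := by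
  cases y with
  | inl u => rfl
  | inr x => exact h x (hy x rfl)

/-- Valuations in separation logic are partial and those in MSO are total. They are compared only on
variables in scope, so the arbitrary values elsewhere, including the default `null`, do not matter.
-/
theorem exists_iff_exists_of_agree (null : Loc) {xs ys : List ℕ} {F : (ℕ → Option Loc) → Prop}
    {G : (ℕ → Loc) → Prop} (h : ∀ ι' ι, Agree (xs ++ ys) ι' ι → (F ι' ↔ G ι))
    {ι₀' : ℕ → Option Loc} {ι₀ : ℕ → Loc} (h₀ : Agree ys ι₀' ι₀) :
    (∃ ι', (∀ x ∈ xs, ∃ l, ι' x = some l) ∧ (∀ x ∉ xs, ι' x = ι₀' x) ∧ F ι') ↔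
      ∃ ι, (∀ k ∉ xs.map (· + 10), ι k = ι₀ k) ∧ G ι := by
  constructor
  · rintro ⟨ι', h1, h2, h3⟩
    refine ⟨fun k => if k ∈ xs.map (· + 10) then (ι' (k - 10)).getD null else ι₀ k,
      fun k hk => if_neg hk, (h _ _ fun x hx => ?_).1 h3⟩
    by_cases hx' : x ∈ xs
    · obtain ⟨l, hl⟩ := h1 x hx'
      rw [if_pos (List.mem_map_of_mem hx')]
      simp [hl]
    · rw [if_neg (by simpa using hx'), h2 x hx']
      exact h₀ x ((List.mem_append.1 hx).resolve_left hx')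
  · rintro ⟨ι, h1, h2⟩
    refine ⟨fun x => if x ∈ xs then some (ι (x + 10)) else ι₀' x,
      fun x hx => ⟨_, if_pos hx⟩, fun x hx => if_neg hx, (h _ _ fun x hx => ?_).2 h2⟩
    by_cases hx' : x ∈ xs
    · rw [if_pos hx']
    · rw [if_neg hx', h1 _ (by simpa using hx')]
      exact h₀ x ((List.mem_append.1 hx).resolve_left hx')

theorem Pure.sat_iff_means {π : Pure (Var ℕ)} {xs : List ℕ} {ι' : ℕ → Option Loc} {ι : ℕ → Loc}
    (h : Agree xs ι' ι) (S : State Loc null N) (hπ : π.VarsIn (TopFormula.scope xs)) :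
    π.Sat S.store ι' ↔ π.Means S ι := by
  refine and_congr (forall₂_congr fun e he => ?_) (forall₂_congr fun e he => ?_)
  · rw [h.evalVar_eq S (hπ.1 e he).1, h.evalVar_eq S (hπ.1 e he).2]
  · rw [h.evalVar_eq S (hπ.2 e he).1, h.evalVar_eq S (hπ.2 e he).2]

theorem PointsTo.sat_iff_means {c : PointsTo (Var ℕ)} {xs : List ℕ} {ι' : ℕ → Option Loc}
    {ι : ℕ → Loc} (h : Agree xs ι' ι) (S : State Loc null N) {A : Set Loc} (hA : A ⊆ S.dom)
    (hc : c.WellFormed (TopFormula.scope xs)) :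
    c.Sat (S.restrict A) ι' ↔ c.Means S ι A := by
  rw [PointsTo.sat_restrict S hA hc.2.1, PointsTo.Means]
  refine exists_congr fun a => ?_
  rw [← exists_cellAt_iff, h.evalVar_eq S hc.1,
    List.map_congr_left fun y hy => h.evalVar_eq S (hc.2.2 y hy)]
  have : A = {a} ↔ ∀ l, l ∈ A ↔ l = a := by simp [Set.ext_iff]
  rw [← this]
  constructor
  · rintro ⟨vs, h1, h2, h3, h4⟩
    exact ⟨h1, h3, vs, h2, h4⟩
  · rintro ⟨h1, h3, vs, h2, h4⟩
    exact ⟨vs, h1, h2, h3, h4⟩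

/-- Finiteness of the heap enters here: it makes `A` finite, which is what turns a marking back into
a finite unfolding tree. -/
theorem Call.sat_iff_means {P : RecSystem} (hP : P.WellFormed) (hB : P.IsBtw) {c : Call (Var ℕ)}
    {xs : List ℕ} {ι' : ℕ → Option Loc} {ι : ℕ → Loc} (h : Agree xs ι' ι) (S : State Loc null N)
    {A : Set Loc} (hA : A ⊆ S.dom) (hlen : c.args.length = (P.params c.pred).length)
    (hc : ∀ y ∈ c.args, y ∈ TopFormula.scope xs) :
    SL.Sat P.PredSat (.call c) (S.restrict A) ι' ↔ c.Means P S ι A := by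
  have hfin : A.Finite := S.heap_finite.subset hA
  have key : ∀ vs : List Loc, c.args.map (valueOf S ι) = vs.map some →
      (P.PredSat c.pred vs (S.restrict A) ↔
        ∃ r m, IsMarking P S c.pred (argValue S ι c.args) A r m) := by
    intro vs hvs
    have hlen' : vs.length = (P.params c.pred).length := by
      rw [← hlen]
      simpa using (congrArg List.length hvs).symm
    have harg : argValue S ι c.args = Marking.argOf vs := by
      funext s v
      have := congrArg (fun l => l[s]?) hvs
      simp only [List.getElem?_map] at this
      rw [argValue, Marking.argOf]
      cases hy : c.args[s]? <;> cases hv : vs[s]? <;> simp_all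
    rw [RecSystem.predSat_restrict_iff hP hB.1 S hlen' hA,
      RecSystem.pHolds_iff_exists_isMarking hP hB hlen' hfin, harg]
  change (∃ vs : List Loc, c.args.map (evalVar S.store ι') = vs.map some ∧ _) ↔ _
  rw [List.map_congr_left fun y hy => h.evalVar_eq S (hc y hy)]
  constructor
  · rintro ⟨vs, h1, h2⟩
    refine ⟨fun s y hy => ?_, (key vs h1).1 h2⟩
    have := congrArg (fun l => l[s]?) h1
    simp only [List.getElem?_map, hy, Option.map_some] at this
    cases hv : vs[s]? with
    | none => simp [hv] at this
    | some v => exact ⟨v, by simpa [hv] using this⟩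
  · rintro ⟨h1, h2⟩
    have hvs : c.args.map (valueOf S ι) =
        (c.args.map fun y => (valueOf S ι y).getD null).map some := by
      rw [map_eq_map_some_iff_of_forall fun y hy => ?_]
      obtain ⟨s, hs⟩ := List.mem_iff_getElem?.1 hy
      obtain ⟨v, hv⟩ := h1 s y hs
      simp [hv]
    exact ⟨_, hvs, (key _ hvs).2 h2⟩

theorem BasicFormula.sat_iff_means {I : ℕ → List Loc → State Loc null N → Prop} (hI : StoreMono I)
    {φ : BasicFormula} {xs : List ℕ} {ι' : ℕ → Option Loc} {ι : ℕ → Loc} (h : Agree xs ι' ι)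
    (S : State Loc null N) {A : Set Loc} (hA : A ⊆ S.dom)
    (hpure : φ.pure.VarsIn (TopFormula.scope (φ.exVars ++ xs)))
    (hspatial : ∀ c ∈ φ.spatial, c.WellFormed (TopFormula.scope (φ.exVars ++ xs))) :
    SL.Sat I φ.toSL (S.restrict A) ι' ↔ φ.Means S ι A := by
  rw [BasicFormula.toSL, SL.sat_exs]
  refine exists_iff_exists_of_agree null (fun ι₁' ι₁ h₁ => ?_) h
  refine and_congr (Pure.sat_iff_means h₁ S hpure) ((SL.sat_bigStar_restrict hI S hA).trans ?_)
  rw [List.length_map]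
  refine exists_congr fun B => and_congr_right fun hB => ?_
  simp only [List.getElem?_map, Option.map_eq_some_iff, forall_exists_index, and_imp,
    forall_apply_eq_imp_iff₂]
  refine forall₃_congr fun k c hk => PointsTo.sat_iff_means h₁ S (fun l hl => hA ?_)
    (hspatial c (List.mem_of_getElem? hk))
  exact (hB.1 l).2 ⟨k, (List.getElem?_eq_some_iff.1 hk).1, hl⟩

/-- The interpretation `ι` is arbitrary because a closed formula has no logical variable in its
outer scope. -/
theorem TopFormula.sat_iff_means {P : RecSystem} (hP : P.WellFormed) (hB : P.IsBtw)
    {φ : TopFormula} (hφ : φ.IsClosedOver P) (S : State Loc null N) (ι : ℕ → Loc) :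
    φ.Models P S ↔ φ.Means P S ι S.dom := by
  have hI := P.storeMono_predSat (Loc := Loc) (null := null) (N := N)
  obtain ⟨h1, h2, h3⟩ := hφ
  rw [TopFormula.Models, TopFormula.toSL, SL.sat_exs]
  refine exists_iff_exists_of_agree (ys := []) null (fun ι₁' ι₁ h₁ => ?_) (by simp [Agree])
  rw [List.append_nil] at h₁
  nth_rw 1 [← S.restrict_dom]
  rw [SL.sat_star_restrict hI S subset_rfl]
  refine exists_congr fun B => exists_congr fun C => and_congr_right fun hBC =>
    and_congr_right fun _ => and_congr ?_ ?_
  · exact BasicFormula.sat_iff_means hI h₁ S (fun l hl => (hBC l).2 (.inl hl)) h1 h2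
  · have hC : C ⊆ S.dom := fun l hl => (hBC l).2 (.inr hl)
    rw [SL.sat_bigStar_restrict hI S hC, List.length_map]
    refine exists_congr fun D => and_congr_right fun hD => ?_
    simp only [List.getElem?_map, Option.map_eq_some_iff, forall_exists_index, and_imp,
      forall_apply_eq_imp_iff₂]
    refine forall₃_congr fun k c hk => ?_
    obtain ⟨-, h4, h5⟩ := h3 c (List.mem_of_getElem? hk)
    refine Call.sat_iff_means hP hB h₁ S (fun l hl => hC ?_) h4 h5
    exact (hD.1 l).2 ⟨k, (List.getElem?_eq_some_iff.1 hk).1, hl⟩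

theorem MSO.sat_bigOr {S : State Loc null N} {φs : List MSO} {ι : ℕ → Loc} {ν : ℕ → Set Loc} :
    MSO.Sat S (MSO.bigOr φs) ι ν ↔ ∃ φ ∈ φs, MSO.Sat S φ ι ν := by
  induction φs with
  | nil => simp [MSO.bigOr, MSO.Sat]
  | cons φ φs ih =>
    have : MSO.Sat S (MSO.bigOr (φ :: φs)) ι ν ↔ MSO.Sat S φ ι ν ∨ MSO.Sat S (MSO.bigOr φs) ι ν := by
      simp only [MSO.bigOr, List.foldr_cons, MSO.or, MSO.Sat]
      tauto
    rw [this, ih]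
    simp

theorem MSO.sat_heapDom {S : State Loc null N} {ι : ℕ → Loc} {ν : ℕ → Set Loc} :
    MSO.Sat S (MSO.heapDom N 0) ι ν ↔ ν 0 = S.dom := by
  have h : ∀ l, MSO.Sat S (MSO.bigOr ((List.range N).map fun i => .exFO 1 (.edge (i + 1) 0 1)))
      (Function.update ι 0 l) ν ↔ l ∈ S.dom := by
    intro l
    rw [MSO.sat_bigOr]
    simp only [List.mem_map, List.mem_range, exists_exists_and_eq_and, MSO.Sat,
      Function.update_self, ne_eq, zero_ne_one, not_false_eq_true, Function.update_of_ne]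
    constructor
    · rintro ⟨i, -, v, hv⟩
      exact ⟨i + 1, by simp [hv]⟩
    · rintro ⟨k, hk⟩
      obtain ⟨h1, h2⟩ := S.heap_sel l k hk
      obtain ⟨v, hv⟩ := Option.ne_none_iff_exists'.1 hk
      exact ⟨k - 1, by omega, v, by rwa [Nat.sub_add_cancel h1]⟩
  simp only [MSO.heapDom, MSO.allFO, MSO.iff, MSO.or, MSO.Sat, h, Function.update_self,
    Set.ext_iff]
  push Not
  refine forall_congr' fun l => ?_
  tauto

end Translation

-- Definability of pure, points-to, basic and top level formulae

namespace Definable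

variable {N : ℕ}

theorem pure : Definable.{u} (N := N) fun (π : Pure (Var ℕ)) _ _ S ι _ => π.Means S ι := by
  have eqs := forall_mem (by fun_prop : Primrec fun π : Pure (Var ℕ) => π.eqs)
    (ex (x := fun _ => 0) (by fun_prop)
    ((valueOf.{u} (N := N) (y := fun p => p.2.1) (v := fun _ => 0) (by fun_prop) (by fun_prop)).and
    (valueOf (y := fun p => p.2.2) (v := fun _ => 0) (by fun_prop) (by fun_prop))))
  have neqs := forall_mem (by fun_prop : Primrec fun π : Pure (Var ℕ) => π.neqs)
    (ex (x := fun _ => 0) (by fun_prop) (ex (x := fun _ => 1) (by fun_prop)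
    ((valueOf.{u} (N := N) (y := fun p => p.2.1) (v := fun _ => 0) (by fun_prop) (by fun_prop)).and
    ((valueOf (y := fun p => p.2.2) (v := fun _ => 1) (by fun_prop) (by fun_prop)).and
    (eq (x := fun _ => 0) (y := fun _ => 1) (by fun_prop) (by fun_prop)).not))))
  refine (eqs.and neqs).congr fun π L n S ι ν => ?_
  simp only [Pure.Means, Function.update_self, ne_eq, zero_ne_one, not_false_eq_true,
    Function.update_of_ne, valueOf_update, Nat.reduceLT]

theorem pointsTo :
    Definable.{u} (N := N) fun (c : PointsTo (Var ℕ)) _ _ S ι ν => c.Means S ι (ν 0) := by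
  have src := valueOf.{u} (N := N) (y := fun c : PointsTo (Var ℕ) => c.src) (v := fun _ => 0)
    (by fun_prop) (by fun_prop)
  have single := all.{u} (N := N) (x := fun _ => 1) (by fun_prop)
    ((mem (X := fun _ : PointsTo (Var ℕ) => 0) (x := fun _ => 1) (by fun_prop) (by fun_prop)).iff
    (eq (x := fun _ => 1) (y := fun _ => 0) (by fun_prop) (by fun_prop)))
  have len := ofLE.{u} (N := N) (f := fun c : PointsTo (Var ℕ) => c.dst.length) (g := fun _ => N)
    (by fun_prop) (by fun_prop)
  have cell := forall_lt (m := fun _ : PointsTo (Var ℕ) => N) (by fun_prop)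
    ((forall_some (by fun_prop : Primrec fun p : PointsTo (Var ℕ) × ℕ => p.1.dst[p.2]?)
      (ex (x := fun _ => 2) (by fun_prop)
      ((valueOf.{u} (N := N) (y := fun p => p.2) (v := fun _ => 2) (by fun_prop)
        (by fun_prop)).and
      (edge (k := fun p => p.1.2 + 1) (x := fun _ => 0) (y := fun _ => 2) (by fun_prop)
        (by fun_prop) (by fun_prop))))).and
    ((ofEq (f := fun p => p.1.dst[p.2]?) (g := fun _ => none) (by fun_prop) (by fun_prop)).imp
      (all (x := fun _ => 2) (by fun_prop) (edge (k := fun p => p.2 + 1) (x := fun _ => 0)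
        (y := fun _ => 2) (by fun_prop) (by fun_prop) (by fun_prop)).not)))
  refine (ex (x := fun _ => 0) (by fun_prop) (src.and (single.and (len.and cell)))).congr
    fun c L n S ι ν => ?_
  simp only [PointsTo.Means, Function.update_self, ne_eq, zero_ne_one, not_false_eq_true,
    Function.update_of_ne, valueOf_update, Nat.reduceLT, OfNat.zero_ne_ofNat]

theorem primrec_shift {α : Type} [Primcodable α] {f : α → List ℕ} (hf : Primrec f) :
    Primrec fun a => (f a).map (· + 10) :=
  Primrec.list_map hf (by fun_prop : Primrec fun p : α × ℕ => p.2 + 10).to₂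

theorem basicFormula :
    Definable.{u} (N := N) fun (φ : BasicFormula) _ _ S ι ν => φ.Means S ι (ν 0) :=
  exList (primrec_shift BasicFormula.primrec_exVars)
    ((pure.comp BasicFormula.primrec_pure).and (bigStar BasicFormula.primrec_spatial
      (pointsTo.comp (by fun_prop : Primrec fun p : BasicFormula × PointsTo (Var ℕ) => p.2))))

theorem topFormula :
    Definable.{u} (N := N) fun (p : RecSystem × TopFormula) _ _ S ι ν =>
      p.2.Means p.1 S ι (ν 0) := by
  have calls := bigStar (by fun_prop : Primrec fun p : RecSystem × TopFormula => p.2.calls)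
    (Q := fun p L n S ι A => p.2.Means p.1.1 S ι A)
    (call.{u} (N := N).comp (by fun_prop :
      Primrec fun p : (RecSystem × TopFormula) × Call (Var ℕ) => (p.1.1, p.2)))
  exact exList (primrec_shift (by fun_prop : Primrec fun p : RecSystem × TopFormula => p.2.exVars))
    (star (basicFormula.comp (by fun_prop : Primrec fun p : RecSystem × TopFormula => p.2.basic))
      calls)

end Definable

end SepLog

-- The main theorem

theorem mainTheorem3 (N : ℕ) (hN : 0 < N) :
    ∃ tr : SepLog.RecSystem × SepLog.TopFormula → SepLog.MSO,
      Computable (fun φ => (tr φ).code) ∧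
      ∀ (P : SepLog.RecSystem) (φ : SepLog.TopFormula),
        P.WellFormed → P.IsBtw → φ.IsClosedOver P →
        (tr (P, φ)).freeFO = ∅ ∧ (tr (P, φ)).freeSO ⊆ {0} ∧
        ∀ (Loc : Type*) [Countable Loc] [Infinite Loc] (null : Loc)
          (S : SepLog.State Loc null N),
          φ.Models P S ↔
            SepLog.MSO.Models S (.exSO 0 (.and (tr (P, φ)) (SepLog.MSO.heapDom N 0))) := by
  obtain ⟨f, hf, hfQ⟩ := SepLog.Definable.topFormula.exists_closed (N := N)
  refine ⟨f, hf.to_comp, fun P φ hP hB hφ => ⟨(hfQ _).1, (hfQ _).2.1, fun Loc _ _ null S => ?_⟩⟩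
  have hsat := (hfQ (P, φ)).2.2 Loc null S
  constructor
  · intro h ι ν
    -- `Heap(X)` leaves `S.dom` as the only possible value of `X`.
    refine ⟨S.dom, (hsat ..).2 ⟨ι, ?_⟩, SepLog.MSO.sat_heapDom.2 (by simp)⟩
    simpa using (SepLog.TopFormula.sat_iff_means hP hB hφ S ι).1 h
  · intro h
    -- Any interpretation serves here, as the translated sentence has no free variables.
    obtain ⟨A, h1, h2⟩ := h (fun _ => null) fun _ => ∅
    obtain ⟨ι, hι⟩ := (hsat ..).1 h1
    rw [SepLog.MSO.sat_heapDom.1 h2] at hι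
    exact (SepLog.TopFormula.sat_iff_means hP hB hφ S ι).2 hι
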